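/- **Setting.** Fix $T>0$ and $d$. All distributions are tempered and, where this applies, $\mathbb R^d$-valued. Fix a dyadic partition of unity $(\chi,\rho)$ on $\mathbb R^d$: $\chi,\rho\in C^\infty(\mathbb R^d,\mathbb R)$ are radial, $\chi$ is supported in a ball and $\rho$ in an annulus $\{a\le|x|\le b'\}$ with $a,b'>0$, $\chi+\sum_{j\ge0}\rho(2^{-j}\cdot)\equiv1$, $\operatorname{supp}\chi\cap\operatorname{supp}\rho(2^{-j}\cdot)=\emptyset$ for $j\ge1$, and $\operatorname{supp}\rho(2^{-i}\cdot)\cap\operatorname{supp}\rho(2^{-j}\cdot)=\emptyset$ for $|i-j|\ge2$. Put $\rho_{-1}=\chi$, $\rho_j=\rho(2^{-j}\cdot)$ for $j\ge 0$, and $\Delta_jf=\mathscr F^{-1}(\rho_j\hat f)$ for $j\ge-1$. Let $\mathcal C^\alpha=B^\alpha_{\infty,\infty}$ be the space with norm $\|f\|_{\mathcal C^\alpha}=\sup_{j\ge-1}2^{j\alpha}\|\Delta_jf\|_{L^\infty}$, and let $C^\gamma_T\mathcal C^\alpha$ be the space of $\gamma$-Hölder continuous functions $[0,T]\to\mathcal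 C^\alpha$. A *local time* of a measurable path $w:[0,T]\to\mathbb R^d$ is a measurable $L:[0,T]\times\mathbb R^d\to[0,\infty)$ with $L_0\equiv0$ and $\lambda\{s\in[0,t]: w_s\in A\}=\int_AL_t(z)\,dz$ for all Borel sets $A$ and $t\in[0,T]$, where $\lambda$ is Lebesgue measure. The path $w$ is *infinitely regularizing* if it has a local time $L$ and $L\in C^\gamma_T\mathcal C^\alpha$ for all $\gamma\in(1/2,1)$ and $\alpha\in\mathbb R$. For a continuous infinitely regularizing $w$ and $b\in\mathscr S'$, the *averaging operator* is $T^w_tb(x)=\langle b,L_t(\cdot-x)\rangle$, where $L_t$ denotes its smooth, compactly supported version, and $T^w_{s,t}b=T^w_tb-T^w_sb$; for continuous $b$ this is $T^w_{s,t}b(x)=\int_s^tb(x+w_r)\,dr$. For $\theta:[0,\tau]\to\mathbb R^d$ put $\Xi_{s,t}=T^w_{s,t}b(\theta_s)$. The *non-linear Young integral* $I_t=\int_0^tT^w_{dr}b(\theta_r)$, $t\in[0,\tau]$, is defined if for some $\beta>1$ and $C<\infty$ one has $|\Xi_{s,t}-\Xi_{s,u}-\Xi_{u,t}|\le C|t-s|^\beta$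 for all $0\le s\le u\le t\le\tau$; it is then the unique function with $I_0=0$ and $|I_t-I_s-\Xi_{s,t}|\le C'|t-s|^\beta$ for some $C'<\infty$ and all $0\le s\le t\le\tau$. A function $y\in C([0,\tau],\mathbb R^d)$, $\tau\le T$, *solves* $y_t=x+\int_0^tb(y_r)\,dr+w_t$ on $[0,\tau]$ if $\theta=y-w$ is $\varepsilon$-Hölder continuous on $[0,\tau]$ for some $\varepsilon>0$ and $\theta_t=x+\int_0^tT^w_{dr}b(\theta_r)$ for all $t\in[0,\tau]$ (with the non-linear Young integral defined). A function solves the equation on an interval $J\ni0$ with left end point $0$ if it does so on $[0,\tau]$ for every $\tau\in J$. **Theorem 1.2.** Let $w:[0,T]\to\mathbb R^d$ be continuous and infinitely regularizing, and let $b\in\mathscr S'$. Then for every $x\in\mathbb R^d$ there is $T^*(x)\in(0,T]\cup\{\infty\}$ such that $$y^x_t=x+\int_0^tb(y^x_r)\,dr+w_t$$ has a unique solution $y^x$ on $[0,T^*(x))\cap[0,T]$. The time $T^*(x)$ is maximal: if $z$ solves the equation on $[0,\tau]$ for some $\tau\in[0,T]$, then $\tau<T^*(x)$ and $z=y^x$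 on $[0,\tau]$. If $T^*(x)<\infty$, then $\lim_{t\uparrow T^*(x)}|y^x_t|=\infty$. The map $x\mapsto T^*(x)^{-1}$ (with $\infty^{-1}=0$) is locally bounded. If $\tau\in[0,T]$ and $U\subset\mathbb R^d$ is open with $\tau<T^*(x)$ for all $x\in U$, then the flow map $U\ni x\mapsto y^x|_{[0,\tau]}\in C([0,\tau],\mathbb R^d)$, with the uniform norm on $C([0,\tau],\mathbb R^d)$, is infinitely Fréchet differentiable. -/

import Mathlib

open Set Filter Topology MeasureTheory
open scoped ENNReal NNReal ContDiff SchwartzMap FourierTransform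

noncomputable section

namespace RegularizedODE

/-- The Euclidean space `ℝ^d`. -/
abbrev Rd (d : ℕ) := EuclideanSpace ℝ (Fin d)

/-! ### Littlewood-Paley blocks and Besov spaces -/

/-- `(χ, ρ)` is a dyadic partition of unity on `ℝ^d`: `χ` is supported in a ball, `ρ` in an annulus,
both are smooth and radial, and `χ + ∑_{j ≥ 0} ρ(2^{-j} ·) = 1`. -/
structure IsDyadicPartition {d : ℕ} (χ ρ : Rd d → ℝ) : Prop where
  smooth_chi : ContDiff ℝ ∞ χ
  smooth_rho : ContDiff ℝ ∞ ρ
  radial_chi : ∀ x y, ‖x‖ = ‖y‖ → χ x = χ y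
  radial_rho : ∀ x y, ‖x‖ = ‖y‖ → ρ x = ρ y
  supp_chi : ∃ c : ℝ, 0 < c ∧ tsupport χ ⊆ {x | ‖x‖ ≤ c}
  supp_rho : ∃ a b : ℝ, 0 < a ∧ 0 < b ∧ tsupport ρ ⊆ {x | a ≤ ‖x‖ ∧ ‖x‖ ≤ b}
  sum_eq_one : ∀ x, HasSum (fun j : ℕ => ρ (((2 : ℝ) ^ j)⁻¹ • x)) (1 - χ x)
  disjoint_chi : ∀ j : ℕ, 1 ≤ j →
    Disjoint (tsupport χ) (tsupport fun x => ρ (((2 : ℝ) ^ j)⁻¹ • x))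
  disjoint_rho : ∀ i j : ℕ, i + 2 ≤ j →
    Disjoint (tsupport fun x => ρ (((2 : ℝ) ^ i)⁻¹ • x))
      (tsupport fun x => ρ (((2 : ℝ) ^ j)⁻¹ • x))

/-- The pieces of the partition of unity with the index shifted by one: `dyadicPiece χ ρ n` is
`ρ_{n-1}`, that is `ρ_{-1} = χ` for `n = 0` and `ρ_j = ρ(2^{-j} ·)` for `n = j + 1`. -/
def dyadicPiece {d : ℕ} (χ ρ : Rd d → ℝ) : ℕ → Rd d → ℝ
  | 0 => χ
  | j + 1 => fun z => ρ (((2 : ℝ) ^ j)⁻¹ • z)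

/-- The kernel `K_{n-1}(x) = (2π)^{-d} ∫ e^{i ⟨z, x⟩} ρ_{n-1}(z) dz`. (Mathlib's inverse Fourier
transform is `∫ e^{2π i ⟨ξ, x⟩} f(ξ) dξ`; substitute `z = 2π ξ`.) -/
def lpKernel {d : ℕ} (χ ρ : Rd d → ℝ) (n : ℕ) : Rd d → ℂ :=
  𝓕⁻ (fun ξ : Rd d => ((dyadicPiece χ ρ n ((2 * Real.pi) • ξ) : ℝ) : ℂ))

/-- The Littlewood-Paley block `Δ_{n-1} f = K_{n-1} ∗ f` of an integrable function `f`. -/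
def lpBlock {d : ℕ} (χ ρ : Rd d → ℝ) (n : ℕ) (f : Rd d → ℝ) (x : Rd d) : ℂ :=
  ∫ z, lpKernel χ ρ n (x - z) * (f z : ℂ)

/-- The norm `sup_{j ≥ -1} 2^{j α} ‖Δ_j f‖_{L^∞}` of the Besov space `𝒞^α = B^α_{∞,∞}`, for an
integrable function `f`; here `j = n - 1`. -/
def besovNorm {d : ℕ} (χ ρ : Rd d → ℝ) (α : ℝ) (f : Rd d → ℝ) : ℝ≥0∞ :=
  ⨆ n : ℕ, ENNReal.ofReal ((2 : ℝ) ^ (((n : ℝ) - 1) * α)) *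
    eLpNorm (lpBlock χ ρ n f) ⊤ volume

/-- `h ∈ C^γ([0,T], 𝒞^α)`, for `h` with integrable values. -/
def IsHolderBesov {d : ℕ} (χ ρ : Rd d → ℝ) (T γ α : ℝ) (h : ℝ → Rd d → ℝ) : Prop :=
  (∀ t ∈ Icc 0 T, besovNorm χ ρ α (h t) < ⊤) ∧
  ∃ C : ℝ≥0, ∀ s ∈ Icc 0 T, ∀ t ∈ Icc 0 T,
    besovNorm χ ρ α (fun z => h t z - h s z) ≤ C * ENNReal.ofReal (|t - s| ^ γ)

/-! ### Local times -/

/-- The occupation measure `μ_t(A) = λ {s ∈ [0,t] | w_s ∈ A}`. -/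
def occupation {d : ℕ} (w : ℝ → Rd d) (t : ℝ) (A : Set (Rd d)) : ℝ≥0∞ :=
  volume {s : ℝ | s ∈ Icc 0 t ∧ w s ∈ A}

/-- `L` is a local time on `[0,T]` of the path `w`. For each `t`, the function `L t` is determined
up to a null set; it is integrable, with integral `t`. -/
structure IsLocalTime {d : ℕ} (T : ℝ) (w : ℝ → Rd d) (L : ℝ → Rd d → ℝ) : Prop where
  measurable : Measurable (fun p : Icc (0 : ℝ) T × Rd d => L p.1 p.2)
  nonneg : ∀ t ∈ Icc 0 T, ∀ z, 0 ≤ L t z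
  zero : ∀ z, L 0 z = 0
  occupation_eq : ∀ t ∈ Icc 0 T, ∀ A : Set (Rd d), MeasurableSet A →
    occupation w t A = ∫⁻ z in A, ENNReal.ofReal (L t z)

/-- The path `w` on `[0,T]` is infinitely regularizing: it has a local time, which lies in
`C^γ([0,T], 𝒞^α)` for all `γ ∈ (1/2, 1)` and all real `α`. -/
def InfinitelyRegularizing {d : ℕ} (χ ρ : Rd d → ℝ) (T : ℝ) (w : ℝ → Rd d) : Prop :=
  ∃ L : ℝ → Rd d → ℝ, IsLocalTime T w L ∧
    ∀ γ ∈ Ioo (1 / 2 : ℝ) 1, ∀ α : ℝ, IsHolderBesov χ ρ T γ α L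

/-! ### Averaging operator and non-linear Young integral -/

/-- `A t x` is the averaging operator `T^w_t b (x) = ⟨b, L_t(· - x)⟩`, where `L` is the local time
of `w`; in particular `L_t(· - x)` agrees almost everywhere with a Schwartz function `φ` (which is
then unique), so that the pairing makes sense. For continuous `b` this is `∫_0^t b(x + w_r) dr`. -/
def IsAveragingOperator {d : ℕ} (T : ℝ) (w : ℝ → Rd d) (b : 𝓢(Rd d, ℝ) →L[ℝ] Rd d)
    (A : ℝ → Rd d → Rd d) : Prop :=
  ∃ L : ℝ → Rd d → ℝ, IsLocalTime T w L ∧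
    ∀ t ∈ Icc 0 T, ∀ x : Rd d, ∃ φ : 𝓢(Rd d, ℝ),
      (⇑φ =ᵐ[volume] fun z => L t (z - x)) ∧ A t x = b φ

/-- `I` is the sewing on `[0,τ]` of the germ `Ξ`: for some `β > 1`,
`|Ξ_{s,t} - Ξ_{s,u} - Ξ_{u,t}| ≲ |t-s|^β`, and `I` is the (unique) function with `I_0 = 0` and
`|I_t - I_s - Ξ_{s,t}| ≲ |t-s|^β`. -/
def IsSewing {d : ℕ} (τ : ℝ) (Ξ : ℝ → ℝ → Rd d) (I : ℝ → Rd d) : Prop :=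
  I 0 = 0 ∧ ∃ β : ℝ, 1 < β ∧ ∃ C : ℝ,
    (∀ s u t : ℝ, 0 ≤ s → s ≤ u → u ≤ t → t ≤ τ →
      ‖Ξ s t - Ξ s u - Ξ u t‖ ≤ C * (t - s) ^ β) ∧
    (∀ s t : ℝ, 0 ≤ s → s ≤ t → t ≤ τ → ‖I t - I s - Ξ s t‖ ≤ C * (t - s) ^ β)

/-- `I_t = ∫_0^t Y_{dr}(y_r)` for `t ∈ [0,τ]`, as a non-linear Young integral: the sewing of
`Ξ_{s,t} = Y_t(y_s) - Y_s(y_s)`. -/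
def IsNonlinearYoungIntegral {d : ℕ} (τ : ℝ) (Y : ℝ → Rd d → Rd d) (y I : ℝ → Rd d) : Prop :=
  IsSewing τ (fun s t => Y t (y s) - Y s (y s)) I

/-! ### The perturbed equation -/

/-- `y` solves `y_t = x + ∫_0^t b(y_r) dr + w_t` on the compact interval `[0,τ]`: `y` is continuous,
`θ = y - w` is `ε`-Hölder continuous for some `ε > 0`, and `θ_t = x + ∫_0^t T^w_{dr} b (θ_r)`. -/
def IsSolution {d : ℕ} (T : ℝ) (w : ℝ → Rd d) (b : 𝓢(Rd d, ℝ) →L[ℝ] Rd d) (x : Rd d)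
    (τ : ℝ) (y : ℝ → Rd d) : Prop :=
  ContinuousOn y (Icc 0 τ) ∧
  (∃ C ε : ℝ≥0, 0 < ε ∧ HolderOnWith C ε (fun t => y t - w t) (Icc 0 τ)) ∧
  ∃ A : ℝ → Rd d → Rd d, IsAveragingOperator T w b A ∧
    IsNonlinearYoungIntegral τ A (fun t => y t - w t) (fun t => y t - w t - x)

/-- The interval `[0,S) ∩ [0,T]`, where `S ∈ (0,∞]`. -/
def existenceInterval (T : ℝ) (S : ℝ≥0∞) : Set ℝ :=
  {t : ℝ | t ∈ Icc 0 T ∧ ENNReal.ofReal t < S}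

/-- `y` solves the perturbed equation on the interval `J` with left end point `0`: it solves it on
`[0,τ]` for every `τ ∈ J`. -/
def SolvesOn {d : ℕ} (T : ℝ) (w : ℝ → Rd d) (b : 𝓢(Rd d, ℝ) →L[ℝ] Rd d) (x : Rd d)
    (J : Set ℝ) (y : ℝ → Rd d) : Prop :=
  ∀ τ ∈ J, IsSolution T w b x τ y

end RegularizedODE

end

/-! Put θ = y - w. The equation becomes a Young equation driven by the averaged field T^w b.
Although b is only a distribution, this field is smooth in space, with bounds proportional to a
power of t - s above 1/2. The rest is the theory of Young equations with a smooth field that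
satisfies no growth condition, so that explosion is possible.

Regularity of the field. The increments of the local time live in a fixed ball, and their
Littlewood-Paley blocks are small in the supremum norm, with arbitrary decay in frequency and a
factor |t - s|^(9/10). The blocks also obey weighted bounds, because the kernels decay rapidly.
Interpolation between the two gives L¹ bounds on the blocks, hence rapid decay of the Fourier
transform and bounds on all Schwartz seminorms (`exists_schwartzMap_of_besovNorm_le`). It costs the
power 3/4, and 9/10 · 3/4 = 27/40 is still larger than 1/2. A tempered distribution is bounded by
finitely many seminorms, and derivatives in the translation parameter fall on the test function. So
the increments of T^w b, divided by (t - s)^(27/40), form a smooth map of x into the bounded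
functions of (s,t): see `IsSmoothField` and `contDiff_translatePairing`.

Solutions. With γ = 27/40, the non-linear Young formulation is equivalent to Davie's: the increments
of θ agree with those of the field up to order 2γ > 1 (`isSolution_iff`). The estimate
`sewing_bound` replaces the unknown constant in such a statement by one computed from the defect
from additivity. Applied to the difference of two solutions it gives uniqueness and Lipschitz
dependence (`exists_difference_bound`). Existence follows from an estimate for the Euler scheme that
is uniform in the step size (`euler_defect`). A smooth field agrees on any ball with a compactly
supported one, so these global statements localize. The time for which a solution surely survives
depends only on a bound for its starting point. Hence a solution that cannot be continued tends to
infinity, and is not merely unbounded.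

Smoothness of the flow. The tangent field (x, v) ↦ (Y(x), DY(x) v) is again a smooth field.
Difference quotients of the flow are bounded, all their limit points solve the tangent equation, and
uniqueness makes them converge. The derivative is therefore a component of the flow of a field of
the same kind, and induction gives all orders (`contDiffOn_flow`). -/

noncomputable section

namespace RegularizedODE

/-! ### A priori estimates for two-parameter functions -/

section Sewing

variable {E : Type*} [NormedAddCommGroup E]

/-- The constant `∑ k, 2^{k(1-α)}` of the sewing estimate. -/
def sewingConst (α : ℝ) : ℝ := (1 - (2 : ℝ) ^ (1 - α))⁻¹

lemma two_rpow_one_sub_lt_one {α : ℝ} (hα : 1 < α) : (2 : ℝ) ^ (1 - α) < 1 :=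
  Real.rpow_lt_one_of_one_lt_of_neg (by norm_num) (by linarith)

lemma one_le_sewingConst {α : ℝ} (hα : 1 < α) : 1 ≤ sewingConst α := by
  have h := two_rpow_one_sub_lt_one hα
  have h0 : (0 : ℝ) < 2 ^ (1 - α) := by positivity
  exact (one_le_inv₀ (by linarith)).2 (by linarith)

lemma two_mul_half_rpow {x : ℝ} (hx : 0 ≤ x) (α : ℝ) :
    2 * (x / 2) ^ α = (2 : ℝ) ^ (1 - α) * x ^ α := by
  rw [Real.div_rpow hx (by norm_num), Real.rpow_sub (by norm_num), Real.rpow_one]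
  ring

lemma rpow_mul_rpow_self {x γ : ℝ} (hx : 0 ≤ x) (hγ : 0 ≤ γ) : x ^ γ * x ^ γ = x ^ (2 * γ) := by
  rw [two_mul, Real.rpow_add_of_nonneg hx hγ hγ]

/-- The a priori sewing estimate: a two-parameter function which is small on short intervals and
almost additive is controlled by its defect from additivity. -/
theorem sewing_bound {R : ℝ → ℝ → E} {a b α β B C : ℝ} (hα : 1 < α) (hβ : 1 < β) (hC : 0 ≤ C)
    (h1 : ∀ s t, a ≤ s → s ≤ t → t ≤ b → ‖R s t‖ ≤ B * (t - s) ^ β)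
    (h2 : ∀ s u t, a ≤ s → s ≤ u → u ≤ t → t ≤ b →
      ‖R s t - R s u - R u t‖ ≤ C * (t - s) ^ α) :
    ∀ s t, a ≤ s → s ≤ t → t ≤ b → ‖R s t‖ ≤ C * sewingConst α * (t - s) ^ α := by
  set q : ℝ := 2 ^ (1 - α) with hq
  set p : ℝ := 2 ^ (1 - β) with hp
  have hq1 : q < 1 := two_rpow_one_sub_lt_one hα
  have hp1 : p < 1 := two_rpow_one_sub_lt_one hβ
  have hq0 : 0 < q := by positivity
  have hp0 : 0 < p := by positivity
  -- Each halving multiplies the term with B by p = 2^(1-β) < 1. The coefficient of the other term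
  -- is the fixed point of A ↦ C + q A. In the limit B disappears.
  have key : ∀ n : ℕ, ∀ s t, a ≤ s → s ≤ t → t ≤ b →
      ‖R s t‖ ≤ C * sewingConst α * (t - s) ^ α + p ^ n * B * (t - s) ^ β := by
    intro n
    induction n with
    | zero =>
      intro s t hs hst ht
      have := h1 s t hs hst ht
      have h3 : 0 ≤ C * sewingConst α * (t - s) ^ α :=
        mul_nonneg (mul_nonneg hC (by linarith [one_le_sewingConst hα]))
          (Real.rpow_nonneg (by linarith) _)
      simpa using by linarith
    | succ n ih =>
      intro s t hs hst ht
      have e1 := ih s ((s + t) / 2) hs (by linarith) (by linarith)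
      have e2 := ih ((s + t) / 2) t (by linarith) (by linarith) ht
      have e3 := h2 s ((s + t) / 2) t hs (by linarith) (by linarith) ht
      have d1 : (s + t) / 2 - s = (t - s) / 2 := by ring
      have d2 : t - (s + t) / 2 = (t - s) / 2 := by ring
      rw [d1] at e1
      rw [d2] at e2
      have e4 : ‖R s t‖ ≤ ‖R s t - R s ((s + t) / 2) - R ((s + t) / 2) t‖ +
          ‖R s ((s + t) / 2)‖ + ‖R ((s + t) / 2) t‖ := by
        have : R s t = (R s t - R s ((s + t) / 2) - R ((s + t) / 2) t) + R s ((s + t) / 2)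
          + R ((s + t) / 2) t := by abel
        conv_lhs => rw [this]
        exact norm_add₃_le
      have f1 := two_mul_half_rpow (x := t - s) (by linarith) α
      have f2 := two_mul_half_rpow (x := t - s) (by linarith) β
      rw [← hq] at f1
      rw [← hp] at f2
      have f3 : C * (t - s) ^ α + C * sewingConst α * (q * (t - s) ^ α) =
          C * sewingConst α * (t - s) ^ α := by
        have : (1 - q) * sewingConst α = 1 := mul_inv_cancel₀ (by linarith)
        linear_combination (-(C * (t - s) ^ α)) * this
      calc ‖R s t‖ ≤ C * (t - s) ^ α + C * sewingConst α * (2 * ((t - s) / 2) ^ α)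
            + p ^ n * B * (2 * ((t - s) / 2) ^ β) := by linarith
        _ = _ := by rw [f1, f2, ← f3]; ring
  intro s t hs hst ht
  have lim : Tendsto (fun n : ℕ => C * sewingConst α * (t - s) ^ α + p ^ n * B * (t - s) ^ β)
      atTop (𝓝 (C * sewingConst α * (t - s) ^ α + 0 * B * (t - s) ^ β)) :=
    tendsto_const_nhds.add
      (((tendsto_pow_atTop_nhds_zero_of_lt_one hp0.le hp1).mul_const _).mul_const _)
  simpa using ge_of_tendsto' lim fun n => key n s t hs hst ht

/-- A bound which can be improved from `N` to `A + N / 2` holds with the constant `2 A`. -/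
theorem le_two_mul_of_halving {ι : Type*} {I : Set ι} {f g : ι → ℝ} {A : ℝ} (hA : 0 ≤ A)
    (hg : ∀ i ∈ I, 0 ≤ g i) (h0 : ∃ N, 0 ≤ N ∧ ∀ i ∈ I, f i ≤ N * g i)
    (h : ∀ N, 0 ≤ N → (∀ i ∈ I, f i ≤ N * g i) → ∀ i ∈ I, f i ≤ (A + N / 2) * g i) :
    ∀ i ∈ I, f i ≤ 2 * A * g i := by
  obtain ⟨N, hN, h0⟩ := h0
  -- The map N ↦ A + N / 2 contracts to its fixed point 2 A. Some finite N is needed to start, but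
  -- its size is irrelevant.
  have key : ∀ n : ℕ, ∀ i ∈ I, f i ≤ (2 * A + N * (1 / 2) ^ n) * g i := by
    intro n
    induction n with
    | zero =>
      refine fun i hi => (h0 i hi).trans (mul_le_mul_of_nonneg_right ?_ (hg i hi))
      simp only [pow_zero, mul_one]
      linarith
    | succ n ih =>
      intro i hi
      have := h _ (by positivity) ih i hi
      convert this using 2
      ring
  intro i hi
  have lim : Tendsto (fun n : ℕ => (2 * A + N * (1 / 2) ^ n) * g i) atTop
      (𝓝 ((2 * A + N * 0) * g i)) :=
    (tendsto_const_nhds.add ((tendsto_pow_atTop_nhds_zero_of_lt_one (by norm_num)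
      (by norm_num)).const_mul _)).mul_const _
  simpa using ge_of_tendsto' lim fun n => key n i hi

end Sewing

/-! ### Solutions in the sense of Davie -/

section Davie

variable {E : Type*} [NormedAddCommGroup E]

/-- `θ` solves the Young equation driven by the field `Y` on `[a,b]` in the sense of Davie: on short
intervals its increments agree with those of the field up to order `α`. -/
def IsDavieSolution (Y : ℝ → E → E) (α a b : ℝ) (θ : ℝ → E) : Prop :=
  ∃ C, ∀ s t, a ≤ s → s ≤ t → t ≤ b → ‖θ t - θ s - (Y t (θ s) - Y s (θ s))‖ ≤ C * (t - s) ^ α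

lemma IsDavieSolution.mono {Y : ℝ → E → E} {α a b a' b' : ℝ} {θ : ℝ → E}
    (h : IsDavieSolution Y α a b θ) (ha : a ≤ a') (hb : b' ≤ b) : IsDavieSolution Y α a' b' θ := by
  obtain ⟨C, h⟩ := h
  exact ⟨C, fun s t h1 h2 h3 => h s t (ha.trans h1) h2 (h3.trans hb)⟩

/-- Only the values of the field along the path enter, so a field may be exchanged for a cut-off
that agrees with it where the path lives. -/
lemma IsDavieSolution.congr_field {Y Y' : ℝ → E → E} {α a b : ℝ} {θ : ℝ → E}
    (h : IsDavieSolution Y α a b θ)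
    (hY : ∀ s ∈ Icc a b, ∀ t ∈ Icc a b, Y t (θ s) = Y' t (θ s)) : IsDavieSolution Y' α a b θ := by
  obtain ⟨C, h⟩ := h
  refine ⟨C, fun s t h1 h2 h3 => ?_⟩
  rw [← hY s ⟨h1, h2.trans h3⟩ t ⟨h1.trans h2, h3⟩, ← hY s ⟨h1, h2.trans h3⟩ s ⟨h1, h2.trans h3⟩]
  exact h s t h1 h2 h3

lemma IsDavieSolution.congr {Y : ℝ → E → E} {α a b : ℝ} {θ θ' : ℝ → E}
    (h : IsDavieSolution Y α a b θ) (hθ : ∀ t ∈ Icc a b, θ t = θ' t) :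
    IsDavieSolution Y α a b θ' := by
  obtain ⟨C, h⟩ := h
  refine ⟨C, fun s t h1 h2 h3 => ?_⟩
  rw [← hθ s ⟨h1, h2.trans h3⟩, ← hθ t ⟨h1.trans h2, h3⟩]
  exact h s t h1 h2 h3

/-- Bounds on the set `S`, uniform in time, for the increments of a field `Y` which is `γ`-Hölder
continuous in time: growth, Lipschitz and four-point bounds. -/
structure FieldBound (Y : ℝ → E → E) (γ K L M a b : ℝ) (S : Set E) : Prop where
  nonneg_K : 0 ≤ K
  nonneg_L : 0 ≤ L
  nonneg_M : 0 ≤ M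
  growth : ∀ s t, a ≤ s → s ≤ t → t ≤ b → ∀ x ∈ S, ‖Y t x - Y s x‖ ≤ K * (t - s) ^ γ
  lip : ∀ s t, a ≤ s → s ≤ t → t ≤ b → ∀ x ∈ S, ∀ x' ∈ S,
    ‖(Y t x' - Y s x') - (Y t x - Y s x)‖ ≤ L * ‖x' - x‖ * (t - s) ^ γ
  four : ∀ s t, a ≤ s → s ≤ t → t ≤ b → ∀ x ∈ S, ∀ x' ∈ S, ∀ y ∈ S, ∀ y' ∈ S,
    ‖((Y t y' - Y s y') - (Y t y - Y s y)) - ((Y t x' - Y s x') - (Y t x - Y s x))‖ ≤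
      (L * ‖(y' - y) - (x' - x)‖ + M * (‖y - x‖ + ‖y' - x'‖) * ‖x' - x‖) * (t - s) ^ γ

namespace FieldBound

variable {Y : ℝ → E → E} {γ K L M a b : ℝ} {S : Set E}

lemma mono (h : FieldBound Y γ K L M a b S) {a' b' : ℝ} (ha : a ≤ a') (hb : b' ≤ b) :
    FieldBound Y γ K L M a' b' S where
  nonneg_K := h.nonneg_K
  nonneg_L := h.nonneg_L
  nonneg_M := h.nonneg_M
  growth s t h1 h2 h3 := h.growth s t (ha.trans h1) h2 (h3.trans hb)
  lip s t h1 h2 h3 := h.lip s t (ha.trans h1) h2 (h3.trans hb)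
  four s t h1 h2 h3 := h.four s t (ha.trans h1) h2 (h3.trans hb)

/-- Solutions are `γ`-Hölder continuous. -/
lemma exists_holder_of_solution (hF : FieldBound Y γ K L M a b S) (hγ : 0 ≤ γ) {θ : ℝ → E}
    (hθ : IsDavieSolution Y (2 * γ) a b θ) (hS : ∀ t ∈ Icc a b, θ t ∈ S) (hab : a ≤ b) :
    ∃ N, 0 ≤ N ∧ ∀ s t, a ≤ s → s ≤ t → t ≤ b → ‖θ t - θ s‖ ≤ N * (t - s) ^ γ := by
  obtain ⟨C, hC⟩ := hθ
  have hK := hF.nonneg_K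
  -- This constant still depends on the solution through C. It only starts the iteration that yields
  -- a constant depending on the field alone.
  refine ⟨K + |C| * (b - a) ^ γ, by positivity [Real.rpow_nonneg (sub_nonneg.2 hab) γ], ?_⟩
  intro s t h1 h2 h3
  have e1 := hC s t h1 h2 h3
  have e2 := hF.growth s t h1 h2 h3 (θ s) (hS s ⟨h1, h2.trans h3⟩)
  have e3 : ‖θ t - θ s‖ ≤ ‖θ t - θ s - (Y t (θ s) - Y s (θ s))‖ + ‖Y t (θ s) - Y s (θ s)‖ := by
    simpa using norm_add_le (θ t - θ s - (Y t (θ s) - Y s (θ s))) (Y t (θ s) - Y s (θ s))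
  have hp : 0 ≤ (t - s) ^ γ := Real.rpow_nonneg (by linarith) _
  have hle : (t - s) ^ γ ≤ (b - a) ^ γ :=
    Real.rpow_le_rpow (by linarith) (by linarith) (by linarith)
  rw [← rpow_mul_rpow_self (by linarith) (by linarith)] at e1
  have e4 : C * ((t - s) ^ γ * (t - s) ^ γ) ≤ |C| * ((b - a) ^ γ * (t - s) ^ γ) :=
    mul_le_mul (le_abs_self C) (mul_le_mul_of_nonneg_right hle hp)
      (by positivity) (abs_nonneg _)
  linarith

/-- On short intervals the Hölder constant of a solution is controlled by the field. -/
theorem holder_of_solution (hF : FieldBound Y γ K L M a b S) (hγ : 1 / 2 < γ) {θ : ℝ → E}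
    (hθ : IsDavieSolution Y (2 * γ) a b θ) (hS : ∀ t ∈ Icc a b, θ t ∈ S) (hab : a ≤ b)
    (hsmall : (b - a) ^ γ * (sewingConst (2 * γ) * L) ≤ 1 / 2) :
    ∀ s t, a ≤ s → s ≤ t → t ≤ b → ‖θ t - θ s‖ ≤ 2 * K * (t - s) ^ γ := by
  obtain ⟨N₀, hN₀, hH₀⟩ := hF.exists_holder_of_solution (by linarith) hθ hS hab
  obtain ⟨C, hC⟩ := hθ
  have hK := hF.nonneg_K
  have hL := hF.nonneg_L
  have hS0 : 0 ≤ sewingConst (2 * γ) := zero_le_one.trans (one_le_sewingConst (by linarith))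
  have hle : ∀ s t, a ≤ s → s ≤ t → t ≤ b → (t - s) ^ γ ≤ (b - a) ^ γ := fun s t h1 h2 h3 =>
    Real.rpow_le_rpow (by linarith) (by linarith) (by linarith)
  -- If N is a Hölder constant of θ, the Lipschitz bound makes the defect of the remainder at most L
  -- N (t - s)^(2γ). Sewing and the smallness of b - a then give the Hölder constant K + N / 2.
  have key := le_two_mul_of_halving (ι := ℝ × ℝ) (I := {p | a ≤ p.1 ∧ p.1 ≤ p.2 ∧ p.2 ≤ b})
    (f := fun p => ‖θ p.2 - θ p.1‖) (g := fun p => (p.2 - p.1) ^ γ) hK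
    (fun p hp => Real.rpow_nonneg (by linarith [hp.2.1]) _) ?_ ?_
  · exact fun s t h1 h2 h3 => key (s, t) ⟨h1, h2, h3⟩
  · exact ⟨N₀, hN₀, fun p hp => hH₀ p.1 p.2 hp.1 hp.2.1 hp.2.2⟩
  · intro N hN hH
    rintro ⟨s, t⟩ ⟨h1, h2, h3⟩
    have hH' : ∀ s t, a ≤ s → s ≤ t → t ≤ b → ‖θ t - θ s‖ ≤ N * (t - s) ^ γ :=
      fun s t h1 h2 h3 => hH (s, t) ⟨h1, h2, h3⟩
    dsimp only at h1 h2 h3 ⊢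
    have rem := sewing_bound (R := fun s t => θ t - θ s - (Y t (θ s) - Y s (θ s))) (a := a) (b := b)
      (α := 2 * γ) (β := 2 * γ) (C := L * N) (by linarith) (by linarith) (by positivity) hC
      (fun s u t h1 h2 h3 h4 => by
        have e := hF.lip u t (h1.trans h2) h3 h4 (θ s) (hS s ⟨h1, h2.trans (h3.trans h4)⟩)
          (θ u) (hS u ⟨h1.trans h2, h3.trans h4⟩)
        have e' := hH' s u h1 h2 (h3.trans h4)
        have q1 : (t - u) ^ γ ≤ (t - s) ^ γ :=
          Real.rpow_le_rpow (by linarith) (by linarith) (by linarith)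
        have q2 : (u - s) ^ γ ≤ (t - s) ^ γ :=
          Real.rpow_le_rpow (by linarith) (by linarith) (by linarith)
        have q3 : 0 ≤ (u - s) ^ γ := Real.rpow_nonneg (by linarith) _
        have q4 : 0 ≤ (t - u) ^ γ := Real.rpow_nonneg (by linarith) _
        have q5 := q4.trans q1
        rw [← rpow_mul_rpow_self (by linarith) (by linarith)]
        calc _ = ‖(Y t (θ u) - Y u (θ u)) - (Y t (θ s) - Y u (θ s))‖ := by congr 1; abel
          _ ≤ L * ‖θ u - θ s‖ * (t - u) ^ γ := e
          _ ≤ L * (N * (u - s) ^ γ) * (t - u) ^ γ := by gcongr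
          _ ≤ L * (N * (t - s) ^ γ) * (t - s) ^ γ := by gcongr
          _ = _ := by ring) s t h1 h2 h3
    have e2 := hF.growth s t h1 h2 h3 (θ s) (hS s ⟨h1, h2.trans h3⟩)
    have e3 : ‖θ t - θ s‖ ≤ ‖θ t - θ s - (Y t (θ s) - Y s (θ s))‖ + ‖Y t (θ s) - Y s (θ s)‖ := by
      simpa using norm_add_le (θ t - θ s - (Y t (θ s) - Y s (θ s))) (Y t (θ s) - Y s (θ s))
    have hp : 0 ≤ (t - s) ^ γ := Real.rpow_nonneg (by linarith) _
    rw [← rpow_mul_rpow_self (by linarith) (by linarith)] at rem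
    have e5 : (t - s) ^ γ * (sewingConst (2 * γ) * L) ≤ 1 / 2 :=
      (mul_le_mul_of_nonneg_right (hle s t h1 h2 h3) (by positivity)).trans hsmall
    have e6 := mul_le_mul_of_nonneg_right e5 (mul_nonneg hN hp)
    nlinarith

/-- The difference of two solutions on a short interval. -/
theorem difference_of_short (hF : FieldBound Y γ K L M a b S) (hγ : 1 / 2 < γ) {θ θ' : ℝ → E}
    (hθ : IsDavieSolution Y (2 * γ) a b θ) (hS : ∀ t ∈ Icc a b, θ t ∈ S)
    (hθ' : IsDavieSolution Y (2 * γ) a b θ') (hS' : ∀ t ∈ Icc a b, θ' t ∈ S) (hab : a ≤ b)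
    {D : ℝ} (hD : D = 2 * (L + 4 * K * M * sewingConst (2 * γ)))
    (hone : (b - a) ^ γ ≤ 1)
    (hsmall : (b - a) ^ γ * (sewingConst (2 * γ) * L + L + 4 * K * M * sewingConst (2 * γ))
      ≤ 1 / 2) :
    (∀ s t, a ≤ s → s ≤ t → t ≤ b →
      ‖(θ' t - θ t) - (θ' s - θ s)‖ ≤ D * ‖θ' a - θ a‖ * (t - s) ^ γ) ∧
    ∀ s t, a ≤ s → s ≤ t → t ≤ b →
      ‖(θ' t - θ t) - (θ' s - θ s) - ((Y t (θ' s) - Y s (θ' s)) - (Y t (θ s) - Y s (θ s)))‖ ≤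
        (L * D + 4 * K * M * (1 + D)) * sewingConst (2 * γ) * ‖θ' a - θ a‖ * (t - s) ^ (2 * γ) := by
  have hK := hF.nonneg_K
  have hL := hF.nonneg_L
  have hM := hF.nonneg_M
  set Q := sewingConst (2 * γ) with hQ
  have hS0 : 0 ≤ Q := zero_le_one.trans (one_le_sewingConst (by linarith))
  have hba : 0 ≤ (b - a) ^ γ := Real.rpow_nonneg (sub_nonneg.2 hab) γ
  have hle : ∀ s t, a ≤ s → s ≤ t → t ≤ b → (t - s) ^ γ ≤ (b - a) ^ γ := fun s t h1 h2 h3 =>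
    Real.rpow_le_rpow (by linarith) (by linarith) (by linarith)
  have hsm : (b - a) ^ γ * (Q * L) ≤ 1 / 2 := by
    refine le_trans ?_ hsmall
    gcongr
    have : 0 ≤ 4 * K * M * Q := by positivity
    linarith
  have hol := hF.holder_of_solution hγ hθ hS hab hsm
  have hol' := hF.holder_of_solution hγ hθ' hS' hab hsm
  obtain ⟨C, hC⟩ := hθ
  obtain ⟨C', hC'⟩ := hθ'
  set z : ℝ → E := fun t => θ' t - θ t with hz
  set G : ℝ → ℝ → E := fun s t => (Y t (θ' s) - Y s (θ' s)) - (Y t (θ s) - Y s (θ s)) with hG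
  -- Here C + C' depends on the two solutions. It serves only as the constant B of `sewing_bound`,
  -- which drops out.
  have rough : ∀ s t, a ≤ s → s ≤ t → t ≤ b → ‖z t - z s - G s t‖ ≤ (C + C') * (t - s) ^ (2 * γ) := by
    intro s t h1 h2 h3
    calc ‖z t - z s - G s t‖ = ‖(θ' t - θ' s - (Y t (θ' s) - Y s (θ' s))) -
          (θ t - θ s - (Y t (θ s) - Y s (θ s)))‖ := by simp only [hz, hG]; congr 1; abel
      _ ≤ _ := by
        refine (norm_sub_le _ _).trans ?_
        linarith [hC s t h1 h2 h3, hC' s t h1 h2 h3]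
  have sup : ∀ N, (∀ s t, a ≤ s → s ≤ t → t ≤ b → ‖z t - z s‖ ≤ N * (t - s) ^ γ) → 0 ≤ N →
      ∀ t ∈ Icc a b, ‖z t‖ ≤ ‖z a‖ + N * (b - a) ^ γ := by
    intro N hN hN0 t ht
    have h1 := hN a t le_rfl ht.1 ht.2
    have h2 : N * (t - a) ^ γ ≤ N * (b - a) ^ γ := by
      gcongr
      · linarith [ht.1]
      · exact ht.2
    have h3 := norm_add_le (z a) (z t - z a)
    rw [add_sub_cancel] at h3
    linarith
  have rem : ∀ N, 0 ≤ N → (∀ s t, a ≤ s → s ≤ t → t ≤ b → ‖z t - z s‖ ≤ N * (t - s) ^ γ) →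
      ∀ s t, a ≤ s → s ≤ t → t ≤ b → ‖z t - z s - G s t‖ ≤
        (L * N + 4 * K * M * (‖z a‖ + N * (b - a) ^ γ)) * Q * (t - s) ^ (2 * γ) := by
    intro N hN hH
    refine sewing_bound (by linarith) (by linarith) (by positivity) rough ?_
    intro s u t h1 h2 h3 h4
    have ms : s ∈ Icc a b := ⟨h1, h2.trans (h3.trans h4)⟩
    have mu : u ∈ Icc a b := ⟨h1.trans h2, h3.trans h4⟩
    -- The defect of the remainder of z is a second difference of the field over θ s, θ' s, θ u, θ'
    -- u. The four-point bound is linear in z and its increments, which keeps the final estimate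
    -- proportional to ‖z a‖.
    have e := hF.four u t (h1.trans h2) h3 h4 (θ s) (hS s ms) (θ' s) (hS' s ms) (θ u) (hS u mu)
      (θ' u) (hS' u mu)
    have q1 : (t - u) ^ γ ≤ (t - s) ^ γ :=
      Real.rpow_le_rpow (by linarith) (by linarith) (by linarith)
    have q2 : (u - s) ^ γ ≤ (t - s) ^ γ :=
      Real.rpow_le_rpow (by linarith) (by linarith) (by linarith)
    have q3 : 0 ≤ (u - s) ^ γ := Real.rpow_nonneg (by linarith) _
    have q4 : 0 ≤ (t - u) ^ γ := Real.rpow_nonneg (by linarith) _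
    have q5 := q4.trans q1
    have e1 := hH s u h1 h2 (h3.trans h4)
    have e2 := hol s u h1 h2 (h3.trans h4)
    have e3 := hol' s u h1 h2 (h3.trans h4)
    have e4 := sup N hH hN s ms
    rw [← rpow_mul_rpow_self (by linarith) (by linarith)]
    calc _ = ‖((Y t (θ' u) - Y u (θ' u)) - (Y t (θ u) - Y u (θ u))) -
          ((Y t (θ' s) - Y u (θ' s)) - (Y t (θ s) - Y u (θ s)))‖ := by
          simp only [hG]; congr 1; abel
      _ ≤ (L * ‖z u - z s‖ + M * (‖θ u - θ s‖ + ‖θ' u - θ' s‖) * ‖z s‖) * (t - u) ^ γ := e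
      _ ≤ (L * (N * (t - s) ^ γ) + M * (2 * K * (t - s) ^ γ + 2 * K * (t - s) ^ γ) *
          (‖z a‖ + N * (b - a) ^ γ)) * (t - s) ^ γ := by
          have e1' := e1.trans (mul_le_mul_of_nonneg_left q2 hN)
          have e2' := e2.trans (mul_le_mul_of_nonneg_left q2 (by positivity))
          have e3' := e3.trans (mul_le_mul_of_nonneg_left q2 (by positivity))
          gcongr
      _ = _ := by ring
  have step : ∀ N, 0 ≤ N → (∀ s t, a ≤ s → s ≤ t → t ≤ b → ‖z t - z s‖ ≤ N * (t - s) ^ γ) →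
      ∀ s t, a ≤ s → s ≤ t → t ≤ b →
        ‖z t - z s‖ ≤ ((L + 4 * K * M * Q) * ‖z a‖ + N / 2) * (t - s) ^ γ := by
    intro N hN hH s t h1 h2 h3
    have ms : s ∈ Icc a b := ⟨h1, h2.trans h3⟩
    have r := rem N hN hH s t h1 h2 h3
    have g1 : ‖G s t‖ ≤ L * ‖z s‖ * (t - s) ^ γ :=
      hF.lip s t h1 h2 h3 (θ s) (hS s ms) (θ' s) (hS' s ms)
    have e4 := sup N hH hN s ms
    have hp : 0 ≤ (t - s) ^ γ := Real.rpow_nonneg (by linarith) _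
    have g2 := norm_add_le (z t - z s - G s t) (G s t)
    rw [sub_add_cancel] at g2
    rw [← rpow_mul_rpow_self (by linarith) (by linarith)] at r
    have r' : (L * N + 4 * K * M * (‖z a‖ + N * (b - a) ^ γ)) * Q * ((t - s) ^ γ * (t - s) ^ γ) ≤
        (L * N * (b - a) ^ γ + 4 * K * M * (‖z a‖ + N * (b - a) ^ γ * (b - a) ^ γ)) * Q *
          (t - s) ^ γ := by
      have := hle s t h1 h2 h3
      have o : (t - s) ^ γ ≤ 1 := this.trans hone
      calc _ = (L * N * (t - s) ^ γ + 4 * K * M * (‖z a‖ * (t - s) ^ γ +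
            N * (b - a) ^ γ * (t - s) ^ γ)) * Q * (t - s) ^ γ := by ring
        _ ≤ (L * N * (b - a) ^ γ + 4 * K * M * (‖z a‖ * 1 +
            N * (b - a) ^ γ * (b - a) ^ γ)) * Q * (t - s) ^ γ := by gcongr
        _ = _ := by ring
    have r'' : N * (b - a) ^ γ * (b - a) ^ γ ≤ N * (b - a) ^ γ :=
      mul_le_of_le_one_right (by positivity) hone
    have r3 : (L * N * (b - a) ^ γ + 4 * K * M * (‖z a‖ + N * (b - a) ^ γ * (b - a) ^ γ)) * Q ≤
        (L * N * (b - a) ^ γ + 4 * K * M * (‖z a‖ + N * (b - a) ^ γ)) * Q := by gcongr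
    have g3 : L * ‖z s‖ ≤ L * (‖z a‖ + N * (b - a) ^ γ) := by gcongr
    calc ‖z t - z s‖ ≤ (L * N * (b - a) ^ γ + 4 * K * M * (‖z a‖ + N * (b - a) ^ γ)) * Q *
          (t - s) ^ γ + L * (‖z a‖ + N * (b - a) ^ γ) * (t - s) ^ γ := by
          have g3' := mul_le_mul_of_nonneg_right g3 hp
          have r3' := mul_le_mul_of_nonneg_right r3 hp
          linarith
      _ = ((L + 4 * K * M * Q) * ‖z a‖ +
          N * ((b - a) ^ γ * (Q * L + L + 4 * K * M * Q))) * (t - s) ^ γ := by ring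
      _ ≤ ((L + 4 * K * M * Q) * ‖z a‖ + N * (1 / 2)) * (t - s) ^ γ := by gcongr
      _ = _ := by ring
  have key := le_two_mul_of_halving (ι := ℝ × ℝ) (I := {p | a ≤ p.1 ∧ p.1 ≤ p.2 ∧ p.2 ≤ b})
    (f := fun p => ‖z p.2 - z p.1‖) (g := fun p => (p.2 - p.1) ^ γ)
    (A := (L + 4 * K * M * Q) * ‖z a‖) (by positivity)
    (fun p hp => Real.rpow_nonneg (by linarith [hp.2.1]) _) ⟨4 * K, by positivity, ?_⟩
    (fun N hN hH p hp => step N hN (fun s t h1 h2 h3 => hH (s, t) ⟨h1, h2, h3⟩) p.1 p.2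
      hp.1 hp.2.1 hp.2.2)
  · have key' : ∀ s t, a ≤ s → s ≤ t → t ≤ b → ‖z t - z s‖ ≤ D * ‖z a‖ * (t - s) ^ γ := by
      intro s t h1 h2 h3
      have := key (s, t) ⟨h1, h2, h3⟩
      rw [hD]
      linarith
    refine ⟨key', fun s t h1 h2 h3 => ?_⟩
    have hD0 : 0 ≤ D := by rw [hD]; positivity
    refine (rem (D * ‖z a‖) (by positivity) key' s t h1 h2 h3).trans ?_
    have hp : 0 ≤ (t - s) ^ (2 * γ) := Real.rpow_nonneg (by linarith) _
    calc _ ≤ (L * (D * ‖z a‖) + 4 * K * M * (‖z a‖ + D * ‖z a‖ * 1)) * Q * (t - s) ^ (2 * γ) := by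
          gcongr
      _ = _ := by ring
  -- The iteration may start from 4 K, since each of the two solutions has Hölder constant at most 2
  -- K.
  · rintro ⟨s, t⟩ ⟨h1, h2, h3⟩
    have : z t - z s = (θ' t - θ' s) - (θ t - θ s) := by simp only [hz]; abel
    rw [this]
    refine (norm_sub_le _ _).trans ?_
    linarith [hol s t h1 h2 h3, hol' s t h1 h2 h3]

end FieldBound

end Davie

/-! ### Comparison of solutions on arbitrary intervals -/

section Comparison

/-- For x ≥ h the factor (x / h)^e is at least 1, so a uniform bound is as good as a power bound.
This extends estimates on short intervals to all intervals. -/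
lemma le_rpow_of_short {x v h e A B : ℝ} (hx : 0 ≤ x) (hh : 0 < h) (he : 0 ≤ e) (hA : 0 ≤ A)
    (hB : 0 ≤ B) (h1 : x ≤ h → v ≤ A * x ^ e) (h2 : v ≤ B) : v ≤ (A + B / h ^ e) * x ^ e := by
  have hxe : 0 ≤ x ^ e := Real.rpow_nonneg hx _
  have hhe : 0 < h ^ e := Real.rpow_pos_of_pos hh _
  rw [add_mul]
  rcases le_total x h with hxh | hxh
  · have : 0 ≤ B / h ^ e * x ^ e := by positivity
    linarith [h1 hxh]
  · have h3 : B ≤ B / h ^ e * x ^ e := by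
      rw [div_mul_eq_mul_div, le_div_iff₀ hhe]
      exact mul_le_mul_of_nonneg_left (Real.rpow_le_rpow hh.le hxh he) hB
    have : 0 ≤ A * x ^ e := by positivity
    linarith

lemma exists_pos_rpow_le {γ ε : ℝ} (hγ : 0 < γ) (hε : 0 < ε) : ∃ h : ℝ, 0 < h ∧ h ^ γ = ε :=
  ⟨ε ^ γ⁻¹, Real.rpow_pos_of_pos hε _, Real.rpow_inv_rpow hε.le hγ.ne'⟩

variable {E : Type*} [NormedAddCommGroup E] {Y : ℝ → E → E} {γ K L M a b : ℝ} {S : Set E}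

namespace FieldBound

/-- Two solutions differ by at most a multiple of the difference of their initial values, and their
difference solves the difference of the equations up to such a multiple. -/
theorem exists_difference_bound (hF : FieldBound Y γ K L M a b S) (hγ : 1 / 2 < γ) (hab : a ≤ b) :
    ∃ C, 0 ≤ C ∧ ∀ θ θ' : ℝ → E, IsDavieSolution Y (2 * γ) a b θ → (∀ t ∈ Icc a b, θ t ∈ S) →
      IsDavieSolution Y (2 * γ) a b θ' → (∀ t ∈ Icc a b, θ' t ∈ S) →
      (∀ t ∈ Icc a b, ‖θ' t - θ t‖ ≤ C * ‖θ' a - θ a‖) ∧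
      ∀ s t, a ≤ s → s ≤ t → t ≤ b →
        ‖(θ' t - θ t) - (θ' s - θ s) - ((Y t (θ' s) - Y s (θ' s)) - (Y t (θ s) - Y s (θ s)))‖ ≤
          C * ‖θ' a - θ a‖ * (t - s) ^ (2 * γ) := by
  have hK := hF.nonneg_K
  have hL := hF.nonneg_L
  have hM := hF.nonneg_M
  set Q := sewingConst (2 * γ) with hQ
  have hQ0 : 0 ≤ Q := zero_le_one.trans (one_le_sewingConst (by linarith))
  set W := Q * L + L + 4 * K * M * Q with hW
  have hW0 : 0 ≤ W := by positivity
  -- This value of h^γ gives both h^γ ≤ 1 and h^γ W ≤ 1/2, the smallness conditions of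
  -- `difference_of_short`.
  obtain ⟨h, hh, hhW⟩ := exists_pos_rpow_le (γ := γ) (ε := 1 / (2 * (W + 1))) (by linarith)
    (by positivity)
  have hh1 : h ^ γ ≤ 1 := by
    rw [hhW, div_le_one (by positivity)]
    linarith
  have hh2 : h ^ γ * W ≤ 1 / 2 := by
    rw [hhW, div_mul_eq_mul_div, div_le_div_iff₀ (by positivity) (by norm_num)]
    linarith
  set D := 2 * (L + 4 * K * M * Q) with hD
  have hD0 : 0 ≤ D := by positivity
  obtain ⟨n, hn⟩ := exists_nat_ge ((b - a) / h)
  rw [div_le_iff₀ hh] at hn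
  set C₁ := (1 + D) ^ n with hC₁
  have hC₁0 : 0 ≤ C₁ := by positivity
  set C₂ := (L * D + 4 * K * M * (1 + D)) * Q with hC₂
  have hC₂0 : 0 ≤ C₂ := by positivity
  set C₃ := C₂ * C₁ + (2 * C₁ + L * C₁ * (b - a) ^ γ) / h ^ (2 * γ) with hC₃
  have hba : 0 ≤ (b - a) ^ γ := Real.rpow_nonneg (sub_nonneg.2 hab) γ
  have hC₃0 : 0 ≤ C₃ := by positivity
  refine ⟨C₁ + C₃, by positivity, fun θ θ' hθ hS hθ' hS' => ?_⟩
  have loc : ∀ s t, a ≤ s → s ≤ t → t ≤ b → t - s ≤ h →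
      ‖(θ' t - θ t) - (θ' s - θ s)‖ ≤ D * ‖θ' s - θ s‖ ∧
      ‖(θ' t - θ t) - (θ' s - θ s) - ((Y t (θ' s) - Y s (θ' s)) - (Y t (θ s) - Y s (θ s)))‖ ≤
        C₂ * ‖θ' s - θ s‖ * (t - s) ^ (2 * γ) := by
    intro s t h1 h2 h3 h4
    have hts : (t - s) ^ γ ≤ h ^ γ := Real.rpow_le_rpow (by linarith) h4 (by linarith)
    have := (hF.mono h1 h3).difference_of_short hγ (hθ.mono h1 h3)
      (fun r hr => hS r ⟨h1.trans hr.1, hr.2.trans h3⟩) (hθ'.mono h1 h3)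
      (fun r hr => hS' r ⟨h1.trans hr.1, hr.2.trans h3⟩) h2 hD (hts.trans hh1)
      ((mul_le_mul_of_nonneg_right hts hW0).trans hh2)
    refine ⟨(this.1 s t le_rfl h2 le_rfl).trans ?_, this.2 s t le_rfl h2 le_rfl⟩
    exact mul_le_of_le_one_right (by positivity) (hts.trans hh1)
  -- Each interval of length at most h multiplies the distance of the two solutions by at most 1 +
  -- D, and n of them cover [a,b].
  have chain : ∀ k : ℕ, ∀ t ∈ Icc a b, t - a ≤ k * h →
      ‖θ' t - θ t‖ ≤ (1 + D) ^ k * ‖θ' a - θ a‖ := by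
    intro k
    induction k with
    | zero =>
      intro t ht hk
      have : t = a := le_antisymm (by simpa using hk) ht.1
      simp [this]
    | succ k ih =>
      intro t ht hk
      have hs : max a (t - h) ∈ Icc a b := ⟨le_max_left _ _, max_le hab (by linarith [ht.2])⟩
      have hst : max a (t - h) ≤ t := max_le ht.1 (by linarith)
      have e1 := ih (max a (t - h)) hs (by
        rw [sub_le_iff_le_add]
        refine max_le (by nlinarith [(Nat.cast_nonneg k : (0 : ℝ) ≤ k)]) ?_
        push_cast at hk
        linarith)
      have e2 := (loc _ t hs.1 hst ht.2 (by linarith [le_max_right a (t - h)])).1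
      have e3 := norm_le_norm_add_norm_sub' (θ' t - θ t)
        (θ' (max a (t - h)) - θ (max a (t - h)))
      calc _ ≤ (1 + D) * ‖θ' (max a (t - h)) - θ (max a (t - h))‖ := by linarith
        _ ≤ (1 + D) * ((1 + D) ^ k * ‖θ' a - θ a‖) := by gcongr
        _ = _ := by ring
  have sup : ∀ t ∈ Icc a b, ‖θ' t - θ t‖ ≤ C₁ * ‖θ' a - θ a‖ := fun t ht =>
    chain n t ht (by linarith [ht.2])
  refine ⟨fun t ht => (sup t ht).trans (by gcongr; linarith), fun s t h1 h2 h3 => ?_⟩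
  have ms : s ∈ Icc a b := ⟨h1, h2.trans h3⟩
  have mt : t ∈ Icc a b := ⟨h1.trans h2, h3⟩
  have hts : (t - s) ^ γ ≤ (b - a) ^ γ :=
    Real.rpow_le_rpow (by linarith) (by linarith) (by linarith)
  have hts0 : 0 ≤ (t - s) ^ (2 * γ) := Real.rpow_nonneg (by linarith) _
  -- Intervals of length at most h are covered by `loc`. On longer ones the supremum bound is
  -- enough.
  refine (le_rpow_of_short (x := t - s) (h := h) (e := 2 * γ) (A := C₂ * C₁ * ‖θ' a - θ a‖)
    (B := (2 * C₁ + L * C₁ * (b - a) ^ γ) * ‖θ' a - θ a‖) (by linarith) hh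
    (by linarith) (by positivity) (by positivity) (fun h4 => ?_) ?_).trans (le_of_le_of_eq
      (b := C₃ * ‖θ' a - θ a‖ * (t - s) ^ (2 * γ)) (le_of_eq (by rw [hC₃]; ring)) rfl |>.trans
      (by gcongr; linarith))
  · refine (loc s t h1 h2 h3 h4).2.trans ?_
    rw [mul_assoc C₂ C₁]
    gcongr
    exact sup s ms
  · have e1 := hF.lip s t h1 h2 h3 (θ s) (hS s ms) (θ' s) (hS' s ms)
    have e2 : L * ‖θ' s - θ s‖ * (t - s) ^ γ ≤ L * (C₁ * ‖θ' a - θ a‖) * (b - a) ^ γ := by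
      gcongr
      exact sup s ms
    refine (norm_sub_le _ _).trans ?_
    have e3 := norm_sub_le (θ' t - θ t) (θ' s - θ s)
    linarith [sup s ms, sup t mt]

/-- Solutions are determined by their initial value. -/
theorem eqOn_of_solution (hF : FieldBound Y γ K L M a b S) (hγ : 1 / 2 < γ) {θ θ' : ℝ → E}
    (hθ : IsDavieSolution Y (2 * γ) a b θ) (hS : ∀ t ∈ Icc a b, θ t ∈ S)
    (hθ' : IsDavieSolution Y (2 * γ) a b θ') (hS' : ∀ t ∈ Icc a b, θ' t ∈ S)
    (h0 : θ a = θ' a) : EqOn θ θ' (Icc a b) := by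
  intro t ht
  obtain ⟨C, -, hC⟩ := hF.exists_difference_bound hγ (ht.1.trans ht.2)
  have := (hC θ θ' hθ hS hθ' hS').1 t ht
  rw [h0, sub_self, norm_zero, mul_zero] at this
  exact (sub_eq_zero.1 (norm_le_zero_iff.1 this)).symm

end FieldBound

end Comparison

/-! ### Existence by the Euler scheme -/

section Euler

variable {E : Type*} [NormedAddCommGroup E]

/-- The Euler scheme with step size `δ` for the equation driven by the field `Y`, started in `x` at
time `a`. -/
def eulerScheme (Y : ℝ → E → E) (a δ : ℝ) (x : E) : ℕ → E
  | 0 => x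
  | k + 1 => eulerScheme Y a δ x k +
      (Y (a + (k + 1) * δ) (eulerScheme Y a δ x k) - Y (a + k * δ) (eulerScheme Y a δ x k))

/-- As x ≤ y, the left side is at most (x + y) y^(α-1), and y is at most two thirds of the sum. The
factor below 1 is what closes the induction for the Euler scheme. -/
lemma rpow_add_rpow_le {x y α : ℝ} (hα : 1 < α) (hx : 0 ≤ x) (hxy : x ≤ y)
    (hy : y ≤ 2 / 3 * (x + y)) : x ^ α + y ^ α ≤ (2 / 3) ^ (α - 1) * (x + y) ^ α := by
  have hy0 : 0 ≤ y := hx.trans hxy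
  have e : ∀ r : ℝ, 0 ≤ r → r ^ α = r * r ^ (α - 1) := fun r hr => by
    rw [← Real.rpow_one_add' hr (by linarith)]
    congr 1
    ring
  have h1 : x ^ (α - 1) ≤ y ^ (α - 1) := Real.rpow_le_rpow hx hxy (by linarith)
  have h2 : y ^ (α - 1) ≤ (2 / 3 * (x + y)) ^ (α - 1) := Real.rpow_le_rpow hy0 hy (by linarith)
  rw [Real.mul_rpow (by norm_num) (by linarith)] at h2
  rw [e x hx, e y hy0, e (x + y) (by linarith)]
  calc x * x ^ (α - 1) + y * y ^ (α - 1) ≤ x * y ^ (α - 1) + y * y ^ (α - 1) := by gcongr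
    _ = (x + y) * y ^ (α - 1) := by ring
    _ ≤ (x + y) * ((2 / 3) ^ (α - 1) * (x + y) ^ (α - 1)) := by gcongr
    _ = _ := by ring

variable {Y : ℝ → E → E} {γ K L M a b : ℝ}

namespace FieldBound

/-- Davie's estimate for the Euler scheme, uniformly in the step size. -/
theorem euler_defect (hF : FieldBound Y γ K L M a b univ) (hγ : 1 / 2 < γ) {c C h δ : ℝ} (x : E)
    (hδ : 0 ≤ δ) (hc : c = (2 / 3 : ℝ) ^ (2 * γ - 1)) (hC0 : 0 ≤ C)
    (hC : L * K ≤ C * ((1 - c) / 2)) (hh : L * h ^ γ ≤ (1 - c) / 2) (m : ℕ) :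
    ∀ k : ℕ, a + (k + m : ℕ) * δ ≤ b → m * δ ≤ h →
      ‖eulerScheme Y a δ x (k + m) - eulerScheme Y a δ x k -
        (Y (a + (k + m : ℕ) * δ) (eulerScheme Y a δ x k) -
          Y (a + k * δ) (eulerScheme Y a δ x k))‖ ≤ C * (m * δ) ^ (2 * γ) := by
  have hK := hF.nonneg_K
  have hL := hF.nonneg_L
  set u := eulerScheme Y a δ x with hu
  induction m using Nat.strong_induction_on with
  | _ m ih =>
  intro k hb hmh
  rcases Nat.lt_or_ge m 2 with hm | hm
  · have : ‖u (k + m) - u k - (Y (a + (k + m : ℕ) * δ) (u k) - Y (a + k * δ) (u k))‖ = 0 := by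
      interval_cases m
      · simp
      · rw [hu]
        simp [eulerScheme]
    rw [this]
    exact mul_nonneg hC0 (Real.rpow_nonneg (by positivity) _)
  -- Splitting m steps as evenly as possible leaves at most 2/3 of them in the larger part. The
  -- worst case is m = 3, whence the 2/3 in c.
  · obtain ⟨p, q, hpq, hp, hq, h1, h2⟩ : ∃ p q : ℕ, m = p + q ∧ p < m ∧ q < m ∧ p ≤ q ∧
        3 * q ≤ 2 * m := ⟨m / 2, m - m / 2, by omega, by omega, by omega, by omega, by omega⟩
    have hpq' : (m : ℝ) = p + q := by exact_mod_cast hpq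
    have h1' : (p : ℝ) ≤ q := by exact_mod_cast h1
    have h2' : (3 : ℝ) * q ≤ 2 * m := by exact_mod_cast h2
    have hp0 : (0 : ℝ) ≤ p := p.cast_nonneg
    have hq0 : (0 : ℝ) ≤ q := q.cast_nonneg
    push_cast at hb
    have b1 : (p : ℝ) * δ ≤ m * δ := by gcongr
    have b2 : (q : ℝ) * δ ≤ m * δ := by gcongr
    have i1 := ih p hp k (by push_cast; nlinarith) (b1.trans hmh)
    have i2 := ih q hq (k + p) (by push_cast; nlinarith) (b2.trans hmh)
    have hkm : k + m = k + p + q := by omega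
    rw [hkm]
    set s := a + k * δ with hs
    set v := a + (k + p : ℕ) * δ with hv
    set t := a + (k + p + q : ℕ) * δ with ht
    have hsv : v - s = p * δ := by rw [hs, hv]; push_cast; ring
    have hvt : t - v = q * δ := by rw [ht, hv]; push_cast; ring
    have hkδ : 0 ≤ k * δ := by positivity
    have hpδ : 0 ≤ p * δ := by positivity
    have hqδ : 0 ≤ q * δ := by positivity
    have hmδ : 0 ≤ m * δ := by positivity
    have htb : t ≤ b := by rw [ht]; push_cast; linarith [congrArg (· * δ) hpq']
    have g1 := hF.growth s v (by linarith) (by linarith) (by linarith) (u k) trivial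
    have g2 := hF.lip v t (by linarith) (by linarith) htb (u k) trivial (u (k + p)) trivial
    rw [hsv] at g1
    rw [hvt] at g2
    have q1 : (p * δ) ^ γ ≤ (m * δ) ^ γ := Real.rpow_le_rpow hpδ b1 (by linarith)
    have q2 : (q * δ) ^ γ ≤ (m * δ) ^ γ := Real.rpow_le_rpow hqδ b2 (by linarith)
    have q3 : (p * δ) ^ γ ≤ h ^ γ := Real.rpow_le_rpow hpδ (b1.trans hmh) (by linarith)
    have q4 : 0 ≤ (p * δ) ^ γ := Real.rpow_nonneg hpδ _
    have q5 : 0 ≤ (q * δ) ^ γ := Real.rpow_nonneg hqδ _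
    have q6 := q5.trans q2
    have q9 := q4.trans q3
    have q7 := rpow_add_rpow_le (α := 2 * γ) (by linarith) hpδ
      (mul_le_mul_of_nonneg_right h1' hδ) (by
        have := mul_le_mul_of_nonneg_right h2' hδ
        rw [hpq'] at this
        linarith)
    rw [← add_mul, ← hpq', ← hc] at q7
    have d1 : ‖u (k + p) - u k‖ ≤ (K + C * h ^ γ) * (m * δ) ^ γ := by
      have := norm_le_norm_add_norm_sub' (u (k + p) - u k) (Y v (u k) - Y s (u k))
      rw [← rpow_mul_rpow_self hpδ (by linarith)] at i1
      calc _ ≤ K * (p * δ) ^ γ + C * ((p * δ) ^ γ * (p * δ) ^ γ) := by linarith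
        _ ≤ K * (m * δ) ^ γ + C * (h ^ γ * (m * δ) ^ γ) := by gcongr
        _ = _ := by ring
    have d2 : ‖(Y t (u (k + p)) - Y v (u (k + p))) - (Y t (u k) - Y v (u k))‖ ≤
        (L * K + C * (L * h ^ γ)) * (m * δ) ^ (2 * γ) := by
      rw [← rpow_mul_rpow_self hmδ (by linarith)]
      calc _ ≤ L * ‖u (k + p) - u k‖ * (q * δ) ^ γ := g2
        _ ≤ L * ((K + C * h ^ γ) * (m * δ) ^ γ) * (m * δ) ^ γ := by gcongr
        _ = _ := by ring
    have d3 : u (k + p + q) - u k - (Y t (u k) - Y s (u k)) =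
        (u (k + p + q) - u (k + p) - (Y t (u (k + p)) - Y v (u (k + p)))) +
        (u (k + p) - u k - (Y v (u k) - Y s (u k))) +
        ((Y t (u (k + p)) - Y v (u (k + p))) - (Y t (u k) - Y v (u k))) := by abel
    rw [d3]
    refine norm_add₃_le.trans ?_
    have q8 : 0 ≤ (m * δ) ^ (2 * γ) := Real.rpow_nonneg hmδ _
    -- The two parts use only the fraction c of the constant C. The new defect has the two
    -- coefficients L K and C L h^γ, and each takes half of the remaining C (1 - c).
    calc _ ≤ C * (q * δ) ^ (2 * γ) + C * (p * δ) ^ (2 * γ) +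
          (L * K + C * (L * h ^ γ)) * (m * δ) ^ (2 * γ) := add_le_add_three i2 i1 d2
      _ = C * ((p * δ) ^ (2 * γ) + (q * δ) ^ (2 * γ)) +
          (L * K + C * (L * h ^ γ)) * (m * δ) ^ (2 * γ) := by ring
      _ ≤ C * (c * (m * δ) ^ (2 * γ)) +
          (C * ((1 - c) / 2) + C * ((1 - c) / 2)) * (m * δ) ^ (2 * γ) := by gcongr
      _ = _ := by ring

/-- The Euler scheme of a field supported in a ball is bounded. -/
lemma norm_eulerScheme_le (hF : FieldBound Y γ K L M a b univ) (hγ : 0 < γ) {R δ : ℝ} (x : E)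
    (hδ : 0 ≤ δ)
    (hR : ∀ s ∈ Icc a b, ∀ t ∈ Icc a b, ∀ x, R ≤ ‖x‖ → Y t x - Y s x = 0) (k : ℕ)
    (hk : a + k * δ ≤ b) : ‖eulerScheme Y a δ x k‖ ≤ max ‖x‖ (R + K * (b - a) ^ γ) := by
  have hK := hF.nonneg_K
  induction k with
  | zero => simp [eulerScheme]
  | succ k ih =>
    have hkδ : 0 ≤ k * δ := by positivity
    push_cast at hk
    have h1 : a + k * δ ≤ a + (k + 1) * δ := by linarith
    rw [eulerScheme]
    rcases le_total R ‖eulerScheme Y a δ x k‖ with h | h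
    · rw [hR _ ⟨by linarith, by linarith⟩ _ ⟨by linarith, by linarith⟩ _ h, add_zero]
      exact ih (by linarith)
    · refine le_max_of_le_right ((norm_add_le _ _).trans (add_le_add h ?_))
      refine (hF.growth _ _ (by linarith) h1 hk _ trivial).trans ?_
      gcongr
      · linarith

variable [ProperSpace E]

/-- Existence of solutions for fields supported in a ball. -/
theorem exists_solution (hF : FieldBound Y γ K L M a b univ) (hγ : 1 / 2 < γ) (hab : a ≤ b) {R : ℝ}
    (hR : ∀ s ∈ Icc a b, ∀ t ∈ Icc a b, ∀ x, R ≤ ‖x‖ → Y t x - Y s x = 0) (x : E) :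
    ∃ θ : ℝ → E, θ a = x ∧ IsDavieSolution Y (2 * γ) a b θ := by
  have hK := hF.nonneg_K
  have hL := hF.nonneg_L
  have hba : 0 ≤ b - a := sub_nonneg.2 hab
  set δ : ℕ → ℝ := fun n => (b - a) / (n + 1) with hδ
  have hδ0 : ∀ n, 0 ≤ δ n := fun n => by positivity
  have hδlim : Tendsto δ atTop (𝓝 0) := tendsto_const_div_atTop_nhds_zero_nat (b - a) |>.comp
    (tendsto_add_atTop_nat 1) |>.congr fun n => by simp [hδ]
  set κ : ℕ → ℝ → ℕ := fun n t => ⌊(t - a) / δ n⌋₊ with hκ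
  have hκle : ∀ n, ∀ t ∈ Icc a b, a + κ n t * δ n ≤ t := by
    intro n t ht
    rcases (hδ0 n).eq_or_lt with h | h
    · rw [← h, mul_zero, add_zero]
      exact ht.1
    · have := Nat.floor_le (div_nonneg (sub_nonneg.2 ht.1) h.le)
      rw [le_div_iff₀ h] at this
      linarith
  have hκge : ∀ n, ∀ t ∈ Icc a b, t - δ n ≤ a + κ n t * δ n := by
    intro n t ht
    rcases (hδ0 n).eq_or_lt with h | h
    · have hba' : b - a = 0 := by
        rcases div_eq_zero_iff.1 h.symm with h | h
        · exact h
        · exact absurd h (by positivity)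
      rw [← h]
      linarith [ht.1, ht.2]
    · have := (Nat.lt_floor_add_one ((t - a) / δ n)).le
      rw [div_le_iff₀ h] at this
      simp only [hκ]
      linarith
  have hκlim : ∀ t ∈ Icc a b, Tendsto (fun n => a + κ n t * δ n) atTop (𝓝 t) := fun t ht =>
    tendsto_of_tendsto_of_tendsto_of_le_of_le (by simpa using tendsto_const_nhds.sub hδlim)
      tendsto_const_nhds (fun n => hκge n t ht) (fun n => hκle n t ht)
  set u : ℕ → ℕ → E := fun n => eulerScheme Y a (δ n) x with hu
  set B := max ‖x‖ (R + K * (b - a) ^ γ) with hB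
  have hbd : ∀ n, ∀ t ∈ Icc a b, u n (κ n t) ∈ Metric.closedBall (0 : E) B := fun n t ht => by
    rw [mem_closedBall_zero_iff]
    exact hF.norm_eulerScheme_le (by linarith) x (hδ0 n) hR _ ((hκle n t ht).trans ht.2)
  -- Compactness gives a limit separately for each t. Since one ultrafilter serves all times,
  -- estimates relating different times pass to the limit, and no equicontinuity is needed.
  have hlim : ∀ t : ℝ, ∃ y ∈ Metric.closedBall (0 : E) B, t ∈ Icc a b →
      Tendsto (fun n => u n (κ n t)) (hyperfilter ℕ) (𝓝 y) := by
    intro t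
    by_cases ht : t ∈ Icc a b
    · obtain ⟨y, hy, h⟩ := (isCompact_closedBall (0 : E) B).ultrafilter_le_nhds'
        ((hyperfilter ℕ).map fun n => u n (κ n t))
        (Ultrafilter.mem_map.2 (univ_mem' fun n => hbd n t ht))
      exact ⟨y, hy, fun _ => h⟩
    · exact ⟨0, Metric.mem_closedBall_self (le_max_of_le_left (norm_nonneg _)), fun h => absurd h ht⟩
  choose θ hθB hθ using hlim
  refine ⟨θ, ?_, ?_⟩
  · have ha : a ∈ Icc a b := ⟨le_rfl, hab⟩
    refine tendsto_nhds_unique (hθ a ha) ?_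
    simp [hκ, hu, eulerScheme]
  set c : ℝ := (2 / 3 : ℝ) ^ (2 * γ - 1) with hc
  have hc1 : c < 1 := Real.rpow_lt_one (by norm_num) (by norm_num) (by linarith)
  obtain ⟨h, hh, hhε⟩ := exists_pos_rpow_le (γ := γ) (ε := (1 - c) / (2 * (L + 1))) (by linarith)
    (div_pos (by linarith) (by positivity))
  have hLh : L * h ^ γ ≤ (1 - c) / 2 := by
    rw [hhε, mul_div_assoc', div_le_div_iff₀ (by positivity) (by norm_num)]
    nlinarith
  set C := 2 * L * K / (1 - c) with hC
  have hC0 : 0 ≤ C := div_nonneg (by positivity) (by linarith)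
  have hCc : L * K ≤ C * ((1 - c) / 2) := by
    rw [hC]
    field_simp
    rw [mul_div_assoc, div_self (by linarith), mul_one]
  have short : ∀ s t, a ≤ s → s ≤ t → t ≤ b → t - s < h →
      ‖θ t - θ s - (Y t (θ s) - Y s (θ s))‖ ≤ C * (t - s) ^ (2 * γ) := by
    intro s t h1 h2 h3 h4
    have ms : s ∈ Icc a b := ⟨h1, h2.trans h3⟩
    have mt : t ∈ Icc a b := ⟨h1.trans h2, h3⟩
    have hle : (hyperfilter ℕ : Filter ℕ) ≤ atTop := by
      rw [← Nat.cofinite_eq_atTop]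
      exact hyperfilter_le_cofinite
    have ls := (hκlim s ms).mono_left hle
    have lt := (hκlim t mt).mono_left hle
    set σ := fun n => a + κ n s * δ n with hσ
    set ϑ := fun n => a + κ n t * δ n with hϑ
    have mono : ∀ n, κ n s ≤ κ n t := fun n =>
      Nat.floor_mono (div_le_div_of_nonneg_right (by linarith) (hδ0 n))
    have hσϑ : ∀ n, σ n ≤ ϑ n := fun n => by
      have : (κ n s : ℝ) ≤ κ n t := by exact_mod_cast mono n
      simp only [hσ, hϑ]
      gcongr
    have haσ : ∀ n, a ≤ σ n := fun n => by
      have := hδ0 n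
      simp only [hσ]
      linarith [mul_nonneg (κ n s).cast_nonneg this]
    have hdef : ∀ᶠ n in hyperfilter ℕ, ‖u n (κ n t) - u n (κ n s) -
        (Y (ϑ n) (u n (κ n s)) - Y (σ n) (u n (κ n s)))‖ ≤ C * (ϑ n - σ n) ^ (2 * γ) := by
      filter_upwards [(lt.sub ls).eventually (gt_mem_nhds h4)] with n hn
      have e := hF.euler_defect hγ x (hδ0 n) hc hC0 hCc hLh (κ n t - κ n s) (κ n s)
      rw [Nat.add_sub_cancel' (mono n)] at e
      have e' : ((κ n t - κ n s : ℕ) : ℝ) * δ n = ϑ n - σ n := by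
        rw [Nat.cast_sub (mono n)]
        simp only [hσ, hϑ]
        ring
      rw [e'] at e
      exact e ((hκle n t mt).trans h3) hn.le
    -- The times and the point of evaluation all move with n. The Lipschitz bound absorbs the moving
    -- point, the growth bound the moving times.
    have hY : Tendsto (fun n => Y (ϑ n) (u n (κ n s)) - Y (σ n) (u n (κ n s))) (hyperfilter ℕ)
        (𝓝 (Y t (θ s) - Y s (θ s))) := by
      rw [tendsto_iff_norm_sub_tendsto_zero]
      have z0 : Tendsto (fun n => L * ‖u n (κ n s) - θ s‖ * (b - a) ^ γ + K * (t - ϑ n) ^ γ +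
          K * (s - σ n) ^ γ) (hyperfilter ℕ)
          (𝓝 (L * 0 * (b - a) ^ γ + K * 0 + K * 0)) := by
        have p0 : ∀ {f : ℕ → ℝ} {r : ℝ}, Tendsto f (hyperfilter ℕ) (𝓝 r) →
            Tendsto (fun n => (r - f n) ^ γ) (hyperfilter ℕ) (𝓝 0) := by
          intro f r hf
          have := ((tendsto_const_nhds (x := r)).sub hf).rpow_const (p := γ)
            (Or.inr (by linarith))
          simpa [Real.zero_rpow (by linarith : γ ≠ 0)] using this
        exact (((tendsto_const_nhds.mul
          (tendsto_iff_norm_sub_tendsto_zero.1 (hθ s ms))).mul_const _).add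
          ((p0 lt).const_mul _)).add ((p0 ls).const_mul _)
      simp only [mul_zero, zero_mul, add_zero] at z0
      refine squeeze_zero (fun n => norm_nonneg _) (fun n => ?_) z0
      have hϑb := (hκle n t mt).trans h3
      have e1 := hF.lip (σ n) (ϑ n) (haσ n) (hσϑ n) hϑb (θ s) trivial (u n (κ n s)) trivial
      have e2 := hF.growth (ϑ n) t ((haσ n).trans (hσϑ n)) (hκle n t mt) h3 (θ s) trivial
      have e3 := hF.growth (σ n) s (haσ n) (hκle n s ms) ms.2 (θ s) trivial
      have e4 : (ϑ n - σ n) ^ γ ≤ (b - a) ^ γ :=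
        Real.rpow_le_rpow (by linarith [hσϑ n]) (by linarith [haσ n]) (by linarith)
      have e5 : L * ‖u n (κ n s) - θ s‖ * (ϑ n - σ n) ^ γ ≤
          L * ‖u n (κ n s) - θ s‖ * (b - a) ^ γ := by gcongr
      have e6 : Y (ϑ n) (u n (κ n s)) - Y (σ n) (u n (κ n s)) - (Y t (θ s) - Y s (θ s)) =
          ((Y (ϑ n) (u n (κ n s)) - Y (σ n) (u n (κ n s))) - (Y (ϑ n) (θ s) - Y (σ n) (θ s))) -
          (Y t (θ s) - Y (ϑ n) (θ s)) + (Y s (θ s) - Y (σ n) (θ s)) := by abel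
      rw [e6]
      refine (norm_add_le _ _).trans (add_le_add ((norm_sub_le _ _).trans ?_) e3)
      linarith
    refine le_of_tendsto_of_tendsto (((hθ t mt).sub (hθ s ms)).sub hY).norm
      (((lt.sub ls).rpow_const (Or.inr (by linarith))).const_mul C) hdef
  -- The length is h / 2 because `short` needs the strict inequality t - s < h.
  refine ⟨C + (2 * B + K * (b - a) ^ γ) / (h / 2) ^ (2 * γ), fun s t h1 h2 h3 => ?_⟩
  have hB0 : 0 ≤ B := (norm_nonneg x).trans (le_max_left _ _)
  have hp : 0 ≤ (b - a) ^ γ := Real.rpow_nonneg hba _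
  refine le_rpow_of_short (by linarith) (half_pos hh) (by linarith) hC0 (by positivity)
    (fun h4 => short s t h1 h2 h3 (by linarith)) ?_
  have n1 := mem_closedBall_zero_iff.1 (hθB s)
  have n2 := mem_closedBall_zero_iff.1 (hθB t)
  have n3 := hF.growth s t h1 h2 h3 (θ s) trivial
  have n4 : K * (t - s) ^ γ ≤ K * (b - a) ^ γ := by
    gcongr
  refine (norm_sub_le _ _).trans ?_
  linarith [norm_sub_le (θ t) (θ s)]

end FieldBound

end Euler

/-! ### Solutions with a given initial value -/

section Solution

variable {E : Type*} [NormedAddCommGroup E] {γ : ℝ}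

/-- A solution on `[a,b]` of the Young equation driven by `Y`, with initial value `x`. -/
structure IsYoungSolution (Y : ℝ → E → E) (γ a b : ℝ) (x : E) (θ : ℝ → E) : Prop where
  initial : θ a = x
  bounded : ∃ R, ∀ t ∈ Icc a b, ‖θ t‖ ≤ R
  davie : IsDavieSolution Y (2 * γ) a b θ

lemma IsYoungSolution.mono {Y : ℝ → E → E} {a b b' : ℝ} {x : E} {θ : ℝ → E}
    (h : IsYoungSolution Y γ a b x θ) (hb : b' ≤ b) : IsYoungSolution Y γ a b' x θ where
  initial := h.initial
  bounded := h.bounded.imp fun _ hR t ht => hR t ⟨ht.1, ht.2.trans hb⟩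
  davie := h.davie.mono le_rfl hb

lemma IsYoungSolution.congr {Y : ℝ → E → E} {a b : ℝ} {x : E} {θ θ' : ℝ → E}
    (h : IsYoungSolution Y γ a b x θ) (hab : a ≤ b) (hθ : EqOn θ θ' (Icc a b)) :
    IsYoungSolution Y γ a b x θ' where
  initial := by rw [← hθ ⟨le_rfl, hab⟩, h.initial]
  bounded := h.bounded.imp fun _ hR t ht => by rw [← hθ ht]; exact hR t ht
  davie := h.davie.congr hθ

lemma continuousOn_of_holder {θ : ℝ → E} {a b N : ℝ} (hγ : 0 < γ)
    (h : ∀ s t, a ≤ s → s ≤ t → t ≤ b → ‖θ t - θ s‖ ≤ N * (t - s) ^ γ) :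
    ContinuousOn θ (Icc a b) := by
  intro t ht
  have hlim : Tendsto (fun s => N * |t - s| ^ γ) (𝓝[Icc a b] t) (𝓝 0) := by
    have h1 : Tendsto (fun s => |t - s|) (𝓝[Icc a b] t) (𝓝 0) := by
      have : Continuous fun s : ℝ => |t - s| := by fun_prop
      simpa using (this.tendsto t).mono_left nhdsWithin_le_nhds
    have h2 := (h1.rpow_const (p := γ) (Or.inr hγ.le)).const_mul N
    simpa [Real.zero_rpow hγ.ne'] using h2
  refine tendsto_iff_norm_sub_tendsto_zero.2
    (squeeze_zero' (Eventually.of_forall fun _ => norm_nonneg _) ?_ hlim)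
  filter_upwards [self_mem_nhdsWithin] with s hs
  rcases le_total s t with hst | hst
  · rw [norm_sub_rev, abs_of_nonneg (by linarith)]
    exact h s t hs.1 hst ht.2
  · rw [abs_of_nonpos (by linarith), neg_sub]
    exact h t s ht.1 hst hs.2

namespace FieldBound

lemma isYoungSolution {Y : ℝ → E → E} {K L M a b : ℝ} (hF : FieldBound Y γ K L M a b univ) (hγ : 0 ≤ γ) (hab : a ≤ b)
    {x : E} {θ : ℝ → E} (h0 : θ a = x) (hθ : IsDavieSolution Y (2 * γ) a b θ) :
    IsYoungSolution Y γ a b x θ := by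
  obtain ⟨N, hN, h⟩ := hF.exists_holder_of_solution hγ hθ (fun _ _ => trivial) hab
  refine ⟨h0, ⟨‖θ a‖ + N * (b - a) ^ γ, fun t ht => ?_⟩, hθ⟩
  have h1 := h a t le_rfl ht.1 ht.2
  have h2 : N * (t - a) ^ γ ≤ N * (b - a) ^ γ := by
    gcongr
    · linarith [ht.1]
    · exact ht.2
  have h3 := norm_le_norm_add_norm_sub' (θ t) (θ a)
  linarith

end FieldBound

end Solution

/-! ### Smooth fields -/

section SmoothField

open BoundedContinuousFunction

/-- The pairs `s < t` of times in `[0,T]`, as a discrete space. -/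
def TimePair (T : ℝ) : Type := {p : ℝ × ℝ // 0 ≤ p.1 ∧ p.1 < p.2 ∧ p.2 ≤ T}

/-- With the discrete topology every bounded function of the pair is continuous. Smoothness of a map
into `TimePair T →ᵇ E` then encodes differentiability in space uniformly over all time increments,
and the calculus of normed spaces applies. -/
instance (T : ℝ) : TopologicalSpace (TimePair T) := ⊥

instance (T : ℝ) : DiscreteTopology (TimePair T) := ⟨rfl⟩

/-! ### Four-point bounds from two bounded derivatives -/

section FourPoint

variable {E F : Type*} [NormedAddCommGroup E] [NormedSpace ℝ E] [NormedAddCommGroup F]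
  [NormedSpace ℝ F]

/-- The four-point bound for a function with bounded first and second derivatives. -/
lemma norm_four_point_le {H : E → F} {L M : ℝ} (hH : Differentiable ℝ H)
    (hL : ∀ x, ‖fderiv ℝ H x‖ ≤ L) (hM0 : 0 ≤ M)
    (hM : ∀ x y, ‖fderiv ℝ H y - fderiv ℝ H x‖ ≤ M * ‖y - x‖) (x x' y y' : E) :
    ‖(H y' - H y) - (H x' - H x)‖ ≤
      L * ‖(y' - y) - (x' - x)‖ + M * (‖y - x‖ + ‖y' - x'‖) * ‖x' - x‖ := by
  set p : ℝ → E := fun r => y + r • (y' - y) with hp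
  set q : ℝ → E := fun r => x + r • (x' - x) with hq
  have hder : ∀ (u v : E) (r : ℝ), HasDerivAt (fun r : ℝ => H (u + r • v))
      (fderiv ℝ H (u + r • v) v) r := fun u v r => by
    have h1 : HasDerivAt (fun r : ℝ => u + r • v) v r := by
      simpa using ((hasDerivAt_id r).smul_const v).const_add u
    exact (hH (u + r • v)).hasFDerivAt.comp_hasDerivAt r h1
  -- Both differences are taken along parallel parametrizations p, q of the segments from y to y'
  -- and from x to x'. The mean value inequality is applied to r ↦ H (p r) - H (q r).
  have key := norm_image_sub_le_of_norm_deriv_le_segment_01'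
    (f := fun r => H (p r) - H (q r))
    (f' := fun r => fderiv ℝ H (p r) (y' - y) - fderiv ℝ H (q r) (x' - x))
    (C := L * ‖(y' - y) - (x' - x)‖ + M * (‖y - x‖ + ‖y' - x'‖) * ‖x' - x‖)
    (fun r _ => ((hder y (y' - y) r).sub (hder x (x' - x) r)).hasDerivWithinAt) ?_
  · have e : (H y' - H y) - (H x' - H x) = (H (p 1) - H (q 1)) - (H (p 0) - H (q 0)) := by
      simp only [hp, hq, one_smul, zero_smul, add_zero, add_sub_cancel]
      abel
    rw [e]
    exact key
  · intro r hr
    have e1 : fderiv ℝ H (p r) (y' - y) - fderiv ℝ H (q r) (x' - x) =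
        fderiv ℝ H (p r) ((y' - y) - (x' - x)) +
          (fderiv ℝ H (p r) - fderiv ℝ H (q r)) (x' - x) := by
      rw [_root_.sub_apply, map_sub (fderiv ℝ H (p r)) (y' - y)]
      abel
    have e2 : p r - q r = (1 - r) • (y - x) + r • (y' - x') := by
      simp only [hp, hq]
      module
    have e3 : ‖p r - q r‖ ≤ ‖y - x‖ + ‖y' - x'‖ := by
      rw [e2]
      refine (norm_add_le _ _).trans ?_
      rw [norm_smul, norm_smul, Real.norm_of_nonneg (by linarith [hr.2]), Real.norm_of_nonneg hr.1]
      exact add_le_add (mul_le_of_le_one_left (norm_nonneg _) (by linarith [hr.1]))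
        (mul_le_of_le_one_left (norm_nonneg _) hr.2.le)
    rw [e1]
    refine (norm_add_le _ _).trans (add_le_add ?_ ?_)
    · exact (ContinuousLinearMap.le_opNorm _ _).trans
        (mul_le_mul_of_nonneg_right (hL _) (norm_nonneg _))
    · refine (ContinuousLinearMap.le_opNorm _ _).trans
        (mul_le_mul_of_nonneg_right ((hM _ _).trans ?_) (norm_nonneg _))
      exact mul_le_mul_of_nonneg_left e3 hM0

lemma contDiff_infty_fderiv {H : E → F} (hH : ContDiff ℝ ∞ H) : ContDiff ℝ ∞ (fderiv ℝ H) :=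
  hH.fderiv_right (by simp)

lemma exists_bounds_of_hasCompactSupport {H : E → F} (hH : ContDiff ℝ ∞ H)
    (hs : HasCompactSupport H) : (∃ K : ℝ, ∀ x, ‖H x‖ ≤ K) ∧ (∃ L : ℝ, ∀ x, ‖fderiv ℝ H x‖ ≤ L) ∧
      ∃ M : ℝ, ∀ x, ‖fderiv ℝ (fderiv ℝ H) x‖ ≤ M :=
  ⟨hH.continuous.bounded_above_of_compact_support hs,
    (contDiff_infty_fderiv hH).continuous.bounded_above_of_compact_support (hs.fderiv ℝ),
    (contDiff_infty_fderiv (contDiff_infty_fderiv hH)).continuous.bounded_above_of_compact_support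
      ((hs.fderiv ℝ).fderiv ℝ)⟩

end FourPoint

variable {E : Type*} [NormedAddCommGroup E] [NormedSpace ℝ E] {γ T : ℝ}

/-- The increments of the field `Y` are `Y_t(x) - Y_s(x) = (t - s)^γ H(x)(s,t)`, with a smooth
function `H` with values in the bounded functions on the set of pairs of times. -/
structure IsSmoothField (γ T : ℝ) (Y : ℝ → E → E) (H : E → (TimePair T →ᵇ E)) : Prop where
  contDiff : ContDiff ℝ ∞ H
  increment : ∀ (p : TimePair T) (x : E),
    Y p.1.2 x - Y p.1.1 x = (p.1.2 - p.1.1) ^ γ • H x p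

namespace IsSmoothField

variable {Y : ℝ → E → E} {H : E → (TimePair T →ᵇ E)}

/-- A field with bounded derivatives satisfies global bounds. -/
theorem fieldBound (hY : IsSmoothField γ T Y H) {K L M : ℝ} (hK : ∀ x, ‖H x‖ ≤ K)
    (hL : ∀ x, ‖fderiv ℝ H x‖ ≤ L) (hM : ∀ x, ‖fderiv ℝ (fderiv ℝ H) x‖ ≤ M) :
    FieldBound Y γ K L M 0 T univ := by
  have hK0 : 0 ≤ K := (norm_nonneg _).trans (hK 0)
  have hL0 : 0 ≤ L := (norm_nonneg _).trans (hL 0)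
  have hM0 : 0 ≤ M := (norm_nonneg (fderiv ℝ (fderiv ℝ H) 0)).trans (hM 0)
  have hd : Differentiable ℝ H := hY.contDiff.differentiable (by simp)
  have hd2 : Differentiable ℝ (fderiv ℝ H) :=
    (hY.contDiff.fderiv_right (m := ∞) (by simp)).differentiable (by simp)
  have hlip : ∀ x y, ‖fderiv ℝ H y - fderiv ℝ H x‖ ≤ M * ‖y - x‖ := fun x y =>
    convex_univ.norm_image_sub_le_of_norm_fderiv_le (fun x _ => hd2 x) (fun x _ => hM x)
      (mem_univ x) (mem_univ y)
  -- Pairs with s = t are not in `TimePair T`; for them the increments vanish.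
  have main : ∀ s t : ℝ, 0 ≤ s → s ≤ t → t ≤ T → (∀ x, Y t x - Y s x = 0) ∨
      ∃ p : TimePair T, ∀ x, Y t x - Y s x = (t - s) ^ γ • H x p := by
    intro s t h1 h2 h3
    rcases h2.eq_or_lt with rfl | h2
    · exact Or.inl fun x => sub_self _
    · exact Or.inr ⟨⟨(s, t), h1, h2, h3⟩, fun x => hY.increment ⟨(s, t), h1, h2, h3⟩ x⟩
  have scal : ∀ {s t : ℝ} {v : TimePair T →ᵇ E} {B : ℝ} (p : TimePair T), s ≤ t → ‖v‖ ≤ B →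
      ‖(t - s) ^ γ • v p‖ ≤ B * (t - s) ^ γ := by
    intro s t v B p hst hv
    have : 0 ≤ (t - s) ^ γ := Real.rpow_nonneg (by linarith) _
    rw [norm_smul, Real.norm_of_nonneg this, mul_comm]
    exact mul_le_mul_of_nonneg_right ((v.norm_coe_le_norm p).trans hv) this
  refine ⟨hK0, hL0, hM0, ?_, ?_, ?_⟩
  · intro s t h1 h2 h3 x _
    have : 0 ≤ (t - s) ^ γ := Real.rpow_nonneg (by linarith) _
    rcases main s t h1 h2 h3 with h | ⟨p, h⟩
    · rw [h, norm_zero]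
      positivity
    · rw [h]
      exact scal p h2 (hK x)
  · intro s t h1 h2 h3 x _ x' _
    have : 0 ≤ (t - s) ^ γ := Real.rpow_nonneg (by linarith) _
    rcases main s t h1 h2 h3 with h | ⟨p, h⟩
    · rw [h, h, sub_zero, norm_zero]
      positivity
    · rw [h, h, ← smul_sub, ← BoundedContinuousFunction.sub_apply]
      exact scal p h2 (convex_univ.norm_image_sub_le_of_norm_fderiv_le (fun x _ => hd x)
        (fun x _ => hL x) (mem_univ x) (mem_univ x'))
  · intro s t h1 h2 h3 x _ x' _ y _ y' _
    have : 0 ≤ (t - s) ^ γ := Real.rpow_nonneg (by linarith) _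
    rcases main s t h1 h2 h3 with h | ⟨p, h⟩
    · rw [h, h, h, h, sub_zero, sub_zero, norm_zero]
      positivity
    · rw [h, h, h, h, ← smul_sub, ← smul_sub, ← smul_sub, ← BoundedContinuousFunction.sub_apply,
        ← BoundedContinuousFunction.sub_apply, ← BoundedContinuousFunction.sub_apply]
      exact scal p h2 (norm_four_point_le hd hL hM0 hlip x x' y y')

variable [FiniteDimensional ℝ E]

/-- A smooth field coincides on a ball with a smooth field of compact support, which satisfies
global bounds. -/
theorem exists_cutoff (hY : IsSmoothField γ T Y H) (R : ℝ) :
    ∃ (Y' : ℝ → E → E) (K L M R' : ℝ), FieldBound Y' γ K L M 0 T univ ∧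
      (∀ t x, ‖x‖ ≤ R → Y' t x = Y t x) ∧ ∀ t x, R' ≤ ‖x‖ → Y' t x = 0 := by
  -- The maximum with 1 keeps the inner radius positive for every real R.
  set ψ : ContDiffBump (0 : E) := ⟨max R 1, max R 1 + 1, by positivity, by linarith⟩ with hψ
  have hc : ContDiff ℝ ∞ fun x => ψ x • H x := ψ.contDiff.smul hY.contDiff
  have hs : HasCompactSupport fun x => ψ x • H x := ψ.hasCompactSupport.smul_right
  obtain ⟨⟨K, hK⟩, ⟨L, hL⟩, M, hM⟩ := exists_bounds_of_hasCompactSupport hc hs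
  have hY' : IsSmoothField γ T (fun t x => ψ x • Y t x) fun x => ψ x • H x := by
    refine ⟨hc, fun p x => ?_⟩
    rw [← smul_sub, hY.increment, smul_comm]
    rfl
  refine ⟨fun t x => ψ x • Y t x, K, L, M, max R 1 + 1, hY'.fieldBound hK hL hM,
    fun t x hx => ?_, fun t x hx => ?_⟩
  · dsimp only
    rw [ψ.one_of_mem_closedBall, one_smul]
    rw [mem_closedBall_zero_iff]
    exact hx.trans (le_max_left _ _)
  · dsimp only
    rw [ψ.zero_of_le_dist, zero_smul]
    rw [dist_zero_right]
    exact hx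

/-- Solutions of a smooth equation are determined by their initial value. -/
theorem eqOn_of_solution (hY : IsSmoothField γ T Y H) (hγ : 1 / 2 < γ) {a b : ℝ} (ha : 0 ≤ a)
    (hb : b ≤ T) {x : E} {θ θ' : ℝ → E} (hθ : IsYoungSolution Y γ a b x θ)
    (hθ' : IsYoungSolution Y γ a b x θ') : EqOn θ θ' (Icc a b) := by
  obtain ⟨R, hR⟩ := hθ.bounded
  obtain ⟨R', hR'⟩ := hθ'.bounded
  obtain ⟨Y', K, L, M, -, hF, hYY', -⟩ := hY.exists_cutoff (max R R')
  refine (hF.mono ha hb).eqOn_of_solution hγ (hθ.davie.congr_field fun s hs t _ =>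
    (hYY' t _ ((hR s hs).trans (le_max_left _ _))).symm) (fun _ _ => trivial)
    (hθ'.davie.congr_field fun s hs t _ =>
      (hYY' t _ ((hR' s hs).trans (le_max_right _ _))).symm) (fun _ _ => trivial) ?_
  rw [hθ.initial, hθ'.initial]

/-- Solutions are `γ`-Hölder continuous. -/
theorem exists_holder_of_solution (hY : IsSmoothField γ T Y H) (hγ : 0 < γ) {a b : ℝ} (ha : 0 ≤ a)
    (hab : a ≤ b) (hb : b ≤ T) {x : E} {θ : ℝ → E} (hθ : IsYoungSolution Y γ a b x θ) :
    ∃ N, 0 ≤ N ∧ ∀ s t, a ≤ s → s ≤ t → t ≤ b → ‖θ t - θ s‖ ≤ N * (t - s) ^ γ := by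
  obtain ⟨R, hR⟩ := hθ.bounded
  obtain ⟨Y', K, L, M, -, hF, hYY', -⟩ := hY.exists_cutoff R
  exact (hF.mono ha hb).exists_holder_of_solution hγ.le (hθ.davie.congr_field fun s hs t _ =>
    (hYY' t _ (hR s hs)).symm) (fun _ _ => trivial) hab

end IsSmoothField

/-! ### Local existence, continuation and blow-up -/

namespace IsSmoothField

variable {Y : ℝ → E → E} {H : E → (TimePair T →ᵇ E)} [FiniteDimensional ℝ E]

/-- If there is a solution on `[0,τ]` for the initial value `x`, then for nearby initial values there
are solutions on a longer interval, and they depend on the initial value in a Lipschitz way. -/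
theorem exists_solution_nearby (hY : IsSmoothField γ T Y H) (hγ : 1 / 2 < γ) {τ : ℝ} (hτ : 0 ≤ τ)
    (hτT : τ ≤ T) {x : E} {θ : ℝ → E} (hθ : IsYoungSolution Y γ 0 τ x θ) :
    ∃ τ', τ ≤ τ' ∧ τ' ≤ T ∧ (τ < T → τ < τ') ∧ ∃ ε > 0, ∃ C, 0 ≤ C ∧ ∀ x' ∈ Metric.ball x ε,
      ∃ θ', IsYoungSolution Y γ 0 τ' x' θ' ∧ (∀ t ∈ Icc 0 τ, ‖θ' t - θ t‖ ≤ C * ‖x' - x‖) ∧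
        ∀ s t, 0 ≤ s → s ≤ t → t ≤ τ →
          ‖(θ' t - θ t) - (θ' s - θ s) - ((Y t (θ' s) - Y s (θ' s)) - (Y t (θ s) - Y s (θ s)))‖ ≤
            C * ‖x' - x‖ * (t - s) ^ (2 * γ) := by
  have := FiniteDimensional.proper_real E
  have hT : 0 ≤ T := hτ.trans hτT
  obtain ⟨R, hR⟩ := hθ.bounded
  -- The margin 1 is spent in two halves: on the motion of the solution during the extra time h, and
  -- on the distance of neighbouring solutions from it. The cut-off is therefore never felt.
  obtain ⟨Y', K, L, M, R', hF, hYY', hsupp⟩ := hY.exists_cutoff (R + 1)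
  have ex : ∀ x' : E, ∃ θ' : ℝ → E, IsYoungSolution Y' γ 0 T x' θ' := fun x' => by
    obtain ⟨θ', h0, h⟩ := hF.exists_solution hγ hT (R := R')
      (fun s _ t _ x hx => by rw [hsupp t x hx, hsupp s x hx, sub_zero]) x'
    exact ⟨θ', hF.isYoungSolution (by linarith) hT h0 h⟩
  choose Θ hΘ using ex
  have hθ' : IsDavieSolution Y' (2 * γ) 0 τ θ := hθ.davie.congr_field fun s hs t _ =>
    (hYY' t _ ((hR s hs).trans (by linarith))).symm
  have heq : EqOn θ (Θ x) (Icc 0 τ) := (hF.mono le_rfl hτT).eqOn_of_solution hγ hθ'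
    (fun _ _ => trivial) ((hΘ x).davie.mono le_rfl hτT) (fun _ _ => trivial)
    (by rw [hθ.initial, (hΘ x).initial])
  obtain ⟨N, hN, hhol⟩ := hF.exists_holder_of_solution (by linarith) (hΘ x).davie
    (fun _ _ => trivial) hT
  obtain ⟨h, hh, hhε⟩ := exists_pos_rpow_le (γ := γ) (ε := 1 / (2 * (N + 1))) (by linarith)
    (by positivity)
  obtain ⟨C, hC0, hC⟩ := hF.exists_difference_bound hγ hT
  have hτ' : min T (τ + h) ≤ T := min_le_left _ _
  have hbound : ∀ t ∈ Icc 0 (min T (τ + h)), ‖Θ x t‖ ≤ R + 1 / 2 := by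
    intro t ht
    rcases le_total t τ with h1 | h1
    · rw [← heq ⟨ht.1, h1⟩]
      linarith [hR t ⟨ht.1, h1⟩]
    · have e1 := hhol τ t hτ h1 (ht.2.trans hτ')
      have e2 : (t - τ) ^ γ ≤ h ^ γ :=
        Real.rpow_le_rpow (by linarith) (by linarith [ht.2.trans (min_le_right _ _)]) (by linarith)
      have e3 : N * (t - τ) ^ γ ≤ 1 / 2 := by
        refine (mul_le_mul_of_nonneg_left e2 hN).trans ?_
        rw [hhε, mul_div_assoc', div_le_div_iff₀ (by positivity) (by norm_num)]
        linarith
      have e4 := norm_le_norm_add_norm_sub' (Θ x t) (Θ x τ)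
      rw [← heq ⟨hτ, le_rfl⟩] at e4 e1
      linarith [hR τ ⟨hτ, le_rfl⟩]
  refine ⟨min T (τ + h), le_min hτT (by linarith), hτ', fun h1 => lt_min h1 (by linarith),
    1 / (2 * (C + 1)), by positivity, C, hC0, fun x' hx' => ⟨Θ x', ⟨(hΘ x').initial, ?_, ?_⟩, ?_, ?_⟩⟩
  · exact (hΘ x').bounded.imp fun _ hB t ht => hB t ⟨ht.1, ht.2.trans hτ'⟩
  · refine ((hΘ x').davie.mono le_rfl hτ').congr_field fun s hs t _ => hYY' t _ ?_
    have e1 := (hC _ _ (hΘ x).davie (fun _ _ => trivial) (hΘ x').davie (fun _ _ => trivial)).1 s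
      ⟨hs.1, hs.2.trans hτ'⟩
    rw [(hΘ x).initial, (hΘ x').initial, ← dist_eq_norm x' x] at e1
    have e2 : C * dist x' x ≤ 1 / 2 := by
      refine (mul_le_mul_of_nonneg_left (Metric.mem_ball.1 hx').le hC0).trans ?_
      rw [mul_div_assoc', div_le_div_iff₀ (by positivity) (by norm_num)]
      linarith
    have e3 := norm_le_norm_add_norm_sub' (Θ x' s) (Θ x s)
    linarith [hbound s hs]
  · intro t ht
    have e1 := (hC _ _ (hΘ x).davie (fun _ _ => trivial) (hΘ x').davie (fun _ _ => trivial)).1 t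
      ⟨ht.1, ht.2.trans hτT⟩
    rwa [(hΘ x).initial, (hΘ x').initial, ← heq ht] at e1
  · intro s t h1 h2 h3
    have e1 := (hC _ _ (hΘ x).davie (fun _ _ => trivial) (hΘ x').davie (fun _ _ => trivial)).2 s t
      h1 h2 (h3.trans hτT)
    rw [(hΘ x).initial, (hΘ x').initial, ← heq ⟨h1, h2.trans h3⟩, ← heq ⟨h1.trans h2, h3⟩] at e1
    have hs : Y' t (Θ x' s) - Y' s (Θ x' s) = Y t (Θ x' s) - Y s (Θ x' s) := by
      have e2 := (hC _ _ (hΘ x).davie (fun _ _ => trivial) (hΘ x').davie (fun _ _ => trivial)).1 s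
        ⟨h1, (h2.trans h3).trans hτT⟩
      rw [(hΘ x).initial, (hΘ x').initial, ← dist_eq_norm x' x] at e2
      have e3 : C * dist x' x ≤ 1 / 2 := by
        refine (mul_le_mul_of_nonneg_left (Metric.mem_ball.1 hx').le hC0).trans ?_
        rw [mul_div_assoc', div_le_div_iff₀ (by positivity) (by norm_num)]
        linarith
      have e4 := norm_le_norm_add_norm_sub' (Θ x' s) (Θ x s)
      have e5 := hbound s ⟨h1, (h2.trans h3).trans (le_min hτT (by linarith))⟩
      rw [hYY' t _ (by linarith), hYY' s _ (by linarith)]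
    have hs' : Y' t (θ s) - Y' s (θ s) = Y t (θ s) - Y s (θ s) := by
      have := hR s ⟨h1, h2.trans h3⟩
      rw [hYY' t _ (by linarith), hYY' s _ (by linarith)]
    rw [hs, hs'] at e1
    exact e1

/-- A bounded solution on a half-open interval extends to the closed interval. -/
theorem exists_solution_of_bounded (hY : IsSmoothField γ T Y H) (hγ : 1 / 2 < γ) {σ : ℝ}
    (hσ : 0 < σ) (hσT : σ ≤ T) {x : E} {θ : ℝ → E}
    (hθ : ∀ τ ∈ Ico 0 σ, IsYoungSolution Y γ 0 τ x θ) {R : ℝ} (hR : ∀ t ∈ Ico 0 σ, ‖θ t‖ ≤ R) :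
    ∃ θ', IsYoungSolution Y γ 0 σ x θ' := by
  have := FiniteDimensional.proper_real E
  obtain ⟨Y', K, L, M, R', hF, hYY', hsupp⟩ := hY.exists_cutoff R
  have hF' := hF.mono le_rfl hσT
  obtain ⟨Θ, h0, hΘ⟩ := hF'.exists_solution hγ hσ.le (R := R')
    (fun s _ t _ x hx => by rw [hsupp t x hx, hsupp s x hx, sub_zero]) x
  obtain ⟨N, hN, hhol⟩ := hF'.exists_holder_of_solution (by linarith) hΘ (fun _ _ => trivial) hσ.le
  have hcont := continuousOn_of_holder (by linarith) hhol
  -- Before time σ the solution of the cut-off equation is θ itself, by uniqueness. Continuity then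
  -- carries the bound R to σ, so it solves the original equation on the closed interval.
  have hlt : ∀ t ∈ Ico 0 σ, ‖Θ t‖ ≤ R := by
    intro t ht
    have heq := (hF.mono le_rfl (ht.2.le.trans hσT)).eqOn_of_solution hγ
      ((hθ t ht).davie.congr_field fun s hs t' _ =>
        (hYY' t' _ (hR s ⟨hs.1, hs.2.trans_lt ht.2⟩)).symm)
      (fun _ _ => trivial) (hΘ.mono le_rfl ht.2.le) (fun _ _ => trivial)
      (by rw [(hθ t ht).initial, h0])
    rw [← heq ⟨ht.1, le_rfl⟩]
    exact hR t ht
  have hle : ∀ t ∈ Icc 0 σ, ‖Θ t‖ ≤ R := by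
    intro t ht
    have hsub : Icc 0 σ ⊆ closure (Ico 0 σ) := (closure_Ico hσ.ne).symm.subset
    have hmem := hsub ht
    have : (𝓝[Ico 0 σ] t).NeBot := mem_closure_iff_nhdsWithin_neBot.1 hmem
    refine le_of_tendsto ((hcont t ht).mono_left (nhdsWithin_mono _ Ico_subset_Icc_self)).norm ?_
    filter_upwards [self_mem_nhdsWithin] with s hs using hlt s hs
  exact ⟨Θ, h0, ⟨R, hle⟩, hΘ.congr_field fun s hs t _ => hYY' t _ (hle s hs)⟩

/-- A solution which cannot be extended to the end point of its interval of existence tends to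
infinity there. -/
theorem tendsto_norm_atTop_of_not_exists (hY : IsSmoothField γ T Y H) (hγ : 1 / 2 < γ) {σ : ℝ}
    (hσ : 0 < σ) (hσT : σ ≤ T) {x : E} {θ : ℝ → E}
    (hθ : ∀ τ ∈ Ico 0 σ, IsYoungSolution Y γ 0 τ x θ)
    (hno : ¬ ∃ θ', IsYoungSolution Y γ 0 σ x θ') :
    Tendsto (fun t => ‖θ t‖) (𝓝[<] σ) atTop := by
  have := FiniteDimensional.proper_real E
  rw [tendsto_atTop]
  intro R
  by_contra hcon
  refine hno ?_
  obtain ⟨Y', K, L, M, R', hF, hYY', hsupp⟩ := hY.exists_cutoff (R + 1)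
  have hK := hF.nonneg_K
  have hL := hF.nonneg_L
  have hQ := one_le_sewingConst (α := 2 * γ) (by linarith)
  -- The length h depends on R but not on the starting time. One W covers both requirements: the
  -- smallness in `holder_of_solution` and a displacement 2 K h^γ of at most 1/2.
  set W := sewingConst (2 * γ) * L + 2 * K with hW
  have hW0 : 0 ≤ W := by positivity
  obtain ⟨h, hh, hhW⟩ := exists_pos_rpow_le (γ := γ) (ε := 1 / (2 * (W + 1))) (by linarith)
    (by positivity)
  have hh2 : h ^ γ * W ≤ 1 / 2 := by
    rw [hhW, div_mul_eq_mul_div, div_le_div_iff₀ (by positivity) (by norm_num)]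
    linarith
  have hfr : ∃ᶠ t in 𝓝[<] σ, ‖θ t‖ < R := by
    intro h1
    exact hcon (h1.mono fun t ht => not_lt.1 ht)
  -- If the norm does not tend to infinity, θ is below some R at a time closer to σ than h.
  -- Restarted there, it stays below R + 1 up to σ, hence is bounded and extends.
  obtain ⟨t₀, ht₀R, ht₀, ht₀σ⟩ := (hfr.and_eventually
    (Ioo_mem_nhdsLT (max_lt hσ (by linarith : σ - h < σ)))).exists
  have h0t₀ : 0 ≤ t₀ := (le_max_left _ _).trans ht₀.le
  have hσt₀ : σ - t₀ ≤ h := by linarith [(le_max_right 0 (σ - h)).trans ht₀.le]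
  have hFσ := hF.mono h0t₀ hσT
  obtain ⟨ζ, hζ0, hζ⟩ := hFσ.exists_solution hγ ht₀σ.le (R := R')
    (fun s _ t _ x hx => by rw [hsupp t x hx, hsupp s x hx, sub_zero]) (θ t₀)
  have hpow : (σ - t₀) ^ γ ≤ h ^ γ := Real.rpow_le_rpow (by linarith) hσt₀ (by linarith)
  have hpow0 : 0 ≤ (σ - t₀) ^ γ := Real.rpow_nonneg (by linarith) _
  have hhol := hFσ.holder_of_solution hγ hζ (fun _ _ => trivial) ht₀σ.le (by
    refine le_trans ?_ hh2
    gcongr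
    linarith)
  have hζR : ∀ t ∈ Icc t₀ σ, ‖ζ t‖ ≤ R + 1 := by
    intro t ht
    have e1 := hhol t₀ t le_rfl ht.1 ht.2
    have e2 : (t - t₀) ^ γ ≤ h ^ γ :=
      Real.rpow_le_rpow (by linarith [ht.1]) (by linarith [ht.2]) (by linarith)
    have e3 : 2 * K * (t - t₀) ^ γ ≤ h ^ γ * W := by
      rw [mul_comm (h ^ γ)]
      refine mul_le_mul ?_ e2 (Real.rpow_nonneg (by linarith [ht.1]) _) hW0
      have : 0 ≤ sewingConst (2 * γ) * L := by positivity
      linarith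
    have e4 := norm_le_norm_add_norm_sub' (ζ t) (ζ t₀)
    rw [hζ0] at e4 e1
    linarith
  have hζY : IsDavieSolution Y (2 * γ) t₀ σ ζ := hζ.congr_field fun s hs t _ => hYY' t _ (hζR s hs)
  obtain ⟨B, hB⟩ := (hθ t₀ ⟨h0t₀, ht₀σ⟩).bounded
  refine hY.exists_solution_of_bounded hγ hσ hσT hθ (R := max B (R + 1)) fun t ht => ?_
  rcases le_total t t₀ with h1 | h1
  · exact le_max_of_le_left (hB t ⟨ht.1, h1⟩)
  · have heq := hY.eqOn_of_solution hγ h0t₀ (ht.2.le.trans hσT) (x := θ t₀) (θ := θ) (θ' := ζ)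
      (b := t) ⟨rfl, (hθ t ht).bounded.imp fun _ hB s hs => hB s ⟨h0t₀.trans hs.1, hs.2⟩,
        (hθ t ht).davie.mono h0t₀ le_rfl⟩
      ⟨hζ0, ⟨R + 1, fun s hs => hζR s ⟨hs.1, hs.2.trans ht.2.le⟩⟩, hζY.mono le_rfl ht.2.le⟩
    rw [heq ⟨h1, le_rfl⟩]
    exact le_max_of_le_right (hζR t ⟨h1, ht.2.le⟩)

end IsSmoothField

end SmoothField

/-! ### The tangent equation and smoothness of the flow -/

section Flow

open BoundedContinuousFunction

universe u

variable {E : Type*} [NormedAddCommGroup E] [NormedSpace ℝ E] {γ T : ℝ}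

/-- The tangent field `(x, v) ↦ (Y_t(x), DY_t(x) v)`; the derivative is that of the increment
`Y_t - Y_0`. -/
def tangentField (Y : ℝ → E → E) (t : ℝ) (z : E × E) : E × E :=
  (Y t z.1, fderiv ℝ (fun x => Y t x - Y 0 x) z.1 z.2)

/-- The function `H` which belongs to the tangent field. -/
def tangentSymbol (H : E → (TimePair T →ᵇ E)) (z : E × E) : TimePair T →ᵇ (E × E) :=
  (ContinuousLinearMap.inl ℝ E E).compLeftContinuousBounded (TimePair T) (H z.1) +
    (ContinuousLinearMap.inr ℝ E E).compLeftContinuousBounded (TimePair T) (fderiv ℝ H z.1 z.2)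

lemma tangentSymbol_apply (H : E → (TimePair T →ᵇ E)) (z : E × E) (p : TimePair T) :
    tangentSymbol H z p = (H z.1 p, fderiv ℝ H z.1 z.2 p) := by
  simp [tangentSymbol]

namespace IsSmoothField

variable {Y : ℝ → E → E} {H : E → (TimePair T →ᵇ E)}

lemma hasFDerivAt_increment (hY : IsSmoothField γ T Y H) (p : TimePair T) (x : E) :
    HasFDerivAt (fun x => Y p.1.2 x - Y p.1.1 x)
      ((p.1.2 - p.1.1) ^ γ • (evalCLM ℝ p).comp (fderiv ℝ H x)) x := by
  have h1 : HasFDerivAt H (fderiv ℝ H x) x :=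
    (hY.contDiff.differentiable (by simp) x).hasFDerivAt
  have h2 := (((evalCLM ℝ p).hasFDerivAt (x := H x)).comp x h1).const_smul
    ((p.1.2 - p.1.1) ^ γ)
  refine h2.congr_of_eventuallyEq (Eventually.of_forall fun y => ?_)
  exact hY.increment p y

lemma differentiableAt_sub_zero (hY : IsSmoothField γ T Y H) {t : ℝ} (h0 : 0 ≤ t) (hT : t ≤ T)
    (x : E) : DifferentiableAt ℝ (fun x => Y t x - Y 0 x) x := by
  rcases h0.eq_or_lt with rfl | h0
  · simp only [sub_self]
    exact differentiableAt_const _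
  · exact (hY.hasFDerivAt_increment ⟨(0, t), le_rfl, h0, hT⟩ x).differentiableAt

/-- The derivative of an increment is the increment of the tangent field. -/
lemma hasFDerivAt_sub (hY : IsSmoothField γ T Y H) {s t : ℝ} (hs : 0 ≤ s) (hst : s ≤ t)
    (hT : t ≤ T) (x : E) : HasFDerivAt (fun x => Y t x - Y s x)
      (fderiv ℝ (fun x => Y t x - Y 0 x) x - fderiv ℝ (fun x => Y s x - Y 0 x) x) x := by
  have h := (hY.differentiableAt_sub_zero (hs.trans hst) hT x).hasFDerivAt.sub
    (hY.differentiableAt_sub_zero hs (hst.trans hT) x).hasFDerivAt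
  refine h.congr_of_eventuallyEq (Eventually.of_forall fun y => ?_)
  simp

lemma contDiff_tangentSymbol (hY : IsSmoothField γ T Y H) : ContDiff ℝ ∞ (tangentSymbol H) := by
  have h1 : ContDiff ℝ ∞ fun z : E × E => H z.1 := hY.contDiff.comp contDiff_fst
  have h2 : ContDiff ℝ ∞ fun z : E × E => fderiv ℝ H z.1 z.2 :=
    ((contDiff_infty_fderiv hY.contDiff).comp contDiff_fst).clm_apply contDiff_snd
  exact (((ContinuousLinearMap.inl ℝ E E).compLeftContinuousBounded (TimePair T)).contDiff.comp
    h1).add (((ContinuousLinearMap.inr ℝ E E).compLeftContinuousBounded (TimePair T)).contDiff.comp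
    h2)

/-- The tangent field is smooth. -/
theorem tangent (hY : IsSmoothField γ T Y H) :
    IsSmoothField γ T (tangentField Y) (tangentSymbol H) := by
  refine ⟨hY.contDiff_tangentSymbol, fun p z => ?_⟩
  rw [tangentSymbol_apply, Prod.smul_mk]
  refine Prod.ext (hY.increment p z.1) ?_
  have h := (hY.hasFDerivAt_sub p.2.1 p.2.2.1.le p.2.2.2 z.1).unique (hY.hasFDerivAt_increment p z.1)
  exact congrArg (fun l : E →L[ℝ] E => l z.2) h

variable [FiniteDimensional ℝ E]

/-- Along a family of solutions, the limit of the difference quotients along an ultrafilter solves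
the tangent equation. -/
lemma exists_tangent_solution (hY : IsSmoothField γ T Y H) (hγ : 1 / 2 < γ) {τ : ℝ} (hτ : 0 ≤ τ)
    (hτT : τ ≤ T) {U : Set E} (hU : IsOpen U) {Φ : E → ℝ → E}
    (hΦ : ∀ x ∈ U, IsYoungSolution Y γ 0 τ x (Φ x)) {x : E} (hx : x ∈ U) (v : E)
    (𝒰 : Ultrafilter ℝ) (h𝒰 : (𝒰 : Filter ℝ) ≤ 𝓝[≠] 0) :
    ∃ J : ℝ → E, IsYoungSolution (tangentField Y) γ 0 τ (x, v) (fun t => (Φ x t, J t)) ∧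
      ∀ t ∈ Icc 0 τ, Tendsto (fun ε : ℝ => ε⁻¹ • (Φ (x + ε • v) t - Φ x t)) 𝒰 (𝓝 (J t)) := by
  have := FiniteDimensional.proper_real E
  obtain ⟨τ', hττ', hτ'T, -, r, hr, C, hC0, hC⟩ :=
    hY.exists_solution_nearby hγ hτ hτT (hΦ x hx)
  set D : ℝ → ℝ → E := fun ε t => ε⁻¹ • (Φ (x + ε • v) t - Φ x t) with hD
  -- After division by ε, the Lipschitz dependence on the initial value and its remainder estimate
  -- become bounds uniform in ε. They are a supremum bound and a Davie estimate for the difference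
  -- quotients.
  have hgood : ∀ᶠ ε in 𝓝[≠] (0 : ℝ), ε ≠ 0 ∧ (∀ t ∈ Icc 0 τ, ‖D ε t‖ ≤ C * ‖v‖) ∧ D ε 0 = v ∧
      ∀ s t, 0 ≤ s → s ≤ t → t ≤ τ → ‖D ε t - D ε s - ε⁻¹ • ((Y t (Φ x s + ε • D ε s) -
        Y s (Φ x s + ε • D ε s)) - (Y t (Φ x s) - Y s (Φ x s)))‖ ≤
          C * ‖v‖ * (t - s) ^ (2 * γ) := by
    have hcont : Tendsto (fun ε : ℝ => x + ε • v) (𝓝[≠] 0) (𝓝 x) := by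
      have : Continuous fun ε : ℝ => x + ε • v := by fun_prop
      simpa using (this.tendsto 0).mono_left nhdsWithin_le_nhds
    filter_upwards [hcont.eventually (hU.mem_nhds hx), hcont.eventually (Metric.ball_mem_nhds x hr),
      self_mem_nhdsWithin] with ε hεU hεr hε
    have hε0 : ε ≠ 0 := hε
    obtain ⟨θ', hθ', hb, hrem⟩ := hC _ hεr
    have heq : EqOn (Φ (x + ε • v)) θ' (Icc 0 τ) :=
      hY.eqOn_of_solution hγ le_rfl hτT (hΦ _ hεU) (hθ'.mono hττ')
    have hn : ∀ A B : ℝ, A ≤ C * ‖x + ε • v - x‖ * B → |ε|⁻¹ * A ≤ C * ‖v‖ * B := by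
      intro A B h
      rw [add_sub_cancel_left, norm_smul, Real.norm_eq_abs] at h
      rw [inv_mul_le_iff₀ (abs_pos.2 hε0)]
      linarith
    have hnorm : ∀ w : E, ‖ε⁻¹ • w‖ = |ε|⁻¹ * ‖w‖ := fun w => by
      rw [norm_smul, norm_inv, Real.norm_eq_abs]
    refine ⟨hε0, fun t ht => ?_, ?_, fun s t h1 h2 h3 => ?_⟩
    · have := hn ‖θ' t - Φ x t‖ 1 (by rw [mul_one]; exact hb t ht)
      rw [← heq ht, mul_one] at this
      simpa only [hD, hnorm] using this
    · simp only [hD, (hΦ _ hεU).initial, (hΦ x hx).initial, add_sub_cancel_left]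
      rw [smul_smul, inv_mul_cancel₀ hε0, one_smul]
    · have e := hn _ _ (hrem s t h1 h2 h3)
      rw [← heq ⟨h1, h2.trans h3⟩, ← heq ⟨h1.trans h2, h3⟩, ← hnorm] at e
      have e2 : Φ x s + ε • D ε s = Φ (x + ε • v) s := by
        simp only [hD]
        rw [smul_smul, mul_inv_cancel₀ hε0, one_smul, add_sub_cancel]
      rw [e2]
      simp only [hD, ← smul_sub]
      exact e
  have hgood' := h𝒰 hgood
  have hlim : ∀ t : ℝ, ∃ y ∈ Metric.closedBall (0 : E) (C * ‖v‖), t ∈ Icc 0 τ →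
      Tendsto (fun ε => D ε t) 𝒰 (𝓝 y) := by
    intro t
    by_cases ht : t ∈ Icc 0 τ
    · obtain ⟨y, hy, h⟩ := (isCompact_closedBall (0 : E) (C * ‖v‖)).ultrafilter_le_nhds'
        (𝒰.map fun ε => D ε t) (Ultrafilter.mem_map.2 (by
          filter_upwards [hgood'] with ε hε
          exact mem_closedBall_zero_iff.2 (hε.2.1 t ht)))
      exact ⟨y, hy, fun _ => h⟩
    · exact ⟨0, Metric.mem_closedBall_self (by positivity), fun h => absurd h ht⟩
  choose J hJb hJ using hlim
  refine ⟨J, ⟨?_, ?_, ?_⟩, hJ⟩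
  · refine Prod.ext (hΦ x hx).initial (tendsto_nhds_unique (hJ 0 ⟨le_rfl, hτ⟩) ?_)
    refine tendsto_nhds_of_eventually_eq ?_
    filter_upwards [hgood'] with ε hε using hε.2.2.1
  · obtain ⟨R, hR⟩ := (hΦ x hx).bounded
    refine ⟨max R (C * ‖v‖), fun t ht => ?_⟩
    exact max_le_max (hR t ht) (mem_closedBall_zero_iff.1 (hJb t))
  · obtain ⟨C', hC'⟩ := (hΦ x hx).davie
    refine ⟨max C' (C * ‖v‖), fun s t h1 h2 h3 => ?_⟩
    have hp : 0 ≤ (t - s) ^ (2 * γ) := Real.rpow_nonneg (by linarith) _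
    refine max_le ((hC' s t h1 h2 h3).trans (mul_le_mul_of_nonneg_right (le_max_left _ _) hp)) ?_
    refine le_trans ?_ (mul_le_mul_of_nonneg_right (le_max_right C' (C * ‖v‖)) hp)
    have ms : s ∈ Icc 0 τ := ⟨h1, h2.trans h3⟩
    have hder := (hY.hasFDerivAt_sub h1 h2 (h3.trans hτT) (Φ x s)).hasFDerivWithinAt (s := univ)
    have hεlim : Tendsto (fun ε : ℝ => ε) 𝒰 (𝓝 0) := h𝒰.trans nhdsWithin_le_nhds
    have hd : Tendsto (fun ε => ε • D ε s) 𝒰 (𝓝 0) := by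
      simpa using hεlim.smul (hJ s ms)
    have hcd : Tendsto (fun ε => ε⁻¹ • (ε • D ε s)) 𝒰 (𝓝 (J s)) := by
      refine (hJ s ms).congr' ?_
      filter_upwards [hgood'] with ε hε
      rw [smul_smul, inv_mul_cancel₀ hε.1, one_smul]
    -- For fixed s and t, the quotient of the field increment along directions D ε s → J s converges
    -- to its derivative in the direction J s. Only differentiability at the single point Φ x s is
    -- needed.
    have hlim := hder.lim (l := (𝒰 : Filter ℝ)) (c := fun ε => ε⁻¹) (d := fun ε => ε • D ε s) hd
      (Eventually.of_forall fun _ => mem_univ _) hcd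
    refine le_of_tendsto (((hJ t ⟨h1.trans h2, h3⟩).sub (hJ s ms)).sub hlim).norm ?_
    filter_upwards [hgood'] with ε hε using hε.2.2.2 s t h1 h2 h3

/-- The flow has directional derivatives, which solve the tangent equation. -/
theorem exists_directional_derivative (hY : IsSmoothField γ T Y H) (hγ : 1 / 2 < γ) {τ : ℝ}
    (hτ : 0 ≤ τ) (hτT : τ ≤ T) {U : Set E} (hU : IsOpen U) {Φ : E → ℝ → E}
    (hΦ : ∀ x ∈ U, IsYoungSolution Y γ 0 τ x (Φ x)) {x : E} (hx : x ∈ U) (v : E) :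
    ∃ J : ℝ → E, IsYoungSolution (tangentField Y) γ 0 τ (x, v) (fun t => (Φ x t, J t)) ∧
      ∀ t ∈ Icc 0 τ, HasDerivAt (fun ε : ℝ => Φ (x + ε • v) t) (J t) 0 := by
  obtain ⟨J, hJ, -⟩ := hY.exists_tangent_solution hγ hτ hτT hU hΦ hx v
    (Ultrafilter.of (𝓝[≠] 0)) (Ultrafilter.of_le _)
  refine ⟨J, hJ, fun t ht => ?_⟩
  rw [hasDerivAt_iff_tendsto_slope]
  have : slope (fun ε : ℝ => Φ (x + ε • v) t) 0 = fun ε : ℝ => ε⁻¹ • (Φ (x + ε • v) t - Φ x t) := by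
    ext1 ε
    simp [slope]
  -- Along any ultrafilter the quotients converge to a solution of the tangent equation with the
  -- same initial value, and uniqueness identifies it with J. So the full limit exists.
  rw [this, tendsto_iff_ultrafilter]
  intro 𝒰 h𝒰
  obtain ⟨J', hJ', hlim⟩ := hY.exists_tangent_solution hγ hτ hτT hU hΦ hx v 𝒰 h𝒰
  have heq := hY.tangent.eqOn_of_solution hγ le_rfl hτT hJ hJ' ht
  rw [show J t = J' t from congrArg Prod.snd heq]
  exact hlim t ht

/-- Superposition of solutions of the tangent equation. -/
lemma tangent_superposition (hY : IsSmoothField γ T Y H) (hγ : 1 / 2 < γ) {τ : ℝ}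
    (hτT : τ ≤ T) {x v v' : E} {θ J J' J'' : ℝ → E} (c c' : ℝ)
    (h : IsYoungSolution (tangentField Y) γ 0 τ (x, v) (fun t => (θ t, J t)))
    (h' : IsYoungSolution (tangentField Y) γ 0 τ (x, v') (fun t => (θ t, J' t)))
    (h'' : IsYoungSolution (tangentField Y) γ 0 τ (x, c • v + c' • v') (fun t => (θ t, J'' t))) :
    ∀ t ∈ Icc 0 τ, J'' t = c • J t + c' • J' t := by
  intro t ht
  -- The tangent field is linear in its second component, so the Davie estimates combine linearly.
  have key : IsYoungSolution (tangentField Y) γ 0 τ (x, c • v + c' • v')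
      (fun t => (θ t, c • J t + c' • J' t)) := by
    obtain ⟨R, hR⟩ := h.bounded
    obtain ⟨R', hR'⟩ := h'.bounded
    obtain ⟨C, hC⟩ := h.davie
    obtain ⟨C', hC'⟩ := h'.davie
    refine ⟨?_, ⟨max R (|c| * R + |c'| * R'), fun s hs => ?_⟩,
      ⟨max C (|c| * C + |c'| * C'), fun r s h1 h2 h3 => ?_⟩⟩
    · have e1 := congrArg Prod.fst h.initial
      have e2 := congrArg Prod.snd h.initial
      have e3 := congrArg Prod.snd h'.initial
      dsimp only at e1 e2 e3
      rw [e1, e2, e3]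
    · refine max_le_max ((norm_fst_le (θ s, J s)).trans (hR s hs)) ((norm_add_le _ _).trans ?_)
      rw [norm_smul, norm_smul, Real.norm_eq_abs, Real.norm_eq_abs]
      exact add_le_add
        (mul_le_mul_of_nonneg_left ((norm_snd_le (θ s, J s)).trans (hR s hs)) (abs_nonneg _))
        (mul_le_mul_of_nonneg_left ((norm_snd_le (θ s, J' s)).trans (hR' s hs)) (abs_nonneg _))
    · have hp : 0 ≤ (s - r) ^ (2 * γ) := Real.rpow_nonneg (by linarith) _
      have e1 := hC r s h1 h2 h3
      have e2 := hC' r s h1 h2 h3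
      have f0 := (norm_fst_le _).trans e1
      refine max_le (f0.trans (mul_le_mul_of_nonneg_right (le_max_left _ _) hp)) ?_
      refine le_trans ?_ (mul_le_mul_of_nonneg_right (le_max_right C (|c| * C + |c'| * C')) hp)
      have f1 := (norm_snd_le _).trans e1
      have f2 := (norm_snd_le _).trans e2
      simp only [tangentField, Prod.snd_sub, map_add, map_smul] at f1 f2 ⊢
      set A := fderiv ℝ (fun x => Y s x - Y 0 x) (θ r)
      set B := fderiv ℝ (fun x => Y r x - Y 0 x) (θ r)
      have e3 : c • J s + c' • J' s - (c • J r + c' • J' r) -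
          (c • A (J r) + c' • A (J' r) - (c • B (J r) + c' • B (J' r))) =
          c • (J s - J r - (A (J r) - B (J r))) + c' • (J' s - J' r - (A (J' r) - B (J' r))) := by
        module
      rw [e3]
      refine (norm_add_le _ _).trans ?_
      rw [norm_smul, norm_smul, Real.norm_eq_abs, Real.norm_eq_abs, add_mul, mul_assoc, mul_assoc]
      exact add_le_add (mul_le_mul_of_nonneg_left f1 (abs_nonneg _))
        (mul_le_mul_of_nonneg_left f2 (abs_nonneg _))
  exact congrArg Prod.snd (hY.tangent.eqOn_of_solution hγ le_rfl hτT h'' key ht)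

/-- The flow is continuous with values in the continuous functions. -/
theorem continuousOn_flow (hY : IsSmoothField γ T Y H) (hγ : 1 / 2 < γ) {τ : ℝ} (hτ : 0 ≤ τ)
    (hτT : τ ≤ T) {U : Set E} {Ψ : E → C(Icc (0 : ℝ) τ, E)}
    (hΨ : ∀ x ∈ U, IsYoungSolution Y γ 0 τ x (fun t => Ψ x (projIcc 0 τ hτ t))) :
    ContinuousOn Ψ U := by
  intro x hx
  obtain ⟨τ', hττ', hτ'T, -, r, hr, C, hC0, hC⟩ :=
    hY.exists_solution_nearby hγ hτ hτT (hΨ x hx)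
  refine tendsto_iff_norm_sub_tendsto_zero.2 (squeeze_zero'
    (Eventually.of_forall fun _ => norm_nonneg _) (g := fun x' => C * ‖x' - x‖) ?_ ?_)
  · filter_upwards [self_mem_nhdsWithin, mem_nhdsWithin_of_mem_nhds (Metric.ball_mem_nhds x hr)]
      with x' hx' hxr
    obtain ⟨θ', hθ', hb, -⟩ := hC x' hxr
    rw [ContinuousMap.norm_le _ (by positivity)]
    intro t
    have heq := hY.eqOn_of_solution hγ le_rfl hτT (hΨ x' hx') (hθ'.mono hττ')
    have := hb t t.2
    rw [← heq t.2] at this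
    simpa only [projIcc_val] using! this
  · have : Continuous fun x' => C * ‖x' - x‖ := by fun_prop
    simpa using (this.tendsto x).mono_left nhdsWithin_le_nhds

lemma exists_continuousMap_of_solution (hY : IsSmoothField γ T Y H) (hγ : 0 < γ) {τ : ℝ}
    (hτ : 0 ≤ τ) (hτT : τ ≤ T) {x : E} {θ : ℝ → E} (hθ : IsYoungSolution Y γ 0 τ x θ) :
    ∃ f : C(Icc (0 : ℝ) τ, E), ∀ t : Icc (0 : ℝ) τ, f t = θ t := by
  obtain ⟨N, hN, h⟩ := hY.exists_holder_of_solution hγ le_rfl hτ hτT hθ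
  exact ⟨⟨_, (continuousOn_of_holder hγ h).domRestrict⟩, fun t => rfl⟩

end IsSmoothField

/-- A map with values in the continuous functions on a compact interval is differentiable if it has
directional derivatives pointwise in time and these are linear and continuous. -/
lemma hasFDerivAt_of_directional {τ : ℝ} {F : Type*} [NormedAddCommGroup F] [NormedSpace ℝ F]
    {U : Set E} (hU : IsOpen U) {Ψ : E → C(Icc (0 : ℝ) τ, F)}
    {J : E → E →L[ℝ] C(Icc (0 : ℝ) τ, F)} (hJ : ContinuousOn J U)
    (hder : ∀ x ∈ U, ∀ v t, HasDerivAt (fun ε : ℝ => Ψ (x + ε • v) t) (J x v t) 0) {x : E}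
    (hx : x ∈ U) : HasFDerivAt Ψ (J x) x := by
  rw [hasFDerivAt_iff_isLittleO_nhds_zero, Asymptotics.isLittleO_iff]
  intro c hc
  obtain ⟨r, hr, hball⟩ : ∃ r > 0, ∀ x' ∈ Metric.ball x r, x' ∈ U ∧ ‖J x' - J x‖ ≤ c := by
    have h0 := (hJ.continuousAt (hU.mem_nhds hx)).preimage_mem_nhds
      (Metric.closedBall_mem_nhds (J x) hc)
    have h1 : ∀ᶠ x' in 𝓝 x, x' ∈ U ∧ ‖J x' - J x‖ ≤ c := by
      filter_upwards [hU.mem_nhds hx, h0] with x' h h'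
      exact ⟨h, (dist_eq_norm (J x') (J x)).symm.trans_le h'⟩
    exact Metric.eventually_nhds_iff_ball.1 h1
  filter_upwards [Metric.ball_mem_nhds (0 : E) hr] with v hv
  rw [ContinuousMap.norm_le _ (by positivity)]
  intro t
  have hmem : ∀ s ∈ Icc (0 : ℝ) 1, x + s • v ∈ Metric.ball x r := by
    intro s hs
    rw [mem_ball_iff_norm, add_sub_cancel_left, norm_smul, Real.norm_of_nonneg hs.1]
    exact (mul_le_of_le_one_left (norm_nonneg _) hs.2).trans_lt (mem_ball_zero_iff.1 hv)
  -- The mean value inequality is applied at each fixed time. Its bound c ‖v‖ does not depend on the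
  -- time, so it holds in the uniform norm.
  have key := norm_image_sub_le_of_norm_deriv_le_segment_01'
    (f := fun s : ℝ => Ψ (x + s • v) t - s • J x v t)
    (f' := fun s => J (x + s • v) v t - J x v t) (C := c * ‖v‖) ?_ ?_
  · simp only [one_smul, zero_smul, add_zero, sub_zero] at key
    simpa [sub_right_comm] using key
  · intro s hs
    have h1 : HasDerivAt (fun s' : ℝ => Ψ (x + s' • v) t) (J (x + s • v) v t) s := by
      have h2 := hder _ (hball _ (hmem s hs)).1 v t
      have h3 : HasDerivAt (fun s' : ℝ => s' - s) 1 s := (hasDerivAt_id s).sub_const s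
      have h4 := HasDerivAt.scomp s (g₁ := fun ε : ℝ => Ψ (x + s • v + ε • v) t)
        (by rw [sub_self]; exact h2) h3
      rw [one_smul] at h4
      refine h4.congr_of_eventuallyEq (Eventually.of_forall fun s' => ?_)
      simp only [Function.comp_apply]
      congr 2
      module
    have h5 : HasDerivAt (fun s : ℝ => s • J x v t) (J x v t) s := by
      simpa using (hasDerivAt_id s).smul_const (J x v t)
    exact (h1.sub h5).hasDerivWithinAt
  · intro s hs
    have h1 := (hball _ (hmem s ⟨hs.1, hs.2.le⟩)).2
    calc ‖J (x + s • v) v t - J x v t‖ = ‖((J (x + s • v) - J x) v) t‖ := by simp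
      _ ≤ ‖(J (x + s • v) - J x) v‖ := ContinuousMap.norm_coe_le_norm _ _
      _ ≤ ‖J (x + s • v) - J x‖ * ‖v‖ := ContinuousLinearMap.le_opNorm _ _
      _ ≤ c * ‖v‖ := by gcongr

/-- The flow of a smooth field is smooth, with values in the continuous functions. -/
theorem contDiffOn_flow (hγ : 1 / 2 < γ) {τ : ℝ} (hτ : 0 ≤ τ) (hτT : τ ≤ T) (n : ℕ) :
    ∀ {E : Type u} [NormedAddCommGroup E] [NormedSpace ℝ E] [FiniteDimensional ℝ E]
      {Y : ℝ → E → E} {H : E → (TimePair T →ᵇ E)} (_ : IsSmoothField γ T Y H) {U : Set E}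
      (_ : IsOpen U) {Ψ : E → C(Icc (0 : ℝ) τ, E)}
      (_ : ∀ x ∈ U, IsYoungSolution Y γ 0 τ x (fun t => Ψ x (projIcc 0 τ hτ t))),
      ContDiffOn ℝ n Ψ U := by
  induction n with
  | zero =>
    intro E _ _ _ Y H hY U hU Ψ hΨ
    exact contDiffOn_zero.2 (hY.continuousOn_flow hγ hτ hτT hΨ)
  | succ n ih =>
    intro E _ _ _ Y H hY U hU Ψ hΨ
    have hex : ∀ x ∈ U, ∀ v : E, ∃ j : C(Icc (0 : ℝ) τ, E),
        IsYoungSolution (tangentField Y) γ 0 τ (x, v)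
          (fun t => (Ψ x (projIcc 0 τ hτ t), j (projIcc 0 τ hτ t))) ∧
        ∀ t, HasDerivAt (fun ε : ℝ => Ψ (x + ε • v) t) (j t) 0 := by
      intro x hx v
      obtain ⟨J, hJ, hder⟩ := hY.exists_directional_derivative hγ hτ hτT hU hΨ hx v
      obtain ⟨f, hf⟩ := hY.tangent.exists_continuousMap_of_solution (by linarith) hτ hτT hJ
      have hfJ : ∀ t : Icc (0 : ℝ) τ, (f t).2 = J t := fun t => by rw [hf]
      refine ⟨⟨fun t => (f t).2, by fun_prop⟩, hJ.congr hτ fun t ht => ?_, fun t => ?_⟩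
      · refine Prod.ext rfl ?_
        simp only [ContinuousMap.coe_mk, hfJ, projIcc_of_mem hτ ht]
      · simp only [ContinuousMap.coe_mk, hfJ]
        simpa using hder t t.2
    choose! j hj hjder using hex
    have hlin : ∀ x ∈ U, ∀ (c c' : ℝ) (v v' : E), j x (c • v + c' • v') = c • j x v + c' • j x v' := by
      intro x hx c c' v v'
      ext1 t
      have := hY.tangent_superposition hγ hτT c c' (hj x hx v) (hj x hx v')
        (hj x hx (c • v + c' • v')) t t.2
      simpa using this
    set J : E → E →L[ℝ] C(Icc (0 : ℝ) τ, E) := fun x => by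
      classical
      exact if hx : x ∈ U then LinearMap.toContinuousLinearMap
        { toFun := j x
          map_add' := fun v v' => by simpa using hlin x hx 1 1 v v'
          map_smul' := fun c v => by simpa using hlin x hx c 0 v 0 } else 0 with hJ
    have hJj : ∀ x ∈ U, ∀ v, J x v = j x v := fun x hx v => by simp [hJ, hx]
    set ΨT : E × E → C(Icc (0 : ℝ) τ, E × E) := fun z => (Ψ z.1).prodMk (j z.1 z.2) with hΨT
    have hΨTsol : ∀ z ∈ U ×ˢ (univ : Set E), IsYoungSolution (tangentField Y) γ 0 τ z
        (fun t => ΨT z (projIcc 0 τ hτ t)) := fun z hz => hj z.1 hz.1 z.2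
    set sndC : C(Icc (0 : ℝ) τ, E × E) →L[ℝ] C(Icc (0 : ℝ) τ, E) :=
      ContinuousLinearMap.compLeftContinuous ℝ (Icc (0 : ℝ) τ)
        (ContinuousLinearMap.snd ℝ E E) with hsndC
    have hsnd : ∀ x ∈ U, ∀ v, J x v = sndC (ΨT (x, v)) := fun x hx v => by
      rw [hJj x hx]
      rfl
    -- As E is finite-dimensional, continuity in operator norm may be checked on each vector v.
    -- There it is the continuity of the tangent flow.
    have hcont : ContinuousOn J U := by
      rw [continuousOn_clm_apply]
      intro v
      have h1 := hY.tangent.continuousOn_flow hγ hτ hτT hΨTsol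
      have h2 : ContinuousOn (fun x => sndC (ΨT (x, v))) U :=
        sndC.continuous.comp_continuousOn (h1.comp (by fun_prop) fun x hx => ⟨hx, trivial⟩)
      exact h2.congr fun x hx => hsnd x hx v
    have hder : ∀ x ∈ U, HasFDerivAt Ψ (J x) x := fun x hx =>
      hasFDerivAt_of_directional hU hcont (fun x hx v t => by
        rw [hJj x hx]
        exact hjder x hx v t) hx
    push_cast
    refine contDiffOn_succ_of_fderiv_apply
      (fun x hx => (hder x hx).differentiableAt.differentiableWithinAt) (by simp) fun v => ?_
    -- The tangent flow lives on E × E over the open set U × E, so the induction must run over all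
    -- spaces and fields simultaneously.
    have h1 := ih hY.tangent (hU.prod isOpen_univ) hΨTsol
    have h2 : ContDiffOn ℝ n (fun x => sndC (ΨT (x, v))) U :=
      sndC.contDiff.comp_contDiffOn (h1.comp (by fun_prop) fun x hx => ⟨hx, trivial⟩)
    refine h2.congr fun x hx => ?_
    rw [fderivWithin_of_isOpen hU hx, (hder x hx).fderiv, hsnd x hx]

end Flow

/-! ### Translations of Schwartz functions -/

section Translation

open BoundedContinuousFunction LineDeriv

variable {V : Type*} [NormedAddCommGroup V] [NormedSpace ℝ V]

/-- Symmetry of the second derivative. It lets ∂_v be moved past iterated derivatives, so that the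
seminorms of ∂_v f are controlled by those of f. -/
lemma lineDerivOp_comm (f : 𝓢(V, ℝ)) (v w : V) : ∂_{v} (∂_{w} f) = ∂_{w} (∂_{v} f) := by
  ext x
  have hd : DifferentiableAt ℝ (fderiv ℝ f) x :=
    (contDiff_infty_fderiv (f.smooth ⊤)).differentiable (by simp) x
  have h : ∀ v w : V, ∂_{v} (∂_{w} f) x = fderiv ℝ (fderiv ℝ f) x v w := by
    intro v w
    have e : ((∂_{w} f : 𝓢(V, ℝ)) : V → ℝ) = fun y => fderiv ℝ f y w :=
      funext fun y => SchwartzMap.lineDerivOp_apply_eq_fderiv w f y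
    rw [SchwartzMap.lineDerivOp_apply_eq_fderiv, e, fderiv_clm_apply hd (differentiableAt_const w)]
    simp
  rw [h, h]
  exact ((f.smooth ⊤).contDiffAt.isSymmSndFDerivAt (by
    rw [minSmoothness_of_isRCLikeNormedField]
    exact WithTop.coe_le_coe.2 le_top)).eq v w

lemma iteratedLineDerivOp_lineDerivOp (f : 𝓢(V, ℝ)) (v : V) {n : ℕ} (m : Fin n → V) :
    ∂^{m} (∂_{v} f) = ∂_{v} (∂^{m} f) := by
  induction n with
  | zero => simp
  | succ n ih => rw [iteratedLineDerivOp_succ_left, iteratedLineDerivOp_succ_left, ih,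
      lineDerivOp_comm]

/-- The iterated derivative of a directional derivative. -/
lemma iteratedFDeriv_lineDerivOp (f : 𝓢(V, ℝ)) (v : V) (n : ℕ) (x : V) :
    iteratedFDeriv ℝ n (∂_{v} f : 𝓢(V, ℝ)) x = fderiv ℝ (iteratedFDeriv ℝ n f) x v := by
  ext m
  have hd : DifferentiableAt ℝ (iteratedFDeriv ℝ n f) x :=
    (f.smooth ⊤).differentiable_iteratedFDeriv (mod_cast ENat.natCast_lt_top n) x
  rw [← SchwartzMap.iteratedLineDerivOp_eq_iteratedFDeriv, iteratedLineDerivOp_lineDerivOp,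
    SchwartzMap.lineDerivOp_apply_eq_fderiv,
    ← fderiv_continuousMultilinear_apply_const_apply hd]
  congr 2
  ext y
  exact SchwartzMap.iteratedLineDerivOp_eq_iteratedFDeriv

lemma norm_iteratedFDeriv_lineDerivOp_le (f : 𝓢(V, ℝ)) (v : V) (n : ℕ) (x : V) :
    ‖iteratedFDeriv ℝ n (∂_{v} f : 𝓢(V, ℝ)) x‖ ≤ ‖v‖ * ‖iteratedFDeriv ℝ (n + 1) f x‖ := by
  rw [iteratedFDeriv_lineDerivOp, ← norm_fderiv_iteratedFDeriv, mul_comm]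
  exact ContinuousLinearMap.le_opNorm _ _

lemma seminorm_lineDerivOp_le (f : 𝓢(V, ℝ)) (v : V) (k n : ℕ) :
    SchwartzMap.seminorm ℝ k n (∂_{v} f : 𝓢(V, ℝ)) ≤
      ‖v‖ * SchwartzMap.seminorm ℝ k (n + 1) f := by
  refine SchwartzMap.seminorm_le_bound ℝ k n _ (by positivity) fun x => ?_
  calc _ ≤ ‖x‖ ^ k * (‖v‖ * ‖iteratedFDeriv ℝ (n + 1) f x‖) := by
        gcongr
        exact norm_iteratedFDeriv_lineDerivOp_le f v n x
    _ = ‖v‖ * (‖x‖ ^ k * ‖iteratedFDeriv ℝ (n + 1) f x‖) := by ring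
    _ ≤ _ := by
        gcongr
        exact SchwartzMap.le_seminorm ℝ k (n + 1) f x

/-- A second order Taylor estimate in the Schwartz seminorms for the translation by `v`. -/
lemma seminorm_translate_sub_le (f : 𝓢(V, ℝ)) {v : V} (hv : ‖v‖ ≤ 1) (k n : ℕ) :
    SchwartzMap.seminorm ℝ k n (f.compSubConstCLM ℝ v - f + ∂_{v} f) ≤
      2 ^ k * (SchwartzMap.seminorm ℝ 0 (n + 2) f + SchwartzMap.seminorm ℝ k (n + 2) f) *
        ‖v‖ ^ 2 := by
  set B := 2 ^ k * (SchwartzMap.seminorm ℝ 0 (n + 2) f + SchwartzMap.seminorm ℝ k (n + 2) f)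
    with hB
  have hB0 : 0 ≤ B := by positivity
  refine SchwartzMap.seminorm_le_bound ℝ k n _ (by positivity) fun z => ?_
  -- As ‖v‖ ≤ 1, the weight ‖z‖^k is comparable to 1 + ‖y‖^k along the segment. The summand 1 is the
  -- source of the seminorm with index 0.
  have hweight : ∀ y, ‖y - z‖ ≤ ‖v‖ → ‖z‖ ^ k * ‖iteratedFDeriv ℝ (n + 2) f y‖ ≤ B := by
    intro y hy
    have h1 : ‖z‖ ≤ ‖y‖ + 1 := by
      have := norm_le_norm_add_norm_sub y z
      linarith
    have h2 : ‖z‖ ^ k ≤ 2 ^ k * (1 + ‖y‖ ^ k) := by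
      refine (pow_le_pow_left₀ (norm_nonneg _) h1 k).trans ((add_pow_le (norm_nonneg _)
        zero_le_one k).trans ?_)
      rw [one_pow, add_comm (1 : ℝ)]
      gcongr
      · norm_num
      · omega
    have h3 := SchwartzMap.le_seminorm ℝ 0 (n + 2) f y
    have h4 := SchwartzMap.le_seminorm ℝ k (n + 2) f y
    rw [pow_zero, one_mul] at h3
    calc _ ≤ 2 ^ k * (1 + ‖y‖ ^ k) * ‖iteratedFDeriv ℝ (n + 2) f y‖ := by gcongr
      _ = 2 ^ k * (‖iteratedFDeriv ℝ (n + 2) f y‖ + ‖y‖ ^ k * ‖iteratedFDeriv ℝ (n + 2) f y‖) := by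
        ring
      _ ≤ _ := by rw [hB]; gcongr
  set G := iteratedFDeriv ℝ n f with hG
  set Gv := iteratedFDeriv ℝ n (∂_{v} f : 𝓢(V, ℝ)) with hGv
  have hGd : Differentiable ℝ G :=
    (f.smooth ⊤).differentiable_iteratedFDeriv (mod_cast ENat.natCast_lt_top n)
  have hGvd : Differentiable ℝ Gv :=
    ((∂_{v} f : 𝓢(V, ℝ)).smooth ⊤).differentiable_iteratedFDeriv (mod_cast ENat.natCast_lt_top n)
  have hexp : iteratedFDeriv ℝ n (f.compSubConstCLM ℝ v - f + ∂_{v} f : 𝓢(V, ℝ)) z =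
      G (z - v) - G z + Gv z := by
    have e1 : ((f.compSubConstCLM ℝ v - f + ∂_{v} f : 𝓢(V, ℝ)) : V → ℝ) =
        ((fun y => f (y - v)) - f) + (∂_{v} f : 𝓢(V, ℝ)) := rfl
    have c0 : ContDiff ℝ n fun y => f (y - v) := (f.smooth n).comp (by fun_prop)
    have c1 : ContDiffAt ℝ n ((fun y => f (y - v)) - (f : V → ℝ)) z := (c0.sub (f.smooth n)).contDiffAt
    rw [e1, iteratedFDeriv_add_apply c1
      ((∂_{v} f : 𝓢(V, ℝ)).smooth n).contDiffAt,
      iteratedFDeriv_sub_apply c0.contDiffAt (f.smooth n).contDiffAt, iteratedFDeriv_comp_sub]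
  rw [hexp]
  have key : ‖z‖ ^ k * ‖G (z - v) - G z + Gv z‖ ≤ B * ‖v‖ ^ 2 := by
    rcases (pow_nonneg (norm_nonneg z) k).eq_or_lt with h0 | h0
    · rw [← h0, zero_mul]
      positivity
    have hpt : ‖G (z - v) - G z + Gv z‖ ≤ B / ‖z‖ ^ k * ‖v‖ ^ 2 := by
      have hseg : ∀ r ∈ Icc (0 : ℝ) 1, ‖Gv (z - r • v) - Gv z‖ ≤ B / ‖z‖ ^ k * ‖v‖ ^ 2 := by
        intro r hr
        have hrv : ‖r • v‖ ≤ ‖v‖ := by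
          rw [norm_smul, Real.norm_of_nonneg hr.1]
          exact mul_le_of_le_one_left (norm_nonneg _) hr.2
        have hmem : z - r • v ∈ Metric.closedBall z ‖v‖ := by
          rw [mem_closedBall_iff_norm]
          simpa using hrv
        have hz : z ∈ Metric.closedBall z ‖v‖ := Metric.mem_closedBall_self (norm_nonneg _)
        have := (convex_closedBall z ‖v‖).norm_image_sub_le_of_norm_fderiv_le (𝕜 := ℝ) (f := Gv)
          (C := ‖v‖ * (B / ‖z‖ ^ k)) (fun y _ => hGvd y) (fun y hy => ?_) hz hmem
        · refine this.trans ?_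
          rw [sub_sub_cancel_left, norm_neg]
          calc _ ≤ ‖v‖ * (B / ‖z‖ ^ k) * ‖v‖ := by gcongr
            _ = _ := by ring
        · rw [hGv, norm_fderiv_iteratedFDeriv]
          refine (norm_iteratedFDeriv_lineDerivOp_le f v (n + 1) y).trans ?_
          gcongr
          rw [le_div_iff₀ h0, mul_comm]
          exact hweight y (mem_closedBall_iff_norm.1 hy)
      -- The auxiliary path has derivative Gv z - Gv (z - r v), which `hseg` bounds by the second
      -- order quantity.
      have := norm_image_sub_le_of_norm_deriv_le_segment_01'
        (f := fun r : ℝ => G (z - r • v) + r • Gv z)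
        (f' := fun r => -Gv (z - r • v) + Gv z) (C := B / ‖z‖ ^ k * ‖v‖ ^ 2) (fun r _ => ?_)
        (fun r hr => ?_)
      · simp only [one_smul, zero_smul, sub_zero, add_zero] at this
        rwa [add_sub_right_comm] at this
      · have h1 : HasDerivAt (fun r : ℝ => z - r • v) (-v) r := by
          simpa using ((hasDerivAt_id r).smul_const v).const_sub z
        have h2 := (hGd (z - r • v)).hasFDerivAt.comp_hasDerivAt r h1
        have h3 : HasDerivAt (fun r : ℝ => r • Gv z) (Gv z) r := by
          simpa using (hasDerivAt_id r).smul_const (Gv z)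
        rw [map_neg, hG, ← iteratedFDeriv_lineDerivOp, ← hGv] at h2
        exact (h2.add h3).hasDerivWithinAt
      · rw [neg_add_eq_sub, norm_sub_rev]
        exact hseg r ⟨hr.1, hr.2.le⟩
    calc _ ≤ ‖z‖ ^ k * (B / ‖z‖ ^ k * ‖v‖ ^ 2) := by gcongr
      _ = _ := by field_simp
  exact key

variable {F : Type*} [NormedAddCommGroup F] [NormedSpace ℝ F]

/-- A continuous linear map on Schwartz functions is bounded by finitely many seminorms. -/
lemma exists_seminorm_bound (b : 𝓢(V, ℝ) →L[ℝ] F) : ∃ (s : Finset (ℕ × ℕ)) (C : ℝ), 0 ≤ C ∧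
    ∀ f, ‖b f‖ ≤ C * ∑ m ∈ s, SchwartzMap.seminorm ℝ m.1 m.2 f := by
  obtain ⟨s, C, -, hC⟩ := Seminorm.bound_of_continuous (schwartz_withSeminorms ℝ V ℝ)
    ((normSeminorm ℝ F).comp b.toLinearMap) (continuous_norm.comp b.continuous)
  refine ⟨s, C, C.2, fun f => (hC f).trans ?_⟩
  rw [_root_.smul_apply, NNReal.smul_def, smul_eq_mul]
  refine mul_le_mul_of_nonneg_left ?_ C.2
  refine (Seminorm.finset_sup_le_sum _ s f).trans (le_of_eq ?_)
  clear hC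
  induction s using Finset.cons_induction with
  | empty => rfl
  | cons m s hm ih => rw [Finset.sum_cons, Finset.sum_cons, ← ih]; rfl

variable {ι : Type*}

/-- Boundedness of a family of Schwartz functions in all seminorms. -/
def IsBoundedFamily (g : ι → 𝓢(V, ℝ)) : Prop :=
  ∀ k n : ℕ, ∃ C, ∀ i, SchwartzMap.seminorm ℝ k n (g i) ≤ C

lemma IsBoundedFamily.exists_bound {g : ι → 𝓢(V, ℝ)} (hg : IsBoundedFamily g)
    (b : 𝓢(V, ℝ) →L[ℝ] F) : ∃ C, 0 ≤ C ∧ ∀ i, ‖b (g i)‖ ≤ C := by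
  obtain ⟨s, C, hC0, hC⟩ := exists_seminorm_bound b
  choose D hD using hg
  refine ⟨|C * ∑ m ∈ s, D m.1 m.2|, abs_nonneg _, fun i => (hC _).trans (le_trans ?_ (le_abs_self _))⟩
  gcongr
  exact hD _ _ i

lemma IsBoundedFamily.lineDerivOp {g : ι → 𝓢(V, ℝ)} (hg : IsBoundedFamily g) (v : V) :
    IsBoundedFamily fun i => (∂_{v} (g i) : 𝓢(V, ℝ)) := by
  intro k n
  obtain ⟨C, hC⟩ := hg k (n + 1)
  exact ⟨‖v‖ * C, fun i => (seminorm_lineDerivOp_le _ _ _ _).trans (by gcongr; exact hC i)⟩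

variable [TopologicalSpace ι] [DiscreteTopology ι]

/-- The pairing of `b` with the translates by `x` of a family of Schwartz functions. -/
def translatePairing (b : 𝓢(V, ℝ) →L[ℝ] F) {g : ι → 𝓢(V, ℝ)} (hg : IsBoundedFamily g) (x : V) :
    ι →ᵇ F :=
  BoundedContinuousFunction.ofNormedAddCommGroupDiscrete
    (fun i => b ((g i).compSubConstCLM ℝ x)) _
    (hg.exists_bound (b.comp (SchwartzMap.compSubConstCLM ℝ x))).choose_spec.2

lemma translatePairing_apply (b : 𝓢(V, ℝ) →L[ℝ] F) {g : ι → 𝓢(V, ℝ)} (hg : IsBoundedFamily g)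
    (x : V) (i : ι) : translatePairing b hg x i = b ((g i).compSubConstCLM ℝ x) := rfl

variable [FiniteDimensional ℝ V]

/-- The first order term of a translation by v is -∂_v g, and the Taylor remainder is quadratic in
every seminorm, uniformly over the family, while b sees only finitely many seminorms. The derivative
is a pairing of the same kind, which drives the induction to all orders. -/
lemma hasFDerivAt_translatePairing (b : 𝓢(V, ℝ) →L[ℝ] F) {g : ι → 𝓢(V, ℝ)}
    (hg : IsBoundedFamily g) (x : V) :
    ∃ A : V →L[ℝ] (ι →ᵇ F), HasFDerivAt (translatePairing b hg) A x ∧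
      ∀ v, A v = -translatePairing b (hg.lineDerivOp v) x := by
  set A : V →L[ℝ] (ι →ᵇ F) := LinearMap.toContinuousLinearMap
    { toFun := fun v => -translatePairing b (hg.lineDerivOp v) x
      map_add' := fun v w => by
        ext i
        simp only [BoundedContinuousFunction.neg_apply, BoundedContinuousFunction.add_apply,
          translatePairing_apply, lineDerivOp_left_add, map_add]
        abel
      map_smul' := fun c v => by
        ext i
        simp only [BoundedContinuousFunction.neg_apply, BoundedContinuousFunction.smul_apply,
          translatePairing_apply, lineDerivOp_left_smul, map_smul, RingHom.id_apply, smul_neg] }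
    with hA
  refine ⟨A, ?_, fun v => rfl⟩
  obtain ⟨s, C, hC0, hC⟩ := exists_seminorm_bound (b.comp (SchwartzMap.compSubConstCLM ℝ x))
  have hg' := hg
  choose D hD using hg'
  set B := C * ∑ m ∈ s, 2 ^ m.1 * (D 0 (m.2 + 2) + D m.1 (m.2 + 2)) with hB
  have hmain : ∀ v : V, ‖v‖ ≤ 1 →
      ‖translatePairing b hg (x + v) - translatePairing b hg x - A v‖ ≤ |B| * ‖v‖ ^ 2 := by
    intro v hv
    rw [BoundedContinuousFunction.norm_le (by positivity)]
    intro i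
    have e : (translatePairing b hg (x + v) - translatePairing b hg x - A v) i =
        (b.comp (SchwartzMap.compSubConstCLM ℝ x))
          ((g i).compSubConstCLM ℝ v - g i + ∂_{v} (g i)) := by
      have e1 : A v i = -b ((∂_{v} (g i) : 𝓢(V, ℝ)).compSubConstCLM ℝ x) := rfl
      simp only [BoundedContinuousFunction.sub_apply, translatePairing_apply, e1,
        ContinuousLinearMap.comp_apply, map_add, map_sub, SchwartzMap.compSubConstCLM_comp]
      rw [add_comm x v]
      abel
    rw [e]
    refine (hC _).trans ((?_ : _ ≤ B * ‖v‖ ^ 2).trans (by gcongr; exact le_abs_self B))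
    rw [hB, mul_assoc, Finset.sum_mul]
    gcongr with m hm
    refine (seminorm_translate_sub_le (g i) hv m.1 m.2).trans ?_
    gcongr
    · exact hD _ _ i
    · exact hD _ _ i
  rw [hasFDerivAt_iff_isLittleO_nhds_zero]
  refine Asymptotics.IsBigO.trans_isLittleO (g := fun v : V => ‖v‖ ^ 2)
    (Asymptotics.IsBigO.of_bound |B| ?_) ?_
  · filter_upwards [Metric.closedBall_mem_nhds (0 : V) one_pos] with v hv
    rw [Real.norm_of_nonneg (by positivity)]
    exact hmain v (by simpa using hv)
  · exact Asymptotics.isLittleO_norm_pow_id one_lt_two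

/-- The pairing of a tempered distribution with the translates of a bounded family of Schwartz
functions is a smooth function of the translation. -/
theorem contDiff_translatePairing (b : 𝓢(V, ℝ) →L[ℝ] F) {g : ι → 𝓢(V, ℝ)}
    (hg : IsBoundedFamily g) : ContDiff ℝ ∞ (translatePairing b hg) := by
  refine contDiff_infty.2 fun n => ?_
  induction n generalizing g with
  | zero =>
    refine contDiff_zero.2 (continuous_iff_continuousAt.2 fun x => ?_)
    obtain ⟨A, hA, -⟩ := hasFDerivAt_translatePairing b hg x
    exact hA.continuousAt
  | succ n ih =>
    push_cast
    refine contDiff_succ_iff_fderiv_apply.2 ⟨fun x => ?_, by simp, fun v => ?_⟩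
    · obtain ⟨A, hA, -⟩ := hasFDerivAt_translatePairing b hg x
      exact hA.differentiableAt
    · have : (fun x => fderiv ℝ (translatePairing b hg) x v) =
          fun x => -translatePairing b (hg.lineDerivOp v) x := by
        ext1 x
        obtain ⟨A, hA, hAv⟩ := hasFDerivAt_translatePairing b hg x
        rw [hA.fderiv, hAv]
      rw [this]
      exact (ih (hg.lineDerivOp v)).neg

end Translation

/-! ### Functions with rapidly decaying Fourier transform -/

section FourierDecay

open Module

variable {V : Type*} [NormedAddCommGroup V] [InnerProductSpace ℝ V] [FiniteDimensional ℝ V]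
  [MeasurableSpace V] [BorelSpace V]

lemma continuous_fourier {F : V → ℂ} (hF : Integrable F) : Continuous (𝓕 F) :=
  VectorFourier.fourierIntegral_continuous Real.continuous_fourierChar
    (by exact continuous_inner) hF

lemma integral_fourier_mul_eq_flip {F G : V → ℂ} (hF : Integrable F) (hG : Integrable G) :
    ∫ ξ, 𝓕 F ξ * G ξ = ∫ x, F x * 𝓕 G x := by
  have := VectorFourier.integral_fourierIntegral_smul_eq_flip (L := innerₗ V)
    Real.continuous_fourierChar (by exact continuous_inner) hF hG
  rwa [flip_innerₗ] at this

/-- Fourier inversion almost everywhere. -/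
lemma fourierInv_fourier_ae_eq {F : V → ℂ} (hF : Integrable F) (hF' : Integrable (𝓕 F)) :
    𝓕⁻ (𝓕 F) =ᵐ[volume] F := by
  have hG : Integrable fun ξ => 𝓕 F (-ξ) := hF'.comp_neg
  rw [Real.fourierInv_eq_fourier_comp_neg]
  -- Both sides are tested against smooth functions of compact support. The transforms are moved
  -- onto the test function, where Fourier inversion for Schwartz functions is available.
  refine ae_eq_of_integral_contDiff_smul_eq (continuous_fourier hG).locallyIntegrable
    hF.locallyIntegrable fun g hg hgc => ?_
  set h : 𝓢(V, ℂ) := (hgc.comp_left (g := ((↑) : ℝ → ℂ)) Complex.ofReal_zero).toSchwartzMap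
    (Complex.ofRealCLM.contDiff.comp hg) with hh
  have hcoe : ∀ x, ((g x : ℝ) : ℂ) = h x := fun x => rfl
  have e1 : ∫ x, g x • 𝓕 (fun ξ => 𝓕 F (-ξ)) x = ∫ x, h x * 𝓕 (fun ξ => 𝓕 F (-ξ)) x :=
    integral_congr_ae (ae_of_all _ fun x => by simp only [Complex.real_smul, hcoe])
  have e2 : ∫ x, g x • F x = ∫ x, h x * F x :=
    integral_congr_ae (ae_of_all _ fun x => by simp only [Complex.real_smul, hcoe])
  rw [e1, e2, ← integral_fourier_mul_eq_flip h.integrable hG,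
    ← integral_neg_eq_self]
  have e3 : ∀ ξ : V, 𝓕 (h : V → ℂ) (-ξ) = (𝓕⁻ h : 𝓢(V, ℂ)) ξ := fun ξ => by
    rw [SchwartzMap.fourierInv_coe, Real.fourierInv_eq_fourier_neg]
  simp only [neg_neg, e3]
  have e4 : (h : V → ℂ) = 𝓕 ((𝓕⁻ h : 𝓢(V, ℂ)) : V → ℂ) := by
    rw [← SchwartzMap.fourier_coe, FourierTransform.fourier_fourierInv_eq]
  conv_rhs => rw [e4]
  exact (integral_fourier_mul_eq_flip (𝓕⁻ h : 𝓢(V, ℂ)).integrable hF).symm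

/-- An integrable real function with support in a ball and rapidly decaying Fourier transform is a
Schwartz function. -/
lemma exists_schwartzMap_of_fourier_decay {f : V → ℝ} (hf : Integrable f) {R : ℝ} (hR : 0 ≤ R)
    (hfR : ∀ᵐ x, R < ‖x‖ → f x = 0) {D : ℕ → ℝ}
    (hD : ∀ m ξ, (1 + ‖ξ‖) ^ m * ‖𝓕 (fun x => (f x : ℂ)) ξ‖ ≤ D m) :
    ∃ φ : 𝓢(V, ℝ), φ =ᵐ[volume] f ∧ ∀ k n, SchwartzMap.seminorm ℝ k n φ ≤
      R ^ k * ((2 * Real.pi) ^ n * D (n + (finrank ℝ V + 1)) *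
        ∫ ξ : V, (1 + ‖ξ‖) ^ (-((finrank ℝ V + 1 : ℕ) : ℝ))) := by
  set r := finrank ℝ V + 1 with hr
  set F : V → ℂ := fun x => (f x : ℂ) with hFdef
  have hF : Integrable F := hf.ofReal
  set G : V → ℂ := fun ξ => 𝓕 F (-ξ) with hG
  have hGc : Continuous G := (continuous_fourier hF).comp continuous_neg
  have hGD : ∀ m ξ, (1 + ‖ξ‖) ^ m * ‖G ξ‖ ≤ D m := fun m ξ => by
    simpa using hD m (-ξ)
  have hint : Integrable (fun ξ : V => (1 + ‖ξ‖) ^ (-(r : ℝ))) :=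
    integrable_one_add_norm (by rw [hr]; push_cast; linarith)
  have hpt : ∀ n (ξ : V), ‖ξ‖ ^ n * ‖G ξ‖ ≤ D (n + r) * (1 + ‖ξ‖) ^ (-(r : ℝ)) := by
    intro n ξ
    have h1 : 0 < 1 + ‖ξ‖ := by positivity
    rw [Real.rpow_neg h1.le, Real.rpow_natCast, ← div_eq_mul_inv, le_div_iff₀ (by positivity)]
    refine le_trans ?_ (hGD (n + r) ξ)
    rw [pow_add _ n r]
    calc _ = ‖ξ‖ ^ n * (1 + ‖ξ‖) ^ r * ‖G ξ‖ := by ring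
      _ ≤ _ := by
        have h2 : ‖ξ‖ ≤ 1 + ‖ξ‖ := by linarith
        gcongr
  have hGi : ∀ n : ℕ, Integrable fun ξ : V => ‖ξ‖ ^ n * ‖G ξ‖ := fun n =>
    (hint.const_mul (D (n + r))).mono' (by fun_prop) (ae_of_all _ fun ξ => by
      rw [Real.norm_of_nonneg (by positivity)]; exact hpt n ξ)
  have hG1 : Integrable G := by
    have := hGi 0
    simp only [pow_zero, one_mul] at this
    exact (integrable_norm_iff hGc.aestronglyMeasurable).1 this
  have hFi : Integrable (𝓕 F) := by simpa [hG] using hG1.comp_neg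
  have hψc : ContDiff ℝ ∞ (𝓕 G) := Real.contDiff_fourier (N := ⊤) fun n _ => hGi n
  have hψae : 𝓕 G =ᵐ[volume] F := by
    have := fourierInv_fourier_ae_eq hF hFi
    rwa [Real.fourierInv_eq_fourier_comp_neg] at this
  have hψb : ∀ n x, ‖iteratedFDeriv ℝ n (𝓕 G) x‖ ≤
      (2 * Real.pi) ^ n * D (n + r) * ∫ ξ : V, (1 + ‖ξ‖) ^ (-(r : ℝ)) := by
    intro n x
    rw [Real.iteratedFDeriv_fourier (N := ⊤) (fun n _ => hGi n) hGc.aestronglyMeasurable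
      (mod_cast le_top)]
    refine (VectorFourier.norm_fourierIntegral_le_integral_norm _ _ _ _ _).trans ?_
    rw [← integral_const_mul]
    refine integral_mono_of_nonneg (ae_of_all _ fun ξ => norm_nonneg _)
      (hint.const_mul _) (ae_of_all _ fun ξ => ?_)
    refine (VectorFourier.norm_fourierPowSMulRight_le _ _ _ _).trans ?_
    have h1 : ‖(innerSL ℝ : V →L[ℝ] V →L[ℝ] ℝ)‖ ≤ 1 := norm_innerSL_le _
    calc (2 * Real.pi * ‖(innerSL ℝ : V →L[ℝ] V →L[ℝ] ℝ)‖) ^ n * ‖ξ‖ ^ n * ‖G ξ‖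
        ≤ (2 * Real.pi * 1) ^ n * ‖ξ‖ ^ n * ‖G ξ‖ := by gcongr
      _ = (2 * Real.pi) ^ n * (‖ξ‖ ^ n * ‖G ξ‖) := by ring
      _ ≤ (2 * Real.pi) ^ n * (D (n + r) * (1 + ‖ξ‖) ^ (-(r : ℝ))) := by
        exact mul_le_mul_of_nonneg_left (hpt n ξ) (by positivity)
      _ = _ := by ring
  -- Since f is real, the real part of the smooth version of F is a smooth version of f. Continuity
  -- turns its vanishing almost everywhere outside the ball into vanishing everywhere there, so the
  -- weight ‖x‖^k costs only R^k.
  set φ : V → ℝ := fun x => (𝓕 G x).re with hφ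
  have hφc : ContDiff ℝ ∞ φ := Complex.reCLM.contDiff.comp hψc
  have hφae : φ =ᵐ[volume] f := by
    filter_upwards [hψae] with x hx
    rw [hφ]
    simp [hx, hFdef]
  have hφ0 : ∀ x, R < ‖x‖ → φ x = 0 := by
    have hopen : IsOpen {x : V | R < ‖x‖} := isOpen_lt continuous_const continuous_norm
    have := Measure.eqOn_open_of_ae_eq (μ := volume) (f := φ) (g := fun _ => 0)
      ((ae_restrict_iff' hopen.measurableSet).2 (by
        filter_upwards [hφae, hfR] with x h1 h2 h3
        rw [h1, h2 h3])) hopen hφc.continuous.continuousOn continuousOn_const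
    exact fun x hx => this hx
  have hsupp : tsupport φ ⊆ Metric.closedBall 0 R :=
    closure_minimal (fun x hx => by
      rw [mem_closedBall_zero_iff]
      by_contra! h
      exact hx (hφ0 x h)) Metric.isClosed_closedBall
  have hcpt : HasCompactSupport φ :=
    (isCompact_closedBall (0 : V) R).of_isClosed_subset (isClosed_tsupport φ) hsupp
  refine ⟨hcpt.toSchwartzMap hφc, hφae, fun k n => ?_⟩
  have hB : 0 ≤ (2 * Real.pi) ^ n * D (n + r) * ∫ ξ : V, (1 + ‖ξ‖) ^ (-(r : ℝ)) :=
    (norm_nonneg _).trans (hψb n 0)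
  refine SchwartzMap.seminorm_le_bound ℝ k n _ (by positivity) fun x => ?_
  have e : iteratedFDeriv ℝ n (hcpt.toSchwartzMap hφc) x = iteratedFDeriv ℝ n φ x := rfl
  rw [e]
  rcases le_or_gt ‖x‖ R with hx | hx
  · gcongr
    have := Complex.reCLM.norm_iteratedFDeriv_comp_left (f := 𝓕 G) (x := x)
      (hψc.contDiffAt) (n := n) (mod_cast le_top)
    rw [Complex.reCLM_norm, one_mul] at this
    exact this.trans (hψb n x)
  · have : iteratedFDeriv ℝ n φ x = 0 := by
      by_contra h
      have := hsupp (support_iteratedFDeriv_subset n h)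
      rw [mem_closedBall_zero_iff] at this
      linarith
    rw [this, norm_zero, mul_zero]
    positivity

end FourierDecay

/-! ### Littlewood-Paley blocks of compactly supported functions -/

section LittlewoodPaley

open Module Convolution

/-- The inverse transform of m(c ·) is a multiple of the inverse transform of m evaluated at x / c.
Since c ≤ c₀, the weight at x is at most c₀^q times the weight at x / c, which Schwartz decay
absorbs. -/
lemma exists_bound_fourierInv_comp_smul {V : Type*} [NormedAddCommGroup V] [InnerProductSpace ℝ V]
    [FiniteDimensional ℝ V] [MeasurableSpace V] [BorelSpace V] (m : 𝓢(V, ℂ)) (q : ℕ) {c₀ : ℝ}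
    (hc₀ : 1 ≤ c₀) : ∃ C, 0 ≤ C ∧ ∀ c, 0 < c → c ≤ c₀ → ∀ x,
      (1 + ‖x‖) ^ q * ‖𝓕⁻ (fun ξ => m (c • ξ)) x‖ ≤ C * (c⁻¹) ^ finrank ℝ V := by
  set κ : 𝓢(V, ℂ) := 𝓕⁻ m with hκ
  set S := 2 ^ q * ((Finset.Iic (q, 0)).sup fun m => SchwartzMap.seminorm ℝ m.1 m.2) κ with hS
  have hdecay : ∀ y, (1 + ‖y‖) ^ q * ‖κ y‖ ≤ S := fun y => by
    have := SchwartzMap.one_add_le_sup_seminorm_apply (𝕜 := ℝ) (m := (q, 0)) (k := q) (n := 0)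
      le_rfl le_rfl κ y
    rwa [norm_iteratedFDeriv_zero] at this
  have hS0 : 0 ≤ S := le_trans (by positivity) (hdecay 0)
  refine ⟨c₀ ^ q * S, by positivity, fun c hc hcc x => ?_⟩
  have hscale : 𝓕⁻ (fun ξ => m (c • ξ)) x = (c⁻¹) ^ finrank ℝ V • κ (c⁻¹ • x) := by
    have h1 : κ (c⁻¹ • x) = ∫ η, Real.fourierChar (inner ℝ η (c⁻¹ • x)) • m η := by
      rw [hκ, SchwartzMap.fourierInv_coe, Real.fourierInv_eq]
    have h2 := Measure.integral_comp_smul (volume : Measure V)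
      (fun η => Real.fourierChar (inner ℝ η (c⁻¹ • x)) • m η) c
    rw [← h1, abs_of_nonneg (by positivity), ← inv_pow] at h2
    rw [Real.fourierInv_eq, ← h2]
    refine integral_congr_ae (ae_of_all _ fun ξ => ?_)
    simp only [inner_smul_left, inner_smul_right, RCLike.conj_to_real, inv_mul_cancel_left₀ hc.ne']
  rw [hscale, norm_smul, Real.norm_of_nonneg (by positivity)]
  have h3 : 1 + ‖x‖ ≤ c₀ * (1 + ‖c⁻¹ • x‖) := by
    rw [norm_smul, norm_inv, Real.norm_of_nonneg hc.le, mul_add, mul_one, ← mul_assoc]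
    have : 1 ≤ c₀ * c⁻¹ := by rwa [← div_eq_mul_inv, one_le_div hc]
    have := mul_le_mul_of_nonneg_right this (norm_nonneg x)
    linarith
  calc (1 + ‖x‖) ^ q * ((c⁻¹) ^ finrank ℝ V * ‖κ (c⁻¹ • x)‖)
      ≤ (c₀ * (1 + ‖c⁻¹ • x‖)) ^ q * ((c⁻¹) ^ finrank ℝ V * ‖κ (c⁻¹ • x)‖) := by gcongr
    _ = c₀ ^ q * ((1 + ‖c⁻¹ • x‖) ^ q * ‖κ (c⁻¹ • x)‖) * (c⁻¹) ^ finrank ℝ V := by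
        rw [mul_pow]; ring
    _ ≤ _ := by
        gcongr
        exact hdecay _

variable {d : ℕ} {χ ρ : Rd d → ℝ}

namespace IsDyadicPartition

lemma hasCompactSupport_chi (h : IsDyadicPartition χ ρ) : HasCompactSupport χ := by
  obtain ⟨c, -, hc⟩ := h.supp_chi
  exact (isCompact_closedBall (0 : Rd d) c).of_isClosed_subset (isClosed_tsupport _)
    fun x hx => mem_closedBall_zero_iff.2 (hc hx)

lemma hasCompactSupport_rho (h : IsDyadicPartition χ ρ) : HasCompactSupport ρ := by
  obtain ⟨a, c, -, -, hc⟩ := h.supp_rho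
  exact (isCompact_closedBall (0 : Rd d) c).of_isClosed_subset (isClosed_tsupport _)
    fun x hx => mem_closedBall_zero_iff.2 (hc hx).2

/-- The multiplier `ρ_{n-1}(2π ·)` is a rescaling of one of two Schwartz functions. -/
lemma exists_schwartzMap (h : IsDyadicPartition χ ρ) : ∃ m₀ m₁ : 𝓢(Rd d, ℂ), ∀ n, ∃ c : ℝ, 0 < c ∧
    c ≤ 2 * Real.pi ∧ c⁻¹ ≤ 2 ^ n ∧ ∃ m ∈ ({m₀, m₁} : Set 𝓢(Rd d, ℂ)), ∀ ξ : Rd d,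
      ((dyadicPiece χ ρ n ((2 * Real.pi) • ξ) : ℝ) : ℂ) = m (c • ξ) := by
  refine ⟨(h.hasCompactSupport_chi.comp_left (g := ((↑) : ℝ → ℂ)) Complex.ofReal_zero).toSchwartzMap
      (Complex.ofRealCLM.contDiff.comp h.smooth_chi),
    (h.hasCompactSupport_rho.comp_left (g := ((↑) : ℝ → ℂ)) Complex.ofReal_zero).toSchwartzMap
      (Complex.ofRealCLM.contDiff.comp h.smooth_rho), fun n => ?_⟩
  have hpi := Real.pi_gt_three
  match n with
  | 0 => exact ⟨2 * Real.pi, by positivity, le_rfl, by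
      rw [pow_zero]; exact inv_le_one_of_one_le₀ (by linarith), _, Or.inl rfl, fun ξ => rfl⟩
  | j + 1 =>
    have h1 : (1 : ℝ) ≤ 2 ^ j := one_le_pow₀ one_le_two
    refine ⟨((2 : ℝ) ^ j)⁻¹ * (2 * Real.pi), by positivity,
      mul_le_of_le_one_left (by positivity) (inv_le_one_of_one_le₀ h1), ?_, _, Or.inr rfl,
      fun ξ => ?_⟩
    · rw [mul_inv, inv_inv, pow_succ]
      gcongr
      exact (inv_le_one_of_one_le₀ (by linarith)).trans one_le_two
    · rw [mul_smul ((2 : ℝ) ^ j)⁻¹]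
      rfl

lemma exists_lpKernel_eq (h : IsDyadicPartition χ ρ) (n : ℕ) : ∃ κ : 𝓢(Rd d, ℂ),
    lpKernel χ ρ n = κ ∧
    ∀ ξ, 𝓕 (lpKernel χ ρ n) ξ = ((dyadicPiece χ ρ n ((2 * Real.pi) • ξ) : ℝ) : ℂ) := by
  obtain ⟨m₀, m₁, hm⟩ := h.exists_schwartzMap
  obtain ⟨c, hc, -, -, m, -, hmc⟩ := hm n
  set m' : 𝓢(Rd d, ℂ) := SchwartzMap.compCLMOfContinuousLinearEquiv ℂ
    (ContinuousLinearEquiv.smulLeft (Units.mk0 c hc.ne') : Rd d ≃L[ℝ] Rd d) m with hm'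
  have e : (fun ξ : Rd d => ((dyadicPiece χ ρ n ((2 * Real.pi) • ξ) : ℝ) : ℂ)) = m' :=
    funext fun ξ => (hmc ξ)
  have e2 : lpKernel χ ρ n = (𝓕⁻ m' : 𝓢(Rd d, ℂ)) := by
    rw [lpKernel, e, SchwartzMap.fourierInv_coe]
  refine ⟨𝓕⁻ m', e2, fun ξ => ?_⟩
  rw [e2, ← SchwartzMap.fourier_coe, FourierTransform.fourier_fourierInv_eq]
  exact (congrFun e ξ).symm

lemma exists_lpKernel_bound (h : IsDyadicPartition χ ρ) (q : ℕ) : ∃ C, 0 ≤ C ∧ ∀ n x,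
    (1 + ‖x‖) ^ q * ‖lpKernel χ ρ n x‖ ≤ C * (2 ^ n) ^ d := by
  obtain ⟨m₀, m₁, hm⟩ := h.exists_schwartzMap
  have hpi : 1 ≤ 2 * Real.pi := by linarith [Real.pi_gt_three]
  obtain ⟨C₀, hC₀, h₀⟩ := exists_bound_fourierInv_comp_smul m₀ q hpi
  obtain ⟨C₁, hC₁, h₁⟩ := exists_bound_fourierInv_comp_smul m₁ q hpi
  refine ⟨C₀ + C₁, by positivity, fun n x => ?_⟩
  obtain ⟨c, hc, hc', hcn, m, hmm, hmc⟩ := hm n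
  have hp : (c⁻¹) ^ finrank ℝ (Rd d) ≤ (2 ^ n) ^ d := by
    rw [finrank_euclideanSpace_fin]
    gcongr
  have e : lpKernel χ ρ n = 𝓕⁻ (fun ξ => m (c • ξ)) := by
    rw [lpKernel]
    exact congrArg _ (funext hmc)
  rw [e]
  rcases hmm with rfl | rfl
  · refine (h₀ c hc hc' x).trans ?_
    gcongr
    linarith
  · refine (h₁ c hc hc' x).trans ?_
    gcongr
    linarith

/-- On the n-th piece the frequency is of order at most 2^n, so a weight (1 + ‖ξ‖)^m costs at most a
constant times 2^(nm). -/
lemma exists_support_bound (h : IsDyadicPartition χ ρ) : ∃ C : ℝ, 0 ≤ C ∧ ∀ n (ξ : Rd d),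
    dyadicPiece χ ρ n ((2 * Real.pi) • ξ) ≠ 0 → 1 + ‖ξ‖ ≤ C * 2 ^ n := by
  obtain ⟨c, hc0, hc⟩ := h.supp_chi
  obtain ⟨a, c', -, hc'0, hc'⟩ := h.supp_rho
  refine ⟨1 + c + c', by positivity, fun n ξ hξ => ?_⟩
  have hpi : 1 ≤ 2 * Real.pi := by linarith [Real.pi_gt_three]
  have hle : ‖ξ‖ ≤ ‖(2 * Real.pi) • ξ‖ := by
    rw [norm_smul, Real.norm_of_nonneg (by positivity)]
    exact le_mul_of_one_le_left (norm_nonneg _) hpi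
  match n with
  | 0 =>
    have := hc (subset_tsupport _ hξ)
    simp only [mem_ofPred_eq] at this
    simp only [pow_zero, mul_one]
    linarith
  | j + 1 =>
    have := (hc' (subset_tsupport _ hξ)).2
    rw [norm_smul, norm_inv, norm_pow, Real.norm_of_nonneg zero_le_two,
      inv_mul_le_iff₀ (by positivity)] at this
    have h1 : (1 : ℝ) ≤ 2 ^ j := one_le_pow₀ one_le_two
    have h2 : (2 : ℝ) ^ (j + 1) = 2 ^ j * 2 := pow_succ _ _
    rw [h2]
    nlinarith

lemma hasSum_dyadicPiece (h : IsDyadicPartition χ ρ) (x : Rd d) :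
    HasSum (fun n => dyadicPiece χ ρ n x) 1 := by
  rw [← hasSum_nat_add_iff' 1]
  simpa [dyadicPiece] using h.sum_eq_one x

variable {f : Rd d → ℝ}

lemma integrable_lpBlock (h : IsDyadicPartition χ ρ) (hf : Integrable f) (n : ℕ) :
    Integrable (lpBlock χ ρ n f) ∧ ∀ ξ, 𝓕 (lpBlock χ ρ n f) ξ =
      ((dyadicPiece χ ρ n ((2 * Real.pi) • ξ) : ℝ) : ℂ) * 𝓕 (fun x => (f x : ℂ)) ξ := by
  obtain ⟨κ, hκ, hκF⟩ := h.exists_lpKernel_eq n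
  have hK : Integrable (lpKernel χ ρ n) := by rw [hκ]; exact κ.integrable
  have hF : Integrable (fun x => (f x : ℂ)) := hf.ofReal
  have e : lpBlock χ ρ n f = (fun x => (f x : ℂ)) ⋆[ContinuousLinearMap.mul ℂ ℂ] lpKernel χ ρ n := by
    ext x
    simp only [lpBlock, convolution, ContinuousLinearMap.mul_apply', mul_comm]
  refine ⟨?_, fun ξ => ?_⟩
  · rw [e]
    exact hF.integrable_convolution _ hK
  · rw [e, Real.fourier_mul_convolution_eq hF hK, hκF, mul_comm]

/-- On the ball that carries f one has 1 + ‖x‖ ≤ (1 + ‖x - z‖)(1 + R), so the decay of the kernel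
passes to the block. -/
lemma norm_lpBlock_le {R C : ℝ} {q n : ℕ} (hC : ∀ x, (1 + ‖x‖) ^ q * ‖lpKernel χ ρ n x‖ ≤ C)
    (hf : Integrable f) (hR : 0 ≤ R) (hfR : ∀ᵐ x, R < ‖x‖ → f x = 0) (x : Rd d) :
    (1 + ‖x‖) ^ q * ‖lpBlock χ ρ n f x‖ ≤ C * (1 + R) ^ q * ∫ z, ‖f z‖ := by
  rw [← integral_const_mul, lpBlock]
  calc _ ≤ (1 + ‖x‖) ^ q * ∫ z, ‖lpKernel χ ρ n (x - z) * (f z : ℂ)‖ := by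
        gcongr
        exact norm_integral_le_integral_norm _
    _ = ∫ z, (1 + ‖x‖) ^ q * ‖lpKernel χ ρ n (x - z) * (f z : ℂ)‖ := (integral_const_mul _ _).symm
    _ ≤ _ := by
        refine integral_mono_of_nonneg (ae_of_all _ fun z => by positivity)
          (hf.norm.const_mul _) ?_
        filter_upwards [hfR] with z hz
        rw [norm_mul, Complex.norm_real]
        rcases le_or_gt ‖z‖ R with hzR | hzR
        · have h1 : 1 + ‖x‖ ≤ (1 + ‖x - z‖) * (1 + R) := by
            have := norm_le_norm_sub_add x z
            nlinarith [norm_nonneg (x - z)]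
          calc _ ≤ ((1 + ‖x - z‖) * (1 + R)) ^ q * (‖lpKernel χ ρ n (x - z)‖ * ‖f z‖) := by gcongr
            _ = ((1 + ‖x - z‖) ^ q * ‖lpKernel χ ρ n (x - z)‖) * (1 + R) ^ q * ‖f z‖ := by
                rw [mul_pow]; ring
            _ ≤ _ := by gcongr; exact hC _
        · simp [hz hzR]

end IsDyadicPartition

lemma norm_lpBlock_le_of_besovNorm_le {α A : ℝ} (hA : 0 ≤ A)
    (hf : besovNorm χ ρ α f ≤ ENNReal.ofReal A) (n : ℕ) :
    ∀ᵐ x, ‖lpBlock χ ρ n f x‖ ≤ A * (2 : ℝ) ^ (-(((n : ℝ) - 1) * α)) := by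
  have hpos : (0 : ℝ) < (2 : ℝ) ^ (((n : ℝ) - 1) * α) := by positivity
  have h1 := (le_iSup (fun n : ℕ => ENNReal.ofReal ((2 : ℝ) ^ (((n : ℝ) - 1) * α)) *
    eLpNorm (lpBlock χ ρ n f) ⊤ volume) n).trans hf
  filter_upwards [ae_le_eLpNormEssSup (f := lpBlock χ ρ n f) (μ := volume)] with x hx
  rw [eLpNorm_exponent_top] at h1
  have h2 : ENNReal.ofReal ((2 : ℝ) ^ (((n : ℝ) - 1) * α) * ‖lpBlock χ ρ n f x‖) ≤
      ENNReal.ofReal A := by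
    rw [ENNReal.ofReal_mul hpos.le, ofReal_norm]
    exact (mul_le_mul_right hx _).trans h1
  rw [ENNReal.ofReal_le_ofReal_iff hA] at h2
  rw [Real.rpow_neg zero_le_two, ← div_eq_mul_inv, le_div_iff₀ hpos, mul_comm]
  exact h2

/-- Interpolation between a supremum bound and a weighted bound. -/
lemma integral_norm_le_of_interpolation {g : Rd d → ℂ} {A B : ℝ} (hB : 0 ≤ B)
    (hgA : ∀ᵐ x, ‖g x‖ ≤ A) (hgB : ∀ x, (1 + ‖x‖) ^ (4 * (d + 1)) * ‖g x‖ ≤ B) :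
    ∫ x, ‖g x‖ ≤ A ^ (3 / 4 : ℝ) * B ^ (1 / 4 : ℝ) *
      ∫ x : Rd d, (1 + ‖x‖) ^ (-((d + 1 : ℕ) : ℝ)) := by
  rw [← integral_const_mul]
  refine integral_mono_of_nonneg (ae_of_all _ fun x => norm_nonneg _)
    ((integrable_one_add_norm (by rw [finrank_euclideanSpace_fin]; push_cast; linarith)).const_mul _)
    ?_
  filter_upwards [hgA] with x hx
  have hw : 0 < 1 + ‖x‖ := by positivity
  have hA : 0 ≤ A := (norm_nonneg _).trans hx
  have h1 : ‖g x‖ ≤ B * (1 + ‖x‖) ^ (-((4 * (d + 1) : ℕ) : ℝ)) := by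
    rw [Real.rpow_neg hw.le, Real.rpow_natCast, ← div_eq_mul_inv, le_div_iff₀ (by positivity),
      mul_comm]
    exact hgB x
  -- The fourth root of the weight with exponent 4 (d + 1) is the weight with exponent d + 1, which
  -- is just enough for integrability on ℝ^d.
  calc ‖g x‖ = ‖g x‖ ^ (3 / 4 : ℝ) * ‖g x‖ ^ (1 / 4 : ℝ) := by
        rw [← Real.rpow_add' (norm_nonneg _) (by norm_num)]
        norm_num
    _ ≤ A ^ (3 / 4 : ℝ) * (B * (1 + ‖x‖) ^ (-((4 * (d + 1) : ℕ) : ℝ))) ^ (1 / 4 : ℝ) := by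
        gcongr
    _ = _ := by
        rw [Real.mul_rpow hB (by positivity), ← Real.rpow_mul hw.le, ← mul_assoc]
        congr 2
        push_cast
        ring

/-- The Fourier transform of f is the sum of those of its blocks, each bounded by the L¹ norm of the
block. The supremum bound carries the factor M and the decay in n, the weighted bound the
integrability. Interpolating them leaves M^(3/4). -/
lemma IsDyadicPartition.exists_fourier_decay (h : IsDyadicPartition χ ρ) {R J : ℝ} (hR : 0 ≤ R)
    (hJ : 0 ≤ J) (c : ℝ → ℝ≥0) : ∃ D : ℕ → ℝ, ∀ (f : Rd d → ℝ) (M : ℝ), 0 ≤ M → Integrable f →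
      (∀ᵐ x, R < ‖x‖ → f x = 0) → ∫ x, ‖f x‖ ≤ J →
      (∀ α, besovNorm χ ρ α f ≤ c α * ENNReal.ofReal M) →
      ∀ m ξ, (1 + ‖ξ‖) ^ m * ‖𝓕 (fun x => (f x : ℂ)) ξ‖ ≤ D m * M ^ (3 / 4 : ℝ) := by
  obtain ⟨C, hC0, hC⟩ := h.exists_lpKernel_bound (4 * (d + 1))
  obtain ⟨a, ha0, ha⟩ := h.exists_support_bound
  set I := ∫ x : Rd d, (1 + ‖x‖) ^ (-((d + 1 : ℕ) : ℝ)) with hI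
  have hI0 : 0 ≤ I := integral_nonneg fun x => by positivity
  set B := (C * ((1 + R) ^ (4 * (d + 1)) * J)) ^ (1 / 4 : ℝ) with hB
  have hB0 : 0 ≤ B := by positivity
  set K : ℕ → ℝ := fun m => (c (4 / 3 * ((m + d + 1 : ℕ) : ℝ)) : ℝ) ^ (3 / 4 : ℝ) *
    2 ^ (m + d + 1) * B * I with hK
  refine ⟨fun m => 2 * (a ^ m * K m), fun f M hM hf hfR hfJ hfα m ξ => ?_⟩
  -- With this α the power 3/4 of the Besov decay is 2^(-(n-1)(m+d+1)). It compensates 2^(nm) from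
  -- the frequency weight and 2^(nd) from the kernel, and leaves the summable factor 2^(-n).
  set α : ℝ := 4 / 3 * ((m + d + 1 : ℕ) : ℝ) with hα
  have hblock : ∀ n, ∫ x, ‖lpBlock χ ρ n f x‖ ≤
      K m * M ^ (3 / 4 : ℝ) * (((2 : ℝ) ^ n) ^ m)⁻¹ * (1 / 2) ^ n := by
    intro n
    have hA := norm_lpBlock_le_of_besovNorm_le (f := f) (α := α) (A := c α * M) (by positivity)
      (by rw [ENNReal.ofReal_mul (by positivity), ENNReal.ofReal_coe_nnreal]; exact hfα α) n
    have hBn := fun x => (IsDyadicPartition.norm_lpBlock_le (hC n) hf hR hfR x).trans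
      (show _ ≤ C * (2 ^ n) ^ d * ((1 + R) ^ (4 * (d + 1)) * J) by rw [← mul_assoc]; gcongr)
    refine (integral_norm_le_of_interpolation (by positivity) hA hBn).trans ?_
    have e1 : ((c α : ℝ) * M * (2 : ℝ) ^ (-(((n : ℝ) - 1) * α))) ^ (3 / 4 : ℝ) =
        (c α : ℝ) ^ (3 / 4 : ℝ) * M ^ (3 / 4 : ℝ) * (2 ^ (m + d + 1) *
          ((2 ^ n) ^ (m + d + 1))⁻¹) := by
      rw [Real.mul_rpow (by positivity) (by positivity), Real.mul_rpow (by positivity) hM,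
        ← Real.rpow_mul zero_le_two, hα]
      congr 1
      rw [← pow_mul, ← Real.rpow_natCast, ← Real.rpow_natCast, ← Real.rpow_neg zero_le_two,
        ← Real.rpow_add two_pos]
      congr 1
      push_cast
      ring
    have e2 : (C * (2 ^ n) ^ d * ((1 + R) ^ (4 * (d + 1)) * J)) ^ (1 / 4 : ℝ) ≤
        B * (2 ^ n) ^ d := by
      have h1 : (1 : ℝ) ≤ (2 ^ n) ^ d := one_le_pow₀ (one_le_pow₀ one_le_two)
      have h2 : C * (2 ^ n) ^ d * ((1 + R) ^ (4 * (d + 1)) * J) =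
        C * ((1 + R) ^ (4 * (d + 1)) * J) * (2 ^ n) ^ d := by ring
      rw [h2, Real.mul_rpow (by positivity) (by positivity)]
      gcongr
      exact Real.rpow_le_self_of_one_le h1 (by norm_num)
    rw [e1]
    calc _ ≤ (c α : ℝ) ^ (3 / 4 : ℝ) * M ^ (3 / 4 : ℝ) * (2 ^ (m + d + 1) *
          ((2 ^ n) ^ (m + d + 1))⁻¹) * (B * (2 ^ n) ^ d) * I := by gcongr
      _ = _ := by
        have hKm : K m = (c α : ℝ) ^ (3 / 4 : ℝ) * 2 ^ (m + d + 1) * B * I := rfl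
        rw [hKm]
        clear_value α
        have h1 : (2 : ℝ) ^ n ≠ 0 := by positivity
        simp only [pow_add, pow_one, one_div, inv_pow]
        field_simp
  have hterm : ∀ n, ‖(((1 + ‖ξ‖) ^ m : ℝ) : ℂ) * (((dyadicPiece χ ρ n ((2 * Real.pi) • ξ) : ℝ) : ℂ) *
      𝓕 (fun x => (f x : ℂ)) ξ)‖ ≤ a ^ m * K m * M ^ (3 / 4 : ℝ) * (1 / 2) ^ n := by
    intro n
    have hK0 : 0 ≤ K m := by positivity
    rcases eq_or_ne (dyadicPiece χ ρ n ((2 * Real.pi) • ξ)) 0 with h0 | h0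
    · rw [h0]
      simp only [Complex.ofReal_zero, zero_mul, mul_zero, norm_zero]
      positivity
    · rw [← (h.integrable_lpBlock hf n).2 ξ, norm_mul, Complex.norm_real,
        Real.norm_of_nonneg (by positivity)]
      calc _ ≤ (a * 2 ^ n) ^ m * (K m * M ^ (3 / 4 : ℝ) * (((2 : ℝ) ^ n) ^ m)⁻¹ * (1 / 2) ^ n) := by
            gcongr
            · exact ha n ξ h0
            · exact (VectorFourier.norm_fourierIntegral_le_integral_norm _ _ _ _ _).trans (hblock n)
        _ = _ := by
            have h1 : (2 : ℝ) ^ n ≠ 0 := by positivity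
            rw [mul_pow]
            field_simp
  have hsum : HasSum (fun n => (((1 + ‖ξ‖) ^ m : ℝ) : ℂ) *
      (((dyadicPiece χ ρ n ((2 * Real.pi) • ξ) : ℝ) : ℂ) * 𝓕 (fun x => (f x : ℂ)) ξ))
      ((((1 + ‖ξ‖) ^ m : ℝ) : ℂ) * (((1 : ℝ) : ℂ) * 𝓕 (fun x => (f x : ℂ)) ξ)) :=
    ((Complex.hasSum_ofReal.2 (h.hasSum_dyadicPiece _)).mul_right _).mul_left _
  have := hsum.norm_le_of_bounded (hasSum_geometric_two.mul_left _) hterm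
  rw [Complex.ofReal_one, one_mul, norm_mul, Complex.norm_real,
    Real.norm_of_nonneg (by positivity)] at this
  linarith

/-- An integrable function with compact support which lies in all Besov spaces `𝒞^α` is a Schwartz
function. The Schwartz seminorms are controlled by a power of the size in the Besov spaces. -/
theorem IsDyadicPartition.exists_schwartzMap_of_besovNorm_le (h : IsDyadicPartition χ ρ) {R J : ℝ}
    (hR : 0 ≤ R) (hJ : 0 ≤ J) (c : ℝ → ℝ≥0) : ∃ D : ℕ → ℕ → ℝ, ∀ (f : Rd d → ℝ) (M : ℝ), 0 ≤ M →
      Integrable f → (∀ᵐ x, R < ‖x‖ → f x = 0) → ∫ x, ‖f x‖ ≤ J →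
      (∀ α, besovNorm χ ρ α f ≤ c α * ENNReal.ofReal M) →
      ∃ φ : 𝓢(Rd d, ℝ), φ =ᵐ[volume] f ∧
        ∀ k n, SchwartzMap.seminorm ℝ k n φ ≤ D k n * M ^ (3 / 4 : ℝ) := by
  obtain ⟨D, hD⟩ := h.exists_fourier_decay hR hJ c
  refine ⟨fun k n => R ^ k * ((2 * Real.pi) ^ n * D (n + (finrank ℝ (Rd d) + 1)) *
    ∫ ξ : Rd d, (1 + ‖ξ‖) ^ (-((finrank ℝ (Rd d) + 1 : ℕ) : ℝ))),
    fun f M hM hf hfR hfJ hfα => ?_⟩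
  obtain ⟨φ, hφ, hb⟩ := exists_schwartzMap_of_fourier_decay hf hR hfR (hD f M hM hf hfR hfJ hfα)
  refine ⟨φ, hφ, fun k n => (hb k n).trans (le_of_eq ?_)⟩
  ring

end LittlewoodPaley

/-! ### Local times -/

section LocalTime

variable {d : ℕ} {T : ℝ} {w : ℝ → Rd d}

namespace IsLocalTime

variable {L L' : ℝ → Rd d → ℝ}

lemma measurable_apply (hL : IsLocalTime T w L) {t : ℝ} (ht : t ∈ Icc 0 T) : Measurable (L t) :=
  hL.measurable.comp (measurable_prodMk_left (x := (⟨t, ht⟩ : Icc (0 : ℝ) T)))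

lemma lintegral_le (hL : IsLocalTime T w L) {t : ℝ} (ht : t ∈ Icc 0 T) :
    ∫⁻ z, ENNReal.ofReal (L t z) ≤ ENNReal.ofReal t := by
  have h := hL.occupation_eq t ht univ MeasurableSet.univ
  rw [Measure.restrict_univ] at h
  rw [← h, occupation]
  refine (measure_mono fun s hs => hs.1 : _ ≤ volume (Icc 0 t)).trans ?_
  rw [Real.volume_Icc, sub_zero]

lemma integrable (hL : IsLocalTime T w L) {t : ℝ} (ht : t ∈ Icc 0 T) : Integrable (L t) :=
  ⟨(hL.measurable_apply ht).aestronglyMeasurable,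
    (hasFiniteIntegral_iff_ofReal (ae_of_all _ (hL.nonneg t ht))).2
      ((hL.lintegral_le ht).trans_lt ENNReal.ofReal_lt_top)⟩

lemma integral_norm_le (hL : IsLocalTime T w L) {t : ℝ} (ht : t ∈ Icc 0 T) :
    ∫ z, ‖L t z‖ ≤ T := by
  have e : ∫ z, ‖L t z‖ = ∫ z, L t z :=
    integral_congr_ae (ae_of_all _ fun z => Real.norm_of_nonneg (hL.nonneg t ht z))
  rw [e, integral_eq_lintegral_of_nonneg_ae (ae_of_all _ (hL.nonneg t ht))
    (hL.integrable ht).aestronglyMeasurable]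
  exact (ENNReal.toReal_le_of_le_ofReal ht.1 (hL.lintegral_le ht)).trans ht.2

lemma ae_eq_zero (hL : IsLocalTime T w L) {R : ℝ} (hR : ∀ s ∈ Icc 0 T, ‖w s‖ ≤ R) {t : ℝ}
    (ht : t ∈ Icc 0 T) : ∀ᵐ z, R < ‖z‖ → L t z = 0 := by
  have hm : MeasurableSet {z : Rd d | R < ‖z‖} := measurableSet_lt measurable_const measurable_norm
  have h := hL.occupation_eq t ht _ hm
  have h0 : occupation w t {z | R < ‖z‖} = 0 := by
    have : {s : ℝ | s ∈ Icc 0 t ∧ w s ∈ {z : Rd d | R < ‖z‖}} = ∅ := by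
      refine eq_empty_of_forall_notMem fun s hs => ?_
      exact absurd (hR s ⟨hs.1.1, hs.1.2.trans ht.2⟩) (not_le.2 hs.2)
    rw [occupation, this, measure_empty]
  rw [h0, eq_comm, lintegral_eq_zero_iff (hL.measurable_apply ht).ennreal_ofReal,
    EventuallyEq, ae_restrict_iff' hm] at h
  filter_upwards [h] with z hz hzR
  exact le_antisymm (ENNReal.ofReal_eq_zero.1 (hz hzR)) (hL.nonneg t ht z)

/-- The local time is unique up to null sets. -/
lemma ae_eq (hL : IsLocalTime T w L) (hL' : IsLocalTime T w L') {t : ℝ} (ht : t ∈ Icc 0 T) :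
    L t =ᵐ[volume] L' t := by
  have h := ae_eq_of_forall_setLIntegral_eq_of_sigmaFinite (μ := volume)
    (hL.measurable_apply ht).ennreal_ofReal (hL'.measurable_apply ht).ennreal_ofReal
    fun A hA _ => (hL.occupation_eq t ht A hA).symm.trans (hL'.occupation_eq t ht A hA)
  filter_upwards [h] with z hz
  exact (ENNReal.ofReal_eq_ofReal_iff (hL.nonneg t ht z) (hL'.nonneg t ht z)).1 hz

end IsLocalTime

/-- The Schwartz functions `φ t`, `t ∈ [0,T]`, are a version of the local time of `w`, and
`φ` is `γ`-Hölder continuous in all Schwartz seminorms. -/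
structure IsSchwartzLocalTime (γ T : ℝ) (w : ℝ → Rd d) (φ : ℝ → 𝓢(Rd d, ℝ)) : Prop where
  version : ∃ L, IsLocalTime T w L ∧ ∀ t ∈ Icc 0 T, φ t =ᵐ[volume] L t
  holder : ∀ k n, ∃ C, ∀ s t, 0 ≤ s → s ≤ t → t ≤ T →
    SchwartzMap.seminorm ℝ k n (φ t - φ s) ≤ C * (t - s) ^ γ

lemma schwartzMap_eq_of_ae_eq {V : Type*} [NormedAddCommGroup V] [NormedSpace ℝ V]
    [MeasurableSpace V] {μ : Measure V} [μ.IsOpenPosMeasure] {φ ψ : 𝓢(V, ℝ)} (h : φ =ᵐ[μ] ψ) :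
    φ = ψ :=
  DFunLike.coe_injective ((φ.continuous.ae_eq_iff_eq μ ψ.continuous).1 h)

/-- The path is bounded, so all increments of L are supported in one ball, up to null sets. The
Hölder exponent 9/10 is chosen so that 9/10 · 3/4 = 27/40 exceeds 1/2. -/
theorem InfinitelyRegularizing.exists_schwartzLocalTime {χ ρ : Rd d → ℝ}
    (hχρ : IsDyadicPartition χ ρ) (hT : 0 ≤ T) (hw : ContinuousOn w (Icc 0 T))
    (hreg : InfinitelyRegularizing χ ρ T w) : ∃ φ, IsSchwartzLocalTime (27 / 40) T w φ := by
  obtain ⟨L, hL, hB⟩ := hreg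
  obtain ⟨R, hR⟩ := isCompact_Icc.exists_bound_of_continuousOn hw
  have hR0 : 0 ≤ R := (norm_nonneg _).trans (hR 0 ⟨le_rfl, hT⟩)
  choose c hc using fun α => (hB (9 / 10) (by norm_num) α).2
  obtain ⟨D, hD⟩ := hχρ.exists_schwartzMap_of_besovNorm_le hR0 (J := 2 * T) (by positivity) c
  have key : ∀ s ∈ Icc 0 T, ∀ t ∈ Icc 0 T, ∃ φ : 𝓢(Rd d, ℝ),
      φ =ᵐ[volume] (fun z => L t z - L s z) ∧
        ∀ k n, SchwartzMap.seminorm ℝ k n φ ≤ D k n * (|t - s| ^ (9 / 10 : ℝ)) ^ (3 / 4 : ℝ) := by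
    intro s hs t ht
    refine hD _ _ (by positivity) ((hL.integrable ht).sub (hL.integrable hs)) ?_ ?_
      fun α => hc α s hs t ht
    · filter_upwards [hL.ae_eq_zero hR hs, hL.ae_eq_zero hR ht] with z h1 h2 h3
      rw [h1 h3, h2 h3, sub_zero]
    · calc ∫ z, ‖L t z - L s z‖ ≤ ∫ z, (‖L t z‖ + ‖L s z‖) :=
            integral_mono_of_nonneg (ae_of_all _ fun z => norm_nonneg _)
              ((hL.integrable ht).norm.add (hL.integrable hs).norm)
              (ae_of_all _ fun z => norm_sub_le _ _)
        _ ≤ 2 * T := by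
            rw [integral_add (hL.integrable ht).norm (hL.integrable hs).norm]
            linarith [hL.integral_norm_le ht, hL.integral_norm_le hs]
  have hφ : ∀ t, ∃ φ : 𝓢(Rd d, ℝ), t ∈ Icc 0 T → φ =ᵐ[volume] L t := by
    intro t
    by_cases ht : t ∈ Icc 0 T
    · obtain ⟨φ, hφ, -⟩ := key 0 ⟨le_rfl, hT⟩ t ht
      refine ⟨φ, fun _ => ?_⟩
      simpa only [hL.zero, sub_zero] using hφ
    · exact ⟨0, fun h => absurd h ht⟩
  choose φ hφ using hφ
  refine ⟨φ, ⟨L, hL, hφ⟩, fun k n => ⟨D k n, fun s t hs hst ht => ?_⟩⟩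
  have ms : s ∈ Icc 0 T := ⟨hs, hst.trans ht⟩
  have mt : t ∈ Icc 0 T := ⟨hs.trans hst, ht⟩
  obtain ⟨ψ, hψ, hb⟩ := key s ms t mt
  have e : φ t - φ s = ψ := by
    refine schwartzMap_eq_of_ae_eq (μ := volume) ?_
    filter_upwards [hψ, hφ t mt, hφ s ms] with z h1 h2 h3
    rw [h1, sub_apply, h2, h3]
  rw [e]
  refine (hb k n).trans (le_of_eq ?_)
  rw [abs_of_nonneg (by linarith), ← Real.rpow_mul (by linarith)]
  norm_num

/-- The field `T^w_t b (x) = ⟨b, φ_t(· - x)⟩`. -/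
def averagedField (b : 𝓢(Rd d, ℝ) →L[ℝ] Rd d) (φ : ℝ → 𝓢(Rd d, ℝ)) (t : ℝ) (x : Rd d) : Rd d :=
  b ((φ t).compSubConstCLM ℝ x)

namespace IsSchwartzLocalTime

variable {γ : ℝ} {φ : ℝ → 𝓢(Rd d, ℝ)} (b : 𝓢(Rd d, ℝ) →L[ℝ] Rd d)

/-- Divided by (t - s)^γ, the increments of φ form a family bounded in all Schwartz seminorms. Its
pairing with b is therefore smooth in the translation. -/
theorem exists_isSmoothField (h : IsSchwartzLocalTime γ T w φ) :
    ∃ H, IsSmoothField γ T (averagedField b φ) H := by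
  have hg : IsBoundedFamily fun p : TimePair T =>
      ((p.1.2 - p.1.1) ^ γ)⁻¹ • (φ p.1.2 - φ p.1.1) := by
    intro k n
    obtain ⟨C, hC⟩ := h.holder k n
    refine ⟨C, fun p => ?_⟩
    have hp : 0 < (p.1.2 - p.1.1) ^ γ := Real.rpow_pos_of_pos (sub_pos.2 p.2.2.1) _
    rw [map_smul_eq_mul, norm_inv, Real.norm_of_nonneg hp.le, inv_mul_le_iff₀ hp, mul_comm]
    exact hC _ _ p.2.1 p.2.2.1.le p.2.2.2
  refine ⟨translatePairing b hg, contDiff_translatePairing b hg, fun p x => ?_⟩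
  have hp : 0 < (p.1.2 - p.1.1) ^ γ := Real.rpow_pos_of_pos (sub_pos.2 p.2.2.1) _
  rw [translatePairing_apply, map_smul, map_smul, smul_inv_smul₀ hp.ne', map_sub, map_sub]
  rfl

lemma ae_eq_translate (x : Rd d) {f g : Rd d → ℝ} (h : f =ᵐ[volume] g) :
    (fun z => f (z - x)) =ᵐ[volume] fun z => g (z - x) :=
  (measurePreserving_sub_right volume x).quasiMeasurePreserving.ae_eq_comp h

lemma isAveragingOperator (h : IsSchwartzLocalTime γ T w φ) :
    IsAveragingOperator T w b (averagedField b φ) := by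
  obtain ⟨L, hL, hφ⟩ := h.version
  exact ⟨L, hL, fun t ht x => ⟨(φ t).compSubConstCLM ℝ x, ae_eq_translate x (hφ t ht), rfl⟩⟩

/-- The averaging operator is unique. -/
lemma eq_averagedField (h : IsSchwartzLocalTime γ T w φ) {b : 𝓢(Rd d, ℝ) →L[ℝ] Rd d}
    {A : ℝ → Rd d → Rd d} (hA : IsAveragingOperator T w b A) {t : ℝ} (ht : t ∈ Icc 0 T)
    (x : Rd d) : A t x = averagedField b φ t x := by
  obtain ⟨L, hL, hφ⟩ := h.version
  obtain ⟨L', hL', hA⟩ := hA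
  obtain ⟨ψ, hψ, e⟩ := hA t ht x
  rw [e, averagedField]
  congr 1
  refine schwartzMap_eq_of_ae_eq (μ := volume) (hψ.trans ?_)
  exact ae_eq_translate x ((hL'.ae_eq hL ht).trans (hφ t ht).symm)

end IsSchwartzLocalTime

end LocalTime

/-! ### The perturbed equation and the Young equation -/

section Equivalence

variable {E : Type*} [NormedAddCommGroup E] [NormedSpace ℝ E] {γ T : ℝ} {Y : ℝ → E → E}

/-- The defect compares the increments over [u,t] at the points θ u and θ s. The Lipschitz bound
contributes one factor of order γ, the Hölder continuity of θ another. This is the condition under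
which the Young integral is defined. -/
lemma IsSmoothField.exists_defect_bound [FiniteDimensional ℝ E]
    {H : E → BoundedContinuousFunction (TimePair T) E}
    (hY : IsSmoothField γ T Y H) (hγ : 0 < γ) {τ R N : ℝ} (hτ : τ ≤ T) {θ : ℝ → E} (hN : 0 ≤ N)
    (hR : ∀ t ∈ Icc 0 τ, ‖θ t‖ ≤ R)
    (hθ : ∀ s t, 0 ≤ s → s ≤ t → t ≤ τ → ‖θ t - θ s‖ ≤ N * (t - s) ^ γ) :
    ∃ C, 0 ≤ C ∧ ∀ s u t, 0 ≤ s → s ≤ u → u ≤ t → t ≤ τ →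
      ‖(Y t (θ s) - Y s (θ s)) - (Y u (θ s) - Y s (θ s)) - (Y t (θ u) - Y u (θ u))‖ ≤
        C * (t - s) ^ (2 * γ) := by
  obtain ⟨Y', K, L, M, -, hF, hYY', -⟩ := hY.exists_cutoff R
  have hL0 := hF.nonneg_L
  refine ⟨L * N, by positivity, fun s u t hs hsu hut ht => ?_⟩
  have hRs := hR s ⟨hs, by linarith⟩
  have hRu := hR u ⟨by linarith, by linarith⟩
  have h1 := hF.lip u t (by linarith) hut (by linarith) (θ s) trivial (θ u) trivial
  rw [hYY' _ _ hRs, hYY' _ _ hRs, hYY' _ _ hRu, hYY' _ _ hRu] at h1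
  have h2 := hθ s u hs hsu (by linarith)
  have e : (Y t (θ s) - Y s (θ s)) - (Y u (θ s) - Y s (θ s)) - (Y t (θ u) - Y u (θ u)) =
      -((Y t (θ u) - Y u (θ u)) - (Y t (θ s) - Y u (θ s))) := by abel
  have q1 : (t - u) ^ γ ≤ (t - s) ^ γ := Real.rpow_le_rpow (by linarith) (by linarith) hγ.le
  have q2 : (u - s) ^ γ ≤ (t - s) ^ γ := Real.rpow_le_rpow (by linarith) (by linarith) hγ.le
  have q3 : 0 ≤ (t - u) ^ γ := Real.rpow_nonneg (by linarith) _
  have q4 : 0 ≤ (u - s) ^ γ := Real.rpow_nonneg (by linarith) _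
  have q5 : 0 ≤ (t - s) ^ γ := q3.trans q1
  rw [e, norm_neg]
  calc _ ≤ L * (N * (u - s) ^ γ) * (t - u) ^ γ := h1.trans (by gcongr)
    _ ≤ L * (N * (t - s) ^ γ) * (t - s) ^ γ := by gcongr
    _ = L * N * ((t - s) ^ γ * (t - s) ^ γ) := by ring
    _ = _ := by rw [rpow_mul_rpow_self (by linarith) hγ.le]

variable {d : ℕ} {w : ℝ → Rd d} {φ : ℝ → 𝓢(Rd d, ℝ)} {b : 𝓢(Rd d, ℝ) →L[ℝ] Rd d}

lemma rpow_le_rpow_mul_rpow_sub {r T β γ : ℝ} (hr : 0 ≤ r) (hrT : r ≤ T) (hγ : 0 < γ)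
    (hβ : γ ≤ β) : r ^ β ≤ T ^ (β - γ) * r ^ γ := by
  have e : r ^ β = r ^ (β - γ) * r ^ γ := by
    rw [← Real.rpow_add' hr (by linarith), sub_add_cancel]
  rw [e]
  gcongr

/-- Solutions of the perturbed equation correspond to solutions of the Young equation for the
averaged field. -/
theorem IsSchwartzLocalTime.isSolution_iff (h : IsSchwartzLocalTime γ T w φ) (hγ : 1 / 2 < γ)
    (hγ1 : γ ≤ 1) (hw : ContinuousOn w (Icc 0 T)) {τ : ℝ} (hτ : τ ∈ Icc 0 T) {x : Rd d}
    {y : ℝ → Rd d} : IsSolution T w b x τ y ↔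
      IsYoungSolution (averagedField b φ) γ 0 τ x fun t => y t - w t := by
  obtain ⟨H, hY⟩ := h.exists_isSmoothField b
  have hwτ : ContinuousOn w (Icc 0 τ) := hw.mono (Icc_subset_Icc_right hτ.2)
  set θ : ℝ → Rd d := fun t => y t - w t with hθ
  constructor
  · rintro ⟨hy, -, A, hA, h0, β, hβ, C, -, hC⟩
    have hAY : ∀ t ∈ Icc 0 τ, ∀ z, A t z = averagedField b φ t z := fun t ht z =>
      h.eq_averagedField hA ⟨ht.1, ht.2.trans hτ.2⟩ z
    obtain ⟨R, hR⟩ : ∃ R, ∀ t ∈ Icc 0 τ, ‖θ t‖ ≤ R :=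
      isCompact_Icc.exists_bound_of_continuousOn (hy.sub hwτ)
    have hC' : ∀ s t, 0 ≤ s → s ≤ t → t ≤ τ →
        ‖θ t - θ s - (averagedField b φ t (θ s) - averagedField b φ s (θ s))‖ ≤
          C * (t - s) ^ β := by
      intro s t hs hst ht
      have := hC s t hs hst ht
      beta_reduce at this
      rwa [hAY t ⟨hs.trans hst, ht⟩, hAY s ⟨hs, hst.trans ht⟩, sub_sub_sub_cancel_right] at this
    obtain ⟨Y', K, L, M, -, hF, hYY', -⟩ := hY.exists_cutoff R
    have hK0 := hF.nonneg_K
    have hT0 : 0 ≤ T := hτ.1.trans hτ.2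
    -- The definition of a solution provides only some β > 1. As β ≥ γ, this already makes θ Hölder
    -- continuous of order γ, and sewing then improves the exponent to 2γ.
    set N := K + |C| * T ^ (β - γ) with hN
    have hN0 : 0 ≤ N := by positivity
    have hθN : ∀ s t, 0 ≤ s → s ≤ t → t ≤ τ → ‖θ t - θ s‖ ≤ N * (t - s) ^ γ := by
      intro s t hs hst ht
      have h1 := hF.growth s t hs hst (ht.trans hτ.2) (θ s) trivial
      have hRs := hR s ⟨hs, hst.trans ht⟩
      rw [hYY' _ _ hRs, hYY' _ _ hRs] at h1
      have h2 := hC' s t hs hst ht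
      have h3 : C * (t - s) ^ β ≤ |C| * (T ^ (β - γ) * (t - s) ^ γ) :=
        mul_le_mul (le_abs_self C)
          (rpow_le_rpow_mul_rpow_sub (by linarith) (by linarith [hτ.2]) (by linarith)
            (by linarith)) (Real.rpow_nonneg (by linarith) _) (abs_nonneg _)
      have h4 := norm_le_norm_sub_add (θ t - θ s)
        (averagedField b φ t (θ s) - averagedField b φ s (θ s))
      rw [hN]
      linarith
    obtain ⟨C₂, hC₂0, hC₂⟩ := hY.exists_defect_bound (by linarith) hτ.2 hN0 hR hθN
    refine ⟨sub_eq_zero.1 h0, ⟨R, hR⟩, _, sewing_bound (R := fun s t => θ t - θ s -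
      (averagedField b φ t (θ s) - averagedField b φ s (θ s))) (by linarith) hβ hC₂0 hC' ?_⟩
    intro s u t hs hsu hut ht
    refine le_trans (le_of_eq ?_) (hC₂ s u t hs hsu hut ht)
    rw [← norm_neg]
    congr 1
    abel
  · intro hsol
    obtain ⟨R, hR⟩ := hsol.bounded
    obtain ⟨N, hN0, hN⟩ := hY.exists_holder_of_solution (by linarith) le_rfl hτ.1 hτ.2 hsol
    obtain ⟨C₂, hC₂0, hC₂⟩ := hY.exists_defect_bound (by linarith) hτ.2 hN0 hR hN
    obtain ⟨C, hC⟩ := hsol.davie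
    have hθc : ContinuousOn θ (Icc 0 τ) := continuousOn_of_holder (by linarith) hN
    refine ⟨(hθc.add hwτ).congr fun t _ => (sub_add_cancel (y t) (w t)).symm,
      ⟨N.toNNReal, γ.toNNReal, by rw [Real.toNNReal_pos]; linarith, ?_⟩, averagedField b φ,
      h.isAveragingOperator b, sub_eq_zero.2 hsol.initial, 2 * γ, by linarith, max C C₂,
      fun s u t hs hsu hut ht => (hC₂ s u t hs hsu hut ht).trans ?_, fun s t hs hst ht => ?_⟩
    · have hle : ∀ s ∈ Icc 0 τ, ∀ t ∈ Icc 0 τ, s ≤ t →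
          edist (θ s) (θ t) ≤ N.toNNReal * edist s t ^ (γ.toNNReal : ℝ) := by
        intro s hs t ht hst
        rw [edist_comm, edist_comm s t, edist_dist, edist_dist, dist_eq_norm, Real.dist_eq,
          abs_of_nonneg (by linarith), Real.coe_toNNReal _ (by linarith),
          ENNReal.ofReal_rpow_of_nonneg (by linarith) (by linarith)]
        change _ ≤ ENNReal.ofReal N * _
        rw [← ENNReal.ofReal_mul hN0]
        exact ENNReal.ofReal_le_ofReal (hN s t hs.1 hst ht.2)
      intro s hs t ht
      rcases le_total s t with hst | hst
      · exact hle s hs t ht hst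
      · rw [edist_comm, edist_comm s t]
        exact hle t ht s hs hst
    · exact mul_le_mul_of_nonneg_right (le_max_right _ _) (Real.rpow_nonneg (by linarith) _)
    · rw [sub_sub_sub_cancel_right]
      refine (hC s t hs hst ht).trans ?_
      exact mul_le_mul_of_nonneg_right (le_max_left _ _) (Real.rpow_nonneg (by linarith) _)

end Equivalence

/-! ### Maximal solutions -/

section Maximal

open Classical in
/-- The explosion time of the solution which starts in `x`, which is infinite if there is a solution
on `[0,T]`. -/
def explosionTime {E : Type*} [NormedAddCommGroup E] (Y : ℝ → E → E) (γ T : ℝ) (x : E) : ℝ≥0∞ :=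
  if ∃ θ, IsYoungSolution Y γ 0 T x θ then ⊤
  else ENNReal.ofReal (sSup {τ | τ ∈ Icc 0 T ∧ ∃ θ, IsYoungSolution Y γ 0 τ x θ})

open Classical in
/-- The maximal solution, glued from the solutions on the intervals `[0,t]`. -/
def maximalSolution {E : Type*} [NormedAddCommGroup E] (Y : ℝ → E → E) (γ : ℝ) (x : E) (t : ℝ) : E :=
  if h : ∃ θ, IsYoungSolution Y γ 0 t x θ then h.choose t else 0

lemma exists_isYoungSolution_zero {E : Type*} [NormedAddCommGroup E] (Y : ℝ → E → E) (γ : ℝ) (x : E) :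
    ∃ θ, IsYoungSolution Y γ 0 0 x θ := by
  refine ⟨fun _ => x, rfl, ⟨‖x‖, fun _ _ => le_rfl⟩, 0, fun s t hs hst ht => ?_⟩
  obtain rfl : s = t := by linarith
  simp

variable {E : Type*} [NormedAddCommGroup E] [NormedSpace ℝ E] [FiniteDimensional ℝ E] {γ T : ℝ}
  {Y : ℝ → E → E} {H : E → BoundedContinuousFunction (TimePair T) E}

namespace IsSmoothField

/-- Every solution on [0,τ] with τ < T extends to a longer interval. So if there is none on [0,T],
the supremum of the existence times is not attained, and the inequality is strict. -/
lemma lt_explosionTime_iff (hY : IsSmoothField γ T Y H) (hγ : 1 / 2 < γ) {x : E} {τ : ℝ}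
    (hτ : τ ∈ Icc 0 T) :
    ENNReal.ofReal τ < explosionTime Y γ T x ↔ ∃ θ, IsYoungSolution Y γ 0 τ x θ := by
  have hbdd : BddAbove {τ | τ ∈ Icc 0 T ∧ ∃ θ, IsYoungSolution Y γ 0 τ x θ} :=
    ⟨T, fun _ h => h.1.2⟩
  rw [explosionTime]
  split_ifs with hT
  · exact ⟨fun _ => hT.imp fun _ h => h.mono hτ.2, fun _ => ENNReal.ofReal_lt_top⟩
  rw [ENNReal.ofReal_lt_ofReal_iff_of_nonneg hτ.1]
  constructor
  · intro h
    have hne : {τ | τ ∈ Icc 0 T ∧ ∃ θ, IsYoungSolution Y γ 0 τ x θ}.Nonempty :=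
      ⟨0, ⟨le_rfl, hτ.1.trans hτ.2⟩, exists_isYoungSolution_zero Y γ x⟩
    obtain ⟨τ', ⟨-, θ, hθ⟩, h'⟩ := exists_lt_of_lt_csSup hne h
    exact ⟨θ, hθ.mono h'.le⟩
  · rintro ⟨θ, hθ⟩
    have hlt : τ < T := hτ.2.lt_of_ne fun e => hT ⟨θ, e ▸ hθ⟩
    obtain ⟨τ', -, hτ'T, hlt', ε, hε, C, -, hsol⟩ := hY.exists_solution_nearby hγ hτ.1 hτ.2 hθ
    obtain ⟨θ', hθ', -⟩ := hsol x (Metric.mem_ball_self hε)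
    exact (hlt' hlt).trans_le (le_csSup hbdd ⟨⟨hτ.1.trans (hlt' hlt).le, hτ'T⟩, θ', hθ'⟩)

lemma explosionTime_pos (hY : IsSmoothField γ T Y H) (hγ : 1 / 2 < γ) (hT : 0 ≤ T) (x : E) :
    0 < explosionTime Y γ T x := by
  have := (hY.lt_explosionTime_iff hγ ⟨le_rfl, hT⟩).2 (exists_isYoungSolution_zero Y γ x)
  rwa [ENNReal.ofReal_zero] at this

lemma isYoungSolution_maximalSolution (hY : IsSmoothField γ T Y H) (hγ : 1 / 2 < γ) {x : E} {τ : ℝ}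
    (hτ : τ ∈ Icc 0 T) (hlt : ENNReal.ofReal τ < explosionTime Y γ T x) :
    IsYoungSolution Y γ 0 τ x (maximalSolution Y γ x) := by
  obtain ⟨θ, hθ⟩ := (hY.lt_explosionTime_iff hγ hτ).1 hlt
  refine hθ.congr hτ.1 fun t ht => ?_
  have h : ∃ θ, IsYoungSolution Y γ 0 t x θ := ⟨θ, hθ.mono ht.2⟩
  rw [maximalSolution, dif_pos h]
  exact hY.eqOn_of_solution hγ le_rfl (ht.2.trans hτ.2) (hθ.mono ht.2) h.choose_spec ⟨ht.1, le_rfl⟩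

/-- A finite explosion time cannot exceed T, since existence on [0,T] makes it infinite by
definition. There is no solution up to and including it, so the blow-up criterion applies. -/
lemma tendsto_norm_maximalSolution (hY : IsSmoothField γ T Y H) (hγ : 1 / 2 < γ) (hT : 0 ≤ T)
    {x : E} (hx : explosionTime Y γ T x < ⊤) : 0 < (explosionTime Y γ T x).toReal ∧
      (explosionTime Y γ T x).toReal ≤ T ∧ Tendsto (fun t => ‖maximalSolution Y γ x t‖)
        (𝓝[<] (explosionTime Y γ T x).toReal) atTop := by
  set σ := (explosionTime Y γ T x).toReal with hσ
  have e : explosionTime Y γ T x = ENNReal.ofReal σ := (ENNReal.ofReal_toReal hx.ne).symm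
  have hσ0 : 0 < σ := ENNReal.toReal_pos (hY.explosionTime_pos hγ hT x).ne' hx.ne
  have hσT : σ ≤ T := by
    by_contra! h
    have hlt : ENNReal.ofReal T < explosionTime Y γ T x := by
      rw [e]
      exact (ENNReal.ofReal_lt_ofReal_iff hσ0).2 h
    have := (hY.lt_explosionTime_iff hγ ⟨hT, le_rfl⟩).1 hlt
    rw [explosionTime, if_pos this] at hx
    exact hx.ne rfl
  refine ⟨hσ0, hσT, hY.tendsto_norm_atTop_of_not_exists (x := x) hγ hσ0 hσT (fun τ hτ => ?_) fun h => ?_⟩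
  · refine hY.isYoungSolution_maximalSolution hγ ⟨hτ.1, hτ.2.le.trans hσT⟩ ?_
    rw [e]
    exact (ENNReal.ofReal_lt_ofReal_iff hσ0).2 hτ.2
  · have := (hY.lt_explosionTime_iff hγ ⟨hσ0.le, hσT⟩).2 h
    exact absurd this (by rw [e]; exact lt_irrefl _)

lemma explosionTime_le_or_eq_top (hY : IsSmoothField γ T Y H) (hγ : 1 / 2 < γ) (hT : 0 ≤ T) (x : E) :
    explosionTime Y γ T x ≤ ENNReal.ofReal T ∨ explosionTime Y γ T x = ⊤ := by
  rcases eq_or_ne (explosionTime Y γ T x) ⊤ with h | h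
  · exact Or.inr h
  · exact Or.inl (ENNReal.le_ofReal_iff_toReal_le h hT |>.2
      (hY.tendsto_norm_maximalSolution hγ hT h.lt_top).2.1)

/-- The trivial solution on [0,0] extends, together with its neighbours, to a common positive time.
-/
lemma exists_inv_explosionTime_le (hY : IsSmoothField γ T Y H) (hγ : 1 / 2 < γ) (hT : 0 < T)
    (x : E) : ∃ C : ℝ≥0, ∀ᶠ x' in 𝓝 x, (explosionTime Y γ T x')⁻¹ ≤ C := by
  obtain ⟨θ, hθ⟩ := exists_isYoungSolution_zero Y γ x
  obtain ⟨τ, -, hτT, hlt, ε, hε, C, -, hsol⟩ := hY.exists_solution_nearby hγ le_rfl hT.le hθ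
  have hτ : 0 < τ := hlt hT
  refine ⟨(τ.toNNReal)⁻¹, ?_⟩
  filter_upwards [Metric.ball_mem_nhds x hε] with x' hx'
  obtain ⟨θ', hθ', -⟩ := hsol x' hx'
  rw [ENNReal.coe_inv (Real.toNNReal_pos.2 hτ).ne', ENNReal.inv_le_inv]
  exact ((hY.lt_explosionTime_iff hγ ⟨hτ.le, hτT⟩).2 ⟨θ', hθ'⟩).le

/-- The flow is a smooth function of the initial value, with values in the continuous functions. -/
theorem exists_contDiffOn_flow (hY : IsSmoothField γ T Y H) (hγ : 1 / 2 < γ) {τ : ℝ} (hτ : τ ∈ Icc 0 T) {U : Set E} (hU : IsOpen U)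
    (hlt : ∀ x ∈ U, ENNReal.ofReal τ < explosionTime Y γ T x) :
    ∃ Ψ : E → C(Icc (0 : ℝ) τ, E),
      (∀ x ∈ U, ∀ t : Icc (0 : ℝ) τ, Ψ x t = maximalSolution Y γ x t) ∧ ContDiffOn ℝ ∞ Ψ U := by
  have hex : ∀ x, ∃ f : C(Icc (0 : ℝ) τ, E), x ∈ U → ∀ t, f t = maximalSolution Y γ x t := by
    intro x
    by_cases hx : x ∈ U
    · obtain ⟨f, hf⟩ := hY.exists_continuousMap_of_solution (by linarith) hτ.1 hτ.2
        (hY.isYoungSolution_maximalSolution hγ hτ (hlt x hx))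
      exact ⟨f, fun _ => hf⟩
    · exact ⟨0, fun h => absurd h hx⟩
  choose Ψ hΨ using hex
  refine ⟨Ψ, hΨ, contDiffOn_infty.2 fun n =>
    contDiffOn_flow hγ hτ.1 hτ.2 n hY hU fun x hx => ?_⟩
  refine (hY.isYoungSolution_maximalSolution hγ hτ (hlt x hx)).congr hτ.1 fun t ht => ?_
  rw [hΨ x hx, projIcc_of_mem hτ.1 ht]

end IsSmoothField

end Maximal

end RegularizedODE

end

/-! ### The theorem: return from θ to y = θ + w -/

theorem theorem1p2 (d : ℕ) (χ ρ : RegularizedODE.Rd d → ℝ)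
    (hχρ : RegularizedODE.IsDyadicPartition χ ρ)
    (T : ℝ) (hT : 0 < T) (w : ℝ → RegularizedODE.Rd d) (hw : ContinuousOn w (Set.Icc 0 T))
    (hreg : RegularizedODE.InfinitelyRegularizing χ ρ T w)
    (b : 𝓢(RegularizedODE.Rd d, ℝ) →L[ℝ] RegularizedODE.Rd d) :
    ∃ (Tstar : RegularizedODE.Rd d → ℝ≥0∞)
      (y : RegularizedODE.Rd d → ℝ → RegularizedODE.Rd d),
      -- `T*(x) ∈ (0,T] ∪ {∞}`
      (∀ x, 0 < Tstar x ∧ (Tstar x ≤ ENNReal.ofReal T ∨ Tstar x = ⊤)) ∧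
      -- existence and uniqueness on `[0,T*(x)) ∩ [0,T]`
      (∀ x, RegularizedODE.SolvesOn T w b x
          (RegularizedODE.existenceInterval T (Tstar x)) (y x) ∧
        ∀ z : ℝ → RegularizedODE.Rd d,
          RegularizedODE.SolvesOn T w b x (RegularizedODE.existenceInterval T (Tstar x)) z →
          Set.EqOn z (y x) (RegularizedODE.existenceInterval T (Tstar x))) ∧
      -- maximality: every solution on some `[0,τ]` is a restriction of `y x`
      (∀ x, ∀ τ ∈ Set.Icc 0 T, ∀ z : ℝ → RegularizedODE.Rd d,
        RegularizedODE.IsSolution T w b x τ z →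
        τ ∈ RegularizedODE.existenceInterval T (Tstar x) ∧ Set.EqOn z (y x) (Set.Icc 0 τ)) ∧
      -- blow-up
      (∀ x, Tstar x < ⊤ → Tendsto (fun t => ‖y x t‖) (𝓝[<] (Tstar x).toReal) atTop) ∧
      -- `x ↦ T*(x)⁻¹` is locally bounded
      (∀ x, ∃ C : ℝ≥0, ∀ᶠ x' in 𝓝 x, (Tstar x')⁻¹ ≤ C) ∧
      -- smoothness of the flow with values in `C([0,τ], ℝ^d)`
      (∀ τ ∈ Set.Icc 0 T, ∀ U : Set (RegularizedODE.Rd d), IsOpen U →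
        (∀ x ∈ U, ENNReal.ofReal τ < Tstar x) →
        ∃ Φ : RegularizedODE.Rd d → C(Set.Icc (0 : ℝ) τ, RegularizedODE.Rd d),
          (∀ x ∈ U, ∀ t : Set.Icc (0 : ℝ) τ, Φ x t = y x t) ∧ ContDiffOn ℝ ∞ Φ U) := by
  open RegularizedODE in
  obtain ⟨φ, hφ⟩ := hreg.exists_schwartzLocalTime hχρ hT.le hw
  obtain ⟨H, hY⟩ := hφ.exists_isSmoothField b
  have hγ : (1 / 2 : ℝ) < 27 / 40 := by norm_num
  set Y := averagedField b φ with hYdef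
  have hiff : ∀ {τ : ℝ}, τ ∈ Icc 0 T → ∀ {x : Rd d} {y : ℝ → Rd d}, IsSolution T w b x τ y ↔
      IsYoungSolution Y (27 / 40) 0 τ x fun t => y t - w t :=
    fun hτ => hφ.isSolution_iff hγ (by norm_num) hw hτ
  have hmax : ∀ x, ∀ τ ∈ Icc 0 T, ∀ z : ℝ → Rd d, IsSolution T w b x τ z →
      τ ∈ existenceInterval T (explosionTime Y (27 / 40) T x) ∧
        EqOn z (fun t => maximalSolution Y (27 / 40) x t + w t) (Icc 0 τ) := by
    intro x τ hτ z hz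
    have hz' := (hiff hτ).1 hz
    have hlt := (hY.lt_explosionTime_iff hγ hτ).2 ⟨_, hz'⟩
    refine ⟨⟨hτ, hlt⟩, fun t ht => ?_⟩
    exact sub_eq_iff_eq_add.1 (hY.eqOn_of_solution hγ le_rfl hτ.2 hz'
      (hY.isYoungSolution_maximalSolution hγ hτ hlt) ht)
  refine ⟨explosionTime Y (27 / 40) T, fun x t => maximalSolution Y (27 / 40) x t + w t,
    fun x => ⟨hY.explosionTime_pos hγ hT.le x, hY.explosionTime_le_or_eq_top hγ hT.le x⟩,
    fun x => ⟨fun τ hτ => (hiff hτ.1).2 ?_, fun z hz τ hτ =>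
      (hmax x τ hτ.1 z (hz τ hτ)).2 ⟨hτ.1.1, le_rfl⟩⟩, hmax, fun x hx => ?_,
    hY.exists_inv_explosionTime_le hγ hT, fun τ hτ U hU hlt => ?_⟩
  · simpa only [add_sub_cancel_right] using hY.isYoungSolution_maximalSolution hγ hτ.1 hτ.2
  · obtain ⟨h0, hle, hlim⟩ := hY.tendsto_norm_maximalSolution hγ hT.le hx
    obtain ⟨R, hR⟩ := isCompact_Icc.exists_bound_of_continuousOn hw
    -- The path w is bounded on [0,T], so adding it does not affect the explosion.
    refine tendsto_atTop_mono' _ ?_ (tendsto_atTop_add_const_right _ (-R) hlim)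
    filter_upwards [Ioo_mem_nhdsLT h0] with t ht
    have h1 := hR t ⟨ht.1.le, ht.2.le.trans hle⟩
    have h2 := norm_sub_le (maximalSolution Y (27 / 40) x t + w t) (w t)
    rw [add_sub_cancel_right] at h2
    linarith
  · obtain ⟨Ψ, hΨ, hsm⟩ := hY.exists_contDiffOn_flow hγ hτ hU hlt
    -- Passing from θ to y translates the flow by the fixed element w of the space of continuous
    -- functions, which preserves smoothness.
    set W : C(Icc (0 : ℝ) τ, Rd d) :=
      ⟨(Icc 0 τ).domRestrict w, (hw.mono (Icc_subset_Icc_right hτ.2)).domRestrict⟩ with hW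
    refine ⟨fun x => Ψ x + W, fun x hx t => ?_, hsm.add contDiffOn_const⟩
    rw [ContinuousMap.add_apply, hΨ x hx]
    rfl
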